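/- Let $\alpha\in\mathbb R$ with $\sin\alpha\neq0$ and $\cos\alpha\neq0$. Let the circle group $\mathbb S^1$ act on $\mathbb R^3$ by the rotations $R_\theta(x,y,z)=(x\cos\theta-y\sin\theta,\;x\sin\theta+y\cos\theta,\;z)$ about the $OZ$-axis, let $T_\theta f=f\circ R_\theta$ be the shift operators (extended to tempered distributions), and let $$X=\{(x,y,z)\in\mathbb R^3:\,-x\sin\alpha+z\cos\alpha=0\},\qquad i:X\to\mathbb R^3,$$ be the tilted plane and its embedding; $X$ is identified with $\mathbb R^2$ by the coordinates $(u,v)$ with respect to the orthonormal basis $e_1=(\cos\alpha,0,\sin\alpha)$, $e_2=(0,1,0)$. Let $$D=\Delta^{-1}\int_{\mathbb S^1}T_\theta\,d\theta ,$$ where $\Delta^{-1}$ is the Fourier multiplier inverse to the Laplacian of $\mathbb R^3$, and let $i^!(D)=i^*Di_*$ be its trace on $X$, where $i^*$ is the boundary operator (the continuous extension $H^t(\mathbb R^3)\to H^{t-1/2}(X)$, $t>1/2$, of the restriction of functions to $X$, also applied to distributions that are locally in $H^t$) and $i_*$ is the coboundary operator conjugate to restriction, $(i_*f)(\psi)=f(\psi\circ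 i)$. Then: 1. $X\cap OZ=\{(0,0,0)\}$; the set $\widetilde X_{\mathbb S^1}$ of the points $p\in X$ at which the orbit of $p$ is tangent to $X$, i.e. $T_p(\mathbb S^1p)\subset T_pX$, is the line $\{y=0,\ -x\sin\alpha+z\cos\alpha=0\}$; and the set $X_{\mathbb S^1}$ of the points of $X$ whose orbits are contained in $X$ is $\{(0,0,0)\}$. 2. For every $s\in(-1,0)$ the trace is a well-defined operator $i^!(D):H^s_{\mathrm{comp}}(X)\to H^{s+1}_{\mathrm{loc}}(X)$, that is, for all $\varphi,\chi\in C_c^\infty(X)$ the composition $\chi\, i^!(D)\,\varphi:H^s(X)\to H^{s+1}(X)$ is well defined and bounded. It is localized at the point $(0,0,0)$: the operator $$\chi\, i^!(D)\,\varphi:H^s(X)\to H^{s+1}(X)$$ is compact for all $\varphi,\chi\in C_c^\infty(X)$ such that $\varphi$ vanishes in a neighbourhood of $(0,0,0)$. -/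

import Mathlib

open MeasureTheory FourierTransform Topology
open scoped SchwartzMap ContDiff

noncomputable section

/-! ### Sobolev spaces `H^s` as Hilbert spaces of tempered distributions -/

section Sobolev

variable (E : Type*) [NormedAddCommGroup E] [InnerProductSpace ℝ E] [FiniteDimensional ℝ E]
  [MeasurableSpace E] [BorelSpace E]

/-- The tempered distributions lying in `H^s(E)`. -/
def sobolevSubmodule (s : ℝ) : Submodule ℂ 𝓢'(E, ℂ) where
  carrier := {u | TemperedDistribution.MemSobolev s 2 u}
  add_mem' hu hv := hu.add hv
  zero_mem' := TemperedDistribution.memSobolev_fun_zero E ℂ s 2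
  smul_mem' c _ hu := hu.smul c

/-- The Sobolev space `H^s(E)`, with the norm `‖u‖_s = ‖(1 + |ξ|²)^{s/2} 𝓕 u‖_{L²}`. -/
def SobolevSpace (s : ℝ) : Type _ := ↥(sobolevSubmodule E s)

variable {E}

instance SobolevSpace.instAddCommGroup (s : ℝ) : AddCommGroup (SobolevSpace E s) :=
  inferInstanceAs (AddCommGroup ↥(sobolevSubmodule E s))

instance SobolevSpace.instModule (s : ℝ) : Module ℂ (SobolevSpace E s) :=
  inferInstanceAs (Module ℂ ↥(sobolevSubmodule E s))

/-- The inclusion of `H^s(E)` into the tempered distributions. -/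
def SobolevSpace.toDistr (s : ℝ) : SobolevSpace E s →ₗ[ℂ] 𝓢'(E, ℂ) :=
  (sobolevSubmodule E s).subtype

theorem lp_toTemperedDistribution_injective :
    Function.Injective
      (fun f : Lp ℂ 2 (volume : Measure E) => (f : 𝓢'(E, ℂ))) :=
  LinearMap.ker_eq_bot.mp
    (Lp.ker_toTemperedDistributionCLM_eq_bot (E := E) (F := ℂ) (μ := volume) (p := 2))

/-- The `L²` function which represents the Bessel potential `(1 + |D|²)^{s/2} u` of `u ∈ H^s`. -/
def SobolevSpace.toLp (s : ℝ) : SobolevSpace E s →ₗ[ℂ] Lp ℂ 2 (volume : Measure E) where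
  toFun u := Classical.choose u.2
  map_add' u v := by
    apply lp_toTemperedDistribution_injective
    have h1 := Classical.choose_spec u.2
    have h2 := Classical.choose_spec v.2
    have h3 := Classical.choose_spec (u + v).2
    have h4 : ((Classical.choose u.2 + Classical.choose v.2 : Lp ℂ 2 (volume : Measure E)) :
        𝓢'(E, ℂ)) = (Classical.choose u.2 : Lp ℂ 2 (volume : Measure E))
          + (Classical.choose v.2 : Lp ℂ 2 (volume : Measure E)) :=
      map_add (Lp.toTemperedDistributionCLM ℂ (volume : Measure E) 2) _ _
    change ((Classical.choose (u + v).2 : Lp ℂ 2 (volume : Measure E)) : 𝓢'(E, ℂ)) = _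
    refine Eq.trans ?_ h4.symm
    rw [← h1, ← h2, ← h3]
    exact map_add _ _ _
  map_smul' c u := by
    apply lp_toTemperedDistribution_injective
    have h1 := Classical.choose_spec u.2
    have h3 := Classical.choose_spec (c • u).2
    have h4 : ((c • Classical.choose u.2 : Lp ℂ 2 (volume : Measure E)) : 𝓢'(E, ℂ))
        = c • ((Classical.choose u.2 : Lp ℂ 2 (volume : Measure E)) : 𝓢'(E, ℂ)) :=
      map_smul (Lp.toTemperedDistributionCLM ℂ (volume : Measure E) 2) _ _
    change ((Classical.choose (c • u).2 : Lp ℂ 2 (volume : Measure E)) : 𝓢'(E, ℂ)) = _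
    refine Eq.trans ?_ h4.symm
    rw [← h1, ← h3]
    exact map_smul _ _ _

theorem SobolevSpace.toLp_spec (s : ℝ) (u : SobolevSpace E s) :
    TemperedDistribution.besselPotential E ℂ s (SobolevSpace.toDistr s u) =
      (SobolevSpace.toLp s u : 𝓢'(E, ℂ)) :=
  Classical.choose_spec u.2

theorem SobolevSpace.toLp_injective (s : ℝ) :
    Function.Injective (SobolevSpace.toLp (E := E) s) := by
  intro u v huv
  have h : TemperedDistribution.besselPotential E ℂ s (SobolevSpace.toDistr s u) =
      TemperedDistribution.besselPotential E ℂ s (SobolevSpace.toDistr s v) := by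
    rw [SobolevSpace.toLp_spec, SobolevSpace.toLp_spec, huv]
  have h' := (TemperedDistribution.besselPotential_neg_apply_eq_iff s _ _).mpr h
  rw [TemperedDistribution.besselPotential_besselPotential_apply] at h'
  simp only [add_neg_cancel, TemperedDistribution.besselPotential_zero,
    ContinuousLinearMap.id_apply] at h'
  exact Subtype.ext h'.symm

instance SobolevSpace.instNormedAddCommGroup (s : ℝ) : NormedAddCommGroup (SobolevSpace E s) :=
  NormedAddCommGroup.induced (SobolevSpace E s) (Lp ℂ 2 (volume : Measure E))
    (SobolevSpace.toLp s) (SobolevSpace.toLp_injective s)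

instance SobolevSpace.instNormedSpace (s : ℝ) : NormedSpace ℂ (SobolevSpace E s) :=
  NormedSpace.induced ℂ (SobolevSpace E s) (Lp ℂ 2 (volume : Measure E)) (SobolevSpace.toLp s)

/-- A Schwartz function, as an element of `H^s(E)`. -/
def SobolevSpace.ofSchwartz (s : ℝ) (f : 𝓢(E, ℂ)) : SobolevSpace E s :=
  ⟨(f : 𝓢'(E, ℂ)), f.memSobolev⟩

/-- Smooth compactly supported functions. -/
def IsCutoff (φ : E → ℂ) : Prop := ContDiff ℝ ∞ φ ∧ HasCompactSupport φ

/-- The product `φ u` of a distribution with a smooth compactly supported function. -/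
def cutoffMul (φ : E → ℂ) (u : 𝓢'(E, ℂ)) : 𝓢'(E, ℂ) :=
  TemperedDistribution.smulLeftCLM ℂ φ u

/-- The tempered distribution `U` is given by the function `g`: `U(ψ) = ∫ ψ g`. -/
def IsGivenBy (U : 𝓢'(E, ℂ)) (g : E → ℂ) : Prop :=
  ∀ ψ : 𝓢(E, ℂ), Integrable (fun ξ => ψ ξ * g ξ) ∧ U ψ = ∫ ξ, ψ ξ * g ξ

/-- `V = Δ⁻¹ W`: the inverse of the Laplacian is the Fourier multiplier with the symbol
`-1 / (4π²|ξ|²)`, the inverse of the symbol of `Δ` (for the Fourier transform with the kernel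
`e^{-2πi⟨x,ξ⟩}`). -/
def IsInverseLaplacian (W V : 𝓢'(E, ℂ)) : Prop :=
  ∃ g : E → ℂ, IsGivenBy (𝓕 W) g ∧
    IsGivenBy (𝓕 V) (fun ξ => ((-(4 * Real.pi ^ 2 * ‖ξ‖ ^ 2)⁻¹ : ℝ) : ℂ) * g ξ)

/-- A relation `A f v` between distributions (read: `A f = v`) is an operator
`H^s_comp(E) → H^r_loc(E)`, bounded after multiplication by cut-off functions on both sides. -/
def IsLocalOperator (A : 𝓢'(E, ℂ) → 𝓢'(E, ℂ) → Prop) (s r : ℝ) : Prop :=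
  (∀ f v v', A f v → A f v' → v = v') ∧
  ∀ φ χ : E → ℂ, IsCutoff φ → IsCutoff χ →
    ∃ K : SobolevSpace E s →L[ℂ] SobolevSpace E r, ∀ u : SobolevSpace E s,
      ∃ v, A (cutoffMul φ (SobolevSpace.toDistr s u)) v ∧
        SobolevSpace.toDistr r (K u) = cutoffMul χ v

/-- The operator `A : H^s_comp(E) → H^r_loc(E)` is localized on `Y`: the composition `A φ` is
compact (as an operator `H^s(E) → H^r_loc(E)`, i.e. `χ A φ` is compact for each cut-off
function `χ`) whenever the smooth compactly supported function `φ` vanishes in a neighbourhood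
of `Y`. -/
def IsLocalizedOn (A : 𝓢'(E, ℂ) → 𝓢'(E, ℂ) → Prop) (s r : ℝ) (Y : Set E) : Prop :=
  ∀ φ χ : E → ℂ, IsCutoff φ → IsCutoff χ → (∀ᶠ x in 𝓝ˢ Y, φ x = 0) →
    ∃ K : SobolevSpace E s →L[ℂ] SobolevSpace E r, IsCompactOperator K ∧
      ∀ u : SobolevSpace E s,
        ∃ v, A (cutoffMul φ (SobolevSpace.toDistr s u)) v ∧
          SobolevSpace.toDistr r (K u) = cutoffMul χ v

end Sobolev

/-! ### The plane, the rotations, and the trace of `D` -/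

/-- Euclidean 3-space, with the coordinates `x = p 0`, `y = p 1`, `z = p 2`. -/
abbrev E3 : Type := EuclideanSpace ℝ (Fin 3)

/-- Euclidean plane, with the coordinates `u = q 0`, `v = q 1`. -/
abbrev E2 : Type := EuclideanSpace ℝ (Fin 2)

/-- The plane `X = {-x sin α + z cos α = 0}`. -/
def planeX (α : ℝ) : Submodule ℝ E3 where
  carrier := {p | -(p 0) * Real.sin α + p 2 * Real.cos α = 0}
  add_mem' := by
    intro p q hp hq
    simp only [Set.mem_ofPred_eq, PiLp.add_apply] at *
    linarith
  zero_mem' := by simp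
  smul_mem' := by
    intro c p hp
    simp only [Set.mem_ofPred_eq, PiLp.smul_apply, smul_eq_mul] at *
    linear_combination c * hp

/-- The embedding `i : X → ℝ³` in the coordinates `(u, v)` on `X` with respect to the orthonormal
basis `e₁ = (cos α, 0, sin α)`, `e₂ = (0, 1, 0)` of `X`. -/
def embX (α : ℝ) : E2 →ₗᵢ[ℝ] E3 where
  toFun q := !₂[q 0 * Real.cos α, q 1, q 0 * Real.sin α]
  map_add' p q := by
    ext j; fin_cases j <;> simp [add_mul]
  map_smul' c q := by
    ext j; fin_cases j <;> simp [mul_assoc]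
  norm_map' q := by
    simp only [EuclideanSpace.norm_eq, Fin.sum_univ_three, Fin.sum_univ_two, LinearMap.coe_mk,
      AddHom.coe_mk, Real.norm_eq_abs, sq_abs]
    congr 1
    simp
    linear_combination (q 0) ^ 2 * Real.sin_sq_add_cos_sq α

theorem range_embX (α : ℝ) : Set.range (embX α) = planeX α := by
  ext p
  constructor
  · rintro ⟨q, rfl⟩
    change -(q 0 * Real.cos α) * Real.sin α + (q 0 * Real.sin α) * Real.cos α = 0
    ring
  · intro hp
    have hp' : -(p 0) * Real.sin α + p 2 * Real.cos α = 0 := hp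
    have h := Real.sin_sq_add_cos_sq α
    refine ⟨!₂[p 0 * Real.cos α + p 2 * Real.sin α, p 1], ?_⟩
    ext j
    fin_cases j
    · change (p 0 * Real.cos α + p 2 * Real.sin α) * Real.cos α = p 0
      linear_combination Real.sin α * hp' + p 0 * h
    · rfl
    · change (p 0 * Real.cos α + p 2 * Real.sin α) * Real.sin α = p 2
      linear_combination -Real.cos α * hp' + p 2 * h

/-- The rotation `(x, y, z) ↦ (x cos θ - y sin θ, x sin θ + y cos θ, z)` about the `OZ`-axis. -/
def rotZ (θ : ℝ) : E3 ≃L[ℝ] E3 :=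
  LinearEquiv.toContinuousLinearEquiv
    { toFun := fun p =>
        !₂[p 0 * Real.cos θ - p 1 * Real.sin θ, p 0 * Real.sin θ + p 1 * Real.cos θ, p 2]
      invFun := fun p =>
        !₂[p 0 * Real.cos θ + p 1 * Real.sin θ, -(p 0) * Real.sin θ + p 1 * Real.cos θ, p 2]
      map_add' := fun p q => by
        ext j; fin_cases j <;> simp <;> ring
      map_smul' := fun c q => by
        ext j; fin_cases j <;> simp <;> ring
      left_inv := fun p => by
        have h := Real.sin_sq_add_cos_sq θ
        ext j
        fin_cases j
        · change (p 0 * Real.cos θ - p 1 * Real.sin θ) * Real.cos θ +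
            (p 0 * Real.sin θ + p 1 * Real.cos θ) * Real.sin θ = p 0
          linear_combination p 0 * h
        · change -(p 0 * Real.cos θ - p 1 * Real.sin θ) * Real.sin θ +
            (p 0 * Real.sin θ + p 1 * Real.cos θ) * Real.cos θ = p 1
          linear_combination p 1 * h
        · rfl
      right_inv := fun p => by
        have h := Real.sin_sq_add_cos_sq θ
        ext j
        fin_cases j
        · change (p 0 * Real.cos θ + p 1 * Real.sin θ) * Real.cos θ -
            (-(p 0) * Real.sin θ + p 1 * Real.cos θ) * Real.sin θ = p 0
          linear_combination p 0 * h
        · change (p 0 * Real.cos θ + p 1 * Real.sin θ) * Real.sin θ +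
            (-(p 0) * Real.sin θ + p 1 * Real.cos θ) * Real.cos θ = p 1
          linear_combination p 1 * h
        · rfl }

/-- The `OZ`-axis. -/
def axisOZ : Set E3 := {p | p 0 = 0 ∧ p 1 = 0}

/-- The set `X_G` of the points of `X` whose orbits are contained in `X`. -/
def orbitInSet (α : ℝ) : Set E3 :=
  {p | p ∈ planeX α ∧ Set.range (fun θ => rotZ θ p) ⊆ planeX α}

/-- The set of the points `p` of `X` at which the orbit of `p` is tangent to `X`:
`T_p(Gp) ⊆ T_p X`, where `T_p(Gp)` is spanned by the velocity at `θ = 0` of the curve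
`θ ↦ rotZ θ p`, and `T_p X = X` since `X` is a linear subspace. -/
def orbitTangentSet (α : ℝ) : Set E3 :=
  {p | p ∈ planeX α ∧ Submodule.span ℝ {deriv (fun θ => rotZ θ p) 0} ≤ planeX α}

/-- The restriction `ψ ↦ ψ ∘ i` of Schwartz functions to `X`. -/
def restrictX (α : ℝ) : 𝓢(E3, ℂ) →L[ℂ] 𝓢(E2, ℂ) :=
  SchwartzMap.compCLMOfAntilipschitz ℂ
    (embX α).toContinuousLinearMap.hasTemperateGrowth (embX α).antilipschitz

/-- The coboundary operator `i_*`, conjugate to the restriction: `(i_* f)(ψ) = f(ψ ∘ i)`. -/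
def coboundary (α : ℝ) : 𝓢'(E2, ℂ) →L[ℂ] 𝓢'(E3, ℂ) :=
  PointwiseConvergenceCLM.precomp ℂ (restrictX α)

/-- The graph of the boundary operator `i^* : H^t(ℝ³) → H^r(X)` (used for `t > 1/2` and
`r = t - 1/2`), i.e. of the continuous extension of the restriction of Schwartz functions. -/
def boundaryGraph (α t r : ℝ) : Set (SobolevSpace E3 t × SobolevSpace E2 r) :=
  closure (Set.range fun ψ : 𝓢(E3, ℂ) =>
    (SobolevSpace.ofSchwartz t ψ, SobolevSpace.ofSchwartz r (restrictX α ψ)))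

/-- `v = i^* V` for `V ∈ H^t_loc(ℝ³)`, `v ∈ H^r_loc(X)`: for each smooth compactly supported
function `η` on `ℝ³`, the boundary operator `H^t(ℝ³) → H^r(X)` takes `η V` to `(η ∘ i) v`. -/
def IsBoundaryValue (α t r : ℝ) (V : 𝓢'(E3, ℂ)) (v : 𝓢'(E2, ℂ)) : Prop :=
  ∀ η : E3 → ℂ, IsCutoff η → ∃ P ∈ boundaryGraph α t r,
    SobolevSpace.toDistr t P.1 = cutoffMul η V ∧
    SobolevSpace.toDistr r P.2 = cutoffMul (fun q => η (embX α q)) v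

/-- The shift operator on distributions, `T_θ f = f ∘ rotZ θ` for functions `f`, i.e.
`(T_θ U)(ψ) = U(ψ ∘ rotZ (-θ))` (rotations preserve the volume). -/
def shiftOp (θ : ℝ) : 𝓢'(E3, ℂ) →L[ℂ] 𝓢'(E3, ℂ) :=
  PointwiseConvergenceCLM.precomp ℂ (SchwartzMap.compCLMOfContinuousLinearEquiv ℂ (rotZ (-θ)))

/-- `W = ∫_{S¹} T_θ U dθ`, as a weak integral of distributions. -/
def IsRotationIntegral (U W : 𝓢'(E3, ℂ)) : Prop :=
  ∀ ψ : 𝓢(E3, ℂ), IntervalIntegrable (fun θ => shiftOp θ U ψ) volume 0 (2 * Real.pi) ∧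
    W ψ = ∫ θ in (0 : ℝ)..(2 * Real.pi), shiftOp θ U ψ

/-- `V = D U`, where `D = Δ⁻¹ ∫_{S¹} T_θ dθ`. -/
def IsOperatorD (U V : 𝓢'(E3, ℂ)) : Prop :=
  ∃ W, IsRotationIntegral U W ∧ IsInverseLaplacian W V

/-- `v = i^!(D) f`, where `i^!(D) = i^* D i_*` is the trace of `D` on `X`, for `f` of order `s`:
here `i_* f` has order `s - 1/2`, `D i_* f` has order `s + 3/2`, and `v` has order `s + 1`. -/
def IsTraceOfD (α s : ℝ) (f v : 𝓢'(E2, ℂ)) : Prop :=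
  ∃ V, IsOperatorD (coboundary α f) V ∧ IsBoundaryValue α (s + 3 / 2) (s + 1) V v

end

/-! Everything is computed on the Fourier side. If F is the Fourier transform of f on X, then i_* f
has the Fourier transform F ∘ projX, constant along the normal ν of X; D averages this over the
rotations and multiplies it by -1/(4π²|ξ|²); restriction to X integrates a Fourier transform along
the normal lines. Hence the Fourier transform of i^!(D) f at η is -1/(4π²) times the integral of
F(projX(R_θ(η + tν))) / (|η|² + t²) over t ∈ ℝ and θ ∈ (0, 2π). As sin α and cos α are nonzero, the
point ζ = projX(R_θ(η + tν)) can replace (t, θ) as the integration variable, and the integral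
becomes ∫ k(η, ζ) F(ζ) dζ with the explicit kernel k = |η₀ - ζ₀| / (|sin α| q), where q has degree 4
(`lintegral_rotation_eq`, `sliceInt_invLapRot_eq`).

Boundedness: k is homogeneous of degree -3, so |η|^{s+1} k |ζ|^{-s} has the critical degree -2 on
the plane. By scaling, Schur's test with constant weights reduces to integrals over ζ for |η| = 1,
which converge for -1 < s < 0 (`lintegral_majKernel_unit`, `kerBound_weightedKernel`). The
homogeneous weights are comparable with the brackets of the Sobolev norms except at low frequencies;
the cut-offs on both sides pass from one to the other, because |ζ|^{2s} and |η|^{-2(s+1)} are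
locally integrable on the plane (`kerBound_multKernel`, `kerBound_multKernelOut`).

Compactness: adding ε(1 + |η|² + |ζ|²)² to q gives a regularised kernel k_ε. The Fourier transform a
of φ satisfies ∫ a = φ(0) = 0, so the composition of k_ε with multiplication by φ sees only the
differences k_ε(η, ζ') - k_ε(η, ζ). These are smaller by one order, and the composition is
Hilbert–Schmidt (`norm_compKernel_le`). For |ζ| ≥ 1 the error k - k_ε is a small multiple of a
kernel satisfying the same Schur bounds, while the part |ζ| < 1 of the multiplication operator is
itself Hilbert–Schmidt. So the operator is a norm limit of compact ones (`exists_regularisation`).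

The rest ties this to the definitions, which are relations between distributions: D i_* f is locally
in H^{s+3/2} (`memLp_jap_convFun_invLapRot`), the closure of the restriction of Schwartz functions
is slice integration (`exists_boundaryCLM`), slicing commutes with cut-offs (`sliceInt_convFun`),
and each relation determines its value (`IsTraceOfD.unique`). -/

noncomputable section

set_option linter.unusedSectionVars false

/-! ### Japanese brackets -/

section Bracket

variable {E : Type*} [NormedAddCommGroup E]

/-- The power `⟨x⟩^s = (1 + |x|²)^{s/2}` of the Japanese bracket. -/
def jap (s : ℝ) (x : E) : ℝ := (1 + ‖x‖ ^ 2) ^ (s / 2)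

theorem jap_pos (s : ℝ) (x : E) : 0 < jap s x := by unfold jap; positivity

theorem jap_nonneg (s : ℝ) (x : E) : 0 ≤ jap s x := (jap_pos s x).le

theorem jap_mul (s t : ℝ) (x : E) : jap s x * jap t x = jap (s + t) x := by
  unfold jap; rw [← Real.rpow_add (by positivity)]; ring_nf

@[simp] theorem jap_zero (x : E) : jap 0 x = 1 := by simp [jap]

theorem jap_neg_mul (s : ℝ) (x : E) : jap (-s) x * jap s x = 1 := by simp [jap_mul]

theorem jap_mul_neg (s : ℝ) (x : E) : jap s x * jap (-s) x = 1 := by simp [jap_mul]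

theorem jap_mono {s t : ℝ} (h : s ≤ t) (x : E) : jap s x ≤ jap t x := by
  unfold jap
  exact Real.rpow_le_rpow_of_exponent_le (by simp) (by linarith)

theorem jap_two (x : E) : jap 2 x = 1 + ‖x‖ ^ 2 := by simp [jap]

theorem jap_rpow (s t : ℝ) (x : E) : jap s x ^ t = jap (s * t) x := by
  unfold jap; rw [← Real.rpow_mul (by positivity)]; ring_nf

theorem jap_sq (s : ℝ) (x : E) : jap s x ^ 2 = jap (2 * s) x := by
  rw [sq, jap_mul]; ring_nf

@[fun_prop] theorem continuous_jap (s : ℝ) : Continuous (jap s : E → ℝ) := by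
  unfold jap
  exact Continuous.rpow_const (by fun_prop) (fun x => Or.inl (by positivity))

@[fun_prop] theorem measurable_jap [MeasurableSpace E] [BorelSpace E] (s : ℝ) :
    Measurable (jap s : E → ℝ) := (continuous_jap s).measurable

theorem jap_two_le (x y : E) : jap 2 x ≤ 2 * (jap 2 y * jap 2 (x - y)) := by
  simp only [jap_two]
  have h : ‖x‖ ≤ ‖y‖ + ‖x - y‖ := by
    calc ‖x‖ = ‖y + (x - y)‖ := by congr 1; abel
      _ ≤ _ := norm_add_le _ _
  have h2 : ‖x‖ ^ 2 ≤ (‖y‖ + ‖x - y‖) ^ 2 := by gcongr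
  nlinarith [sq_nonneg (‖y‖ - ‖x - y‖), mul_nonneg (sq_nonneg ‖y‖) (sq_nonneg ‖x - y‖)]

/-- Peetre's inequality. -/
theorem jap_peetre (s : ℝ) (x y : E) :
    jap s x ≤ 2 ^ (|s| / 2) * (jap s y * jap |s| (x - y)) := by
  have key : ∀ a : ℝ, 0 ≤ a → ∀ x y : E, jap a x ≤ 2 ^ (a / 2) * (jap a y * jap a (x - y)) := by
    intro a ha x y
    have h := Real.rpow_le_rpow (jap_nonneg 2 x) (jap_two_le x y) (show 0 ≤ a / 2 by linarith)
    rw [Real.mul_rpow (by norm_num) (mul_nonneg (jap_nonneg _ _) (jap_nonneg _ _)),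
      Real.mul_rpow (jap_nonneg _ _) (jap_nonneg _ _), jap_rpow, jap_rpow, jap_rpow] at h
    convert h using 3 <;> ring_nf
  rcases le_total 0 s with hs | hs
  · rw [abs_of_nonneg hs]; exact key s hs x y
  -- For s ≤ 0, exchange x and y and multiply by ⟨x⟩^s ⟨y⟩^s.
  · rw [abs_of_nonpos hs]
    have h := key (-s) (by linarith) y x
    have h1 : jap (-s) (y - x) = jap (-s) (x - y) := by simp [jap, norm_sub_rev]
    rw [h1] at h
    have h3 := mul_le_mul_of_nonneg_left h
      (mul_nonneg (jap_nonneg s x) (jap_nonneg s y))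
    have e1 : jap s x * jap s y * jap (-s) y = jap s x := by
      rw [mul_assoc, jap_mul_neg, mul_one]
    have e2 : jap s x * jap s y * (2 ^ (-s / 2) * (jap (-s) x * jap (-s) (x - y)))
        = 2 ^ (-s / 2) * (jap s y * jap (-s) (x - y)) * (jap s x * jap (-s) x) := by ring
    rwa [e1, e2, jap_mul_neg, mul_one] at h3

theorem integrable_jap [NormedSpace ℝ E] [FiniteDimensional ℝ E] [MeasurableSpace E]
    [BorelSpace E] (μ : Measure E) [μ.IsAddHaarMeasure] {s : ℝ}
    (h : (Module.finrank ℝ E : ℝ) < -s) : Integrable (jap s : E → ℝ) μ := by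
  have := integrable_rpow_neg_one_add_norm_sq (μ := μ) h
  simp only [neg_neg] at this
  exact this

theorem norm_le_jap (x : E) : ‖x‖ ≤ jap 1 x := by
  unfold jap
  rw [← Real.sqrt_eq_rpow]
  exact Real.le_sqrt_of_sq_le (by linarith)

end Bracket

/-! ### Schwartz functions and distributions given by functions -/

section Basic

variable {E : Type*} [NormedAddCommGroup E] [InnerProductSpace ℝ E] [FiniteDimensional ℝ E]
  [MeasurableSpace E] [BorelSpace E]

theorem hasTemperateGrowth_jap (s : ℝ) :
    Function.HasTemperateGrowth (fun x : E => ((jap s x : ℝ) : ℂ)) := by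
  unfold jap; fun_prop

theorem schwartz_decay (ψ : 𝓢(E, ℂ)) (N : ℝ) : ∃ C : ℝ, 0 ≤ C ∧ ∀ x, ‖ψ x‖ ≤ C * jap (-N) x := by
  let f := SchwartzMap.smulLeftCLM ℂ (fun x : E => ((jap N x : ℝ) : ℂ)) ψ
  refine ⟨SchwartzMap.seminorm ℂ 0 0 f, by positivity, fun x => ?_⟩
  have h := SchwartzMap.norm_le_seminorm ℂ f x
  rw [SchwartzMap.smulLeftCLM_apply_apply (hasTemperateGrowth_jap N), smul_eq_mul, norm_mul,
    Complex.norm_real, Real.norm_of_nonneg (jap_nonneg _ _)] at h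
  calc ‖ψ x‖ = (jap N x * ‖ψ x‖) * jap (-N) x := by
        rw [mul_right_comm, jap_mul_neg, one_mul]
    _ ≤ _ := mul_le_mul_of_nonneg_right h (jap_nonneg _ _)

/-- Integrability of a function up to a polynomial weight. -/
def PolyInt (g : E → ℂ) : Prop :=
  ∃ N : ℝ, Integrable (fun x => ((jap (-N) x : ℝ) : ℂ) * g x)

theorem PolyInt.mono {g : E → ℂ} (h : PolyInt g) : ∃ N₀ : ℝ, ∀ N, N₀ ≤ N →
    Integrable (fun x => ((jap (-N) x : ℝ) : ℂ) * g x) := by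
  obtain ⟨N₀, h⟩ := h
  refine ⟨N₀, fun N hN => ?_⟩
  have e : (fun x => ((jap (-N) x : ℝ) : ℂ) * g x)
      = fun x => ((jap (-(N - N₀)) x : ℝ) : ℂ) * (((jap (-N₀) x : ℝ) : ℂ) * g x) := by
    ext x; rw [← mul_assoc, ← Complex.ofReal_mul, jap_mul]; ring_nf
  rw [e]
  refine h.bdd_mul (c := 1) (by fun_prop) (Filter.Eventually.of_forall fun x => ?_)
  rw [Complex.norm_real, Real.norm_of_nonneg (jap_nonneg _ _)]
  simpa using jap_mono (show -(N - N₀) ≤ 0 by linarith) x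

theorem PolyInt.integrable_mul_of_decay {g : E → ℂ} (h : PolyInt g) {a : E → ℂ}
    (ha : AEStronglyMeasurable a) (hd : ∀ N : ℝ, ∃ C : ℝ, ∀ x, ‖a x‖ ≤ C * jap (-N) x) :
    Integrable (fun x => a x * g x) := by
  obtain ⟨N, hN⟩ := h
  obtain ⟨C, hC⟩ := hd N
  have e : (fun x => a x * g x)
      = fun x => (((jap N x : ℝ) : ℂ) * a x) * (((jap (-N) x : ℝ) : ℂ) * g x) := by
    ext x
    have : ((jap N x : ℝ) : ℂ) * ((jap (-N) x : ℝ) : ℂ) = 1 := by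
      rw [← Complex.ofReal_mul, jap_mul_neg]; simp
    linear_combination (-(a x * g x)) * this
  rw [e]
  refine hN.bdd_mul (c := C) ?_ (Filter.Eventually.of_forall fun x => ?_)
  · exact (by fun_prop : AEStronglyMeasurable (fun x : E => ((jap N x : ℝ) : ℂ))).mul ha
  · rw [norm_mul, Complex.norm_real, Real.norm_of_nonneg (jap_nonneg _ _)]
    calc jap N x * ‖a x‖ ≤ jap N x * (C * jap (-N) x) :=
          mul_le_mul_of_nonneg_left (hC x) (jap_nonneg _ _)
      _ = C * (jap N x * jap (-N) x) := by ring
      _ = C := by rw [jap_mul_neg, mul_one]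

theorem PolyInt.integrable_schwartz_mul {g : E → ℂ} (h : PolyInt g) (ψ : 𝓢(E, ℂ)) :
    Integrable (fun x => ψ x * g x) :=
  h.integrable_mul_of_decay (by fun_prop) fun N => (schwartz_decay ψ N).imp fun _ h => h.2

theorem Integrable.polyInt {g : E → ℂ} (h : Integrable g) : PolyInt g := ⟨0, by simpa using h⟩

theorem PolyInt.exists_distr {g : E → ℂ} (h : PolyInt g) : ∃ U : 𝓢'(E, ℂ), IsGivenBy U g := by
  obtain ⟨N, hN⟩ := id h
  let f : Lp ℂ 1 (volume : Measure E) := (memLp_one_iff_integrable.mpr hN).toLp _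
  have hf : f =ᵐ[volume] _ := (memLp_one_iff_integrable.mpr hN).coeFn_toLp
  refine ⟨TemperedDistribution.smulLeftCLM ℂ (fun x : E => ((jap N x : ℝ) : ℂ)) (f : 𝓢'(E, ℂ)),
    fun ψ => ⟨h.integrable_schwartz_mul ψ, ?_⟩⟩
  rw [TemperedDistribution.smulLeftCLM_apply_apply, Lp.toTemperedDistribution_apply]
  refine integral_congr_ae ?_
  filter_upwards [hf] with x hx
  rw [hx, SchwartzMap.smulLeftCLM_apply_apply (hasTemperateGrowth_jap N)]
  have : ((jap N x : ℝ) : ℂ) * ((jap (-N) x : ℝ) : ℂ) = 1 := by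
    rw [← Complex.ofReal_mul, jap_mul_neg]; simp
  simp only [smul_eq_mul]
  linear_combination (ψ x * g x) * this

theorem IsGivenBy.ext {U V : 𝓢'(E, ℂ)} {g : E → ℂ} (hU : IsGivenBy U g) (hV : IsGivenBy V g) :
    U = V := by
  ext ψ; rw [(hU ψ).2, (hV ψ).2]

theorem IsGivenBy.congr {U : 𝓢'(E, ℂ)} {g g' : E → ℂ} (hU : IsGivenBy U g) (h : g =ᵐ[volume] g') :
    IsGivenBy U g' := by
  intro ψ
  have e : (fun x => ψ x * g x) =ᵐ[volume] fun x => ψ x * g' x := by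
    filter_upwards [h] with x hx; rw [hx]
  exact ⟨(hU ψ).1.congr e, by rw [(hU ψ).2, integral_congr_ae e]⟩

/-- Testing against a bump equal to 1 near a point recovers local integrability from integrability
against Schwartz functions. This is what makes the representing function unique almost everywhere.
-/
theorem IsGivenBy.locallyIntegrable {U : 𝓢'(E, ℂ)} {g : E → ℂ} (hU : IsGivenBy U g) :
    LocallyIntegrable g := by
  intro x
  let b : ContDiffBump x := default
  have hc : HasCompactSupport (fun y => ((b y : ℝ) : ℂ)) :=
    b.hasCompactSupport.comp_left (g := fun r : ℝ => (r : ℂ)) (by simp)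
  have hs : ContDiff ℝ ∞ (fun y => ((b y : ℝ) : ℂ)) :=
    Complex.ofRealCLM.contDiff.comp b.contDiff
  have h := (hU (hc.toSchwartzMap hs)).1
  refine ⟨Metric.closedBall x b.rIn, Metric.closedBall_mem_nhds x b.rIn_pos, ?_⟩
  refine (h.integrableOn (s := Metric.closedBall x b.rIn)).congr_fun (fun y hy => ?_)
    Metric.isClosed_closedBall.measurableSet
  simp [b.one_of_mem_closedBall hy]

theorem IsGivenBy.ae_eq {U : 𝓢'(E, ℂ)} {g g' : E → ℂ} (hg : IsGivenBy U g)
    (hg' : IsGivenBy U g') : g =ᵐ[volume] g' := by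
  refine ae_eq_of_integral_contDiff_smul_eq hg.locallyIntegrable hg'.locallyIntegrable ?_
  intro φ hφ hc
  have hc' : HasCompactSupport (fun y => ((φ y : ℝ) : ℂ)) :=
    hc.comp_left (g := fun r : ℝ => (r : ℂ)) (by simp)
  have hs : ContDiff ℝ ∞ (fun y => ((φ y : ℝ) : ℂ)) := Complex.ofRealCLM.contDiff.comp hφ
  have h1 := (hg (hc'.toSchwartzMap hs)).2
  rw [(hg' (hc'.toSchwartzMap hs)).2] at h1
  simpa using h1.symm

theorem fourier_distr_injective {U V : 𝓢'(E, ℂ)} (h : 𝓕 U = 𝓕 V) : U = V := by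
  have := congrArg (fun W => 𝓕⁻ W) h
  simpa using this

theorem PolyInt.exists_fourier {g : E → ℂ} (h : PolyInt g) :
    ∃ U : 𝓢'(E, ℂ), IsGivenBy (𝓕 U) g := by
  obtain ⟨W, hW⟩ := h.exists_distr
  exact ⟨𝓕⁻ W, by simpa using hW⟩

theorem IsGivenBy.apply_eq {U : 𝓢'(E, ℂ)} {g : E → ℂ} (hU : IsGivenBy (𝓕 U) g) (ψ : 𝓢(E, ℂ)) :
    U ψ = ∫ ξ, (𝓕⁻ ψ) ξ * g ξ := by
  rw [← (hU (𝓕⁻ ψ)).2, TemperedDistribution.fourier_apply]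
  simp

theorem isGivenBy_coe_schwartz (ψ : 𝓢(E, ℂ)) : IsGivenBy (ψ : 𝓢'(E, ℂ)) ψ := by
  intro χ
  refine ⟨(Integrable.polyInt ψ.integrable).integrable_schwartz_mul χ, ?_⟩
  rw [SchwartzMap.coe_apply]; rfl

theorem isGivenBy_fourier_coe_schwartz (ψ : 𝓢(E, ℂ)) :
    IsGivenBy (𝓕 (ψ : 𝓢'(E, ℂ))) (𝓕 ψ : 𝓢(E, ℂ)) := by
  rw [TemperedDistribution.fourier_toTemperedDistributionCLM_eq]
  exact isGivenBy_coe_schwartz _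

/-! ### Sobolev spaces on the Fourier side -/

/-- The weighted Fourier transform `⟨ξ⟩^s û` of `u ∈ H^s`. -/
def SobolevSpace.hat (s : ℝ) (u : SobolevSpace E s) : Lp ℂ 2 (volume : Measure E) :=
  𝓕 (SobolevSpace.toLp s u)

theorem SobolevSpace.fourier_eq (s : ℝ) (u : SobolevSpace E s) :
    TemperedDistribution.smulLeftCLM ℂ (fun x : E => ((jap s x : ℝ) : ℂ))
      (𝓕 (SobolevSpace.toDistr s u)) = (SobolevSpace.hat s u : 𝓢'(E, ℂ)) := by
  have h := congrArg (fun W => 𝓕 W) (SobolevSpace.toLp_spec s u)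
  simp only [TemperedDistribution.fourier_besselPotential_eq_smulLeftCLM_fourier_apply] at h
  rw [Lp.fourier_toTemperedDistribution_eq] at h
  exact h

theorem polyInt_of_memLp {s : ℝ} {g : E → ℂ}
    (h : MemLp (fun x => ((jap s x : ℝ) : ℂ) * g x) 2 volume) : PolyInt g := by
  -- With d the dimension, ⟨x⟩^{-(d+1)} is square integrable, and Cauchy–Schwarz passes from L² to
  -- L¹.
  refine ⟨-s + (Module.finrank ℝ E + 1), ?_⟩
  have h1 : MemLp (fun x : E => ((jap (-(Module.finrank ℝ E + 1 : ℝ)) x : ℝ) : ℂ)) 2 volume := by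
    refine (memLp_two_iff_integrable_sq_norm (by fun_prop)).mpr ?_
    simp only [Complex.norm_real, Real.norm_eq_abs, sq_abs, jap_sq]
    exact integrable_jap _ (by linarith)
  refine (h.integrable_mul h1).congr (Filter.Eventually.of_forall fun x => ?_)
  simp only [Pi.mul_apply]
  rw [mul_right_comm, ← Complex.ofReal_mul, jap_mul]
  ring_nf

theorem Lp.polyInt_jap_mul (s : ℝ) (h : Lp ℂ 2 (volume : Measure E)) :
    PolyInt (fun x => ((jap (-s) x : ℝ) : ℂ) * h x) := by
  refine polyInt_of_memLp (s := s) ((Lp.memLp h).ae_eq (Filter.Eventually.of_forall fun x => ?_))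
  simp only
  rw [← mul_assoc, ← Complex.ofReal_mul, jap_mul_neg]; simp

theorem isGivenBy_smulLeft_lp (s : ℝ) (h : Lp ℂ 2 (volume : Measure E)) :
    IsGivenBy (TemperedDistribution.smulLeftCLM ℂ (fun x : E => ((jap (-s) x : ℝ) : ℂ))
      (h : 𝓢'(E, ℂ))) (fun x => ((jap (-s) x : ℝ) : ℂ) * h x) := by
  intro ψ
  refine ⟨(Lp.polyInt_jap_mul s h).integrable_schwartz_mul ψ, ?_⟩
  rw [TemperedDistribution.smulLeftCLM_apply_apply, Lp.toTemperedDistribution_apply]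
  refine integral_congr_ae (Filter.Eventually.of_forall fun x => ?_)
  simp only
  rw [SchwartzMap.smulLeftCLM_apply_apply (hasTemperateGrowth_jap _)]
  simp only [smul_eq_mul]; ring

theorem smulLeft_jap_cancel (s : ℝ) (U : 𝓢'(E, ℂ)) :
    TemperedDistribution.smulLeftCLM ℂ (fun x : E => ((jap (-s) x : ℝ) : ℂ))
      (TemperedDistribution.smulLeftCLM ℂ (fun x : E => ((jap s x : ℝ) : ℂ)) U) = U := by
  rw [TemperedDistribution.smulLeftCLM_smulLeftCLM_apply (hasTemperateGrowth_jap _)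
    (hasTemperateGrowth_jap _)]
  have : ((fun x : E => ((jap s x : ℝ) : ℂ)) * fun x : E => ((jap (-s) x : ℝ) : ℂ))
      = fun _ => 1 := by
    ext x; simp only [Pi.mul_apply]; rw [← Complex.ofReal_mul, jap_mul_neg]; simp
  rw [this]; simp

theorem SobolevSpace.isGivenBy_fourier (s : ℝ) (u : SobolevSpace E s) :
    IsGivenBy (𝓕 (SobolevSpace.toDistr s u))
      (fun x => ((jap (-s) x : ℝ) : ℂ) * SobolevSpace.hat s u x) := by
  have h := isGivenBy_smulLeft_lp s (SobolevSpace.hat s u)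
  rwa [← SobolevSpace.fourier_eq, smulLeft_jap_cancel] at h

theorem SobolevSpace.toDistr_injective (s : ℝ) :
    Function.Injective (SobolevSpace.toDistr (E := E) s) := Subtype.val_injective

theorem SobolevSpace.norm_hat (s : ℝ) (u : SobolevSpace E s) : ‖SobolevSpace.hat s u‖ = ‖u‖ :=
  Lp.norm_fourier_eq _

theorem SobolevSpace.exists_hat_eq (s : ℝ) (h : Lp ℂ 2 (volume : Measure E)) :
    ∃ u : SobolevSpace E s, SobolevSpace.hat s u = h := by
  let U : 𝓢'(E, ℂ) :=
    𝓕⁻ (TemperedDistribution.smulLeftCLM ℂ (fun x : E => ((jap (-s) x : ℝ) : ℂ)) (h : 𝓢'(E, ℂ)))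
  have hU : TemperedDistribution.smulLeftCLM ℂ (fun x : E => ((jap s x : ℝ) : ℂ)) (𝓕 U)
      = (h : 𝓢'(E, ℂ)) := by
    have := smulLeft_jap_cancel (-s) (h : 𝓢'(E, ℂ))
    rw [neg_neg] at this
    simpa [U] using this
  have hm : TemperedDistribution.MemSobolev s 2 U :=
    TemperedDistribution.memSobolev_iff_exists_smulLeftCLM_fourier.mpr ⟨h, hU⟩
  let u : SobolevSpace E s := ⟨U, hm⟩
  refine ⟨u, lp_toTemperedDistribution_injective ?_⟩
  exact (SobolevSpace.fourier_eq s u).symm.trans hU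

/-- The isometry `u ↦ ⟨ξ⟩^s û` of `H^s` onto `L²`. -/
def SobolevSpace.hatEquiv (s : ℝ) : SobolevSpace E s ≃ₗᵢ[ℂ] Lp ℂ 2 (volume : Measure E) :=
  LinearIsometryEquiv.ofSurjective
    { toFun := SobolevSpace.hat s
      map_add' := fun u v => by simp only [SobolevSpace.hat, map_add, FourierAdd.fourier_add]
      map_smul' := fun c u => by
        simp only [SobolevSpace.hat, map_smul, FourierSMul.fourier_smul, RingHom.id_apply]
      norm_map' := SobolevSpace.norm_hat s } (SobolevSpace.exists_hat_eq s)

theorem SobolevSpace.hatEquiv_apply (s : ℝ) (u : SobolevSpace E s) :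
    SobolevSpace.hatEquiv s u = SobolevSpace.hat s u := rfl

theorem SobolevSpace.hat_ae_eq {s : ℝ} {u : SobolevSpace E s} {g : E → ℂ}
    (h : IsGivenBy (𝓕 (SobolevSpace.toDistr s u)) g) :
    SobolevSpace.hat s u =ᵐ[volume] fun x => ((jap s x : ℝ) : ℂ) * g x := by
  filter_upwards [(SobolevSpace.isGivenBy_fourier s u).ae_eq h] with x hx
  rw [← hx, ← mul_assoc, ← Complex.ofReal_mul, jap_mul_neg]; simp

theorem exists_sobolev_of_isGivenBy {s : ℝ} {U : 𝓢'(E, ℂ)} {g : E → ℂ} (h : IsGivenBy (𝓕 U) g)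
    (hg : MemLp (fun x => ((jap s x : ℝ) : ℂ) * g x) 2 volume) :
    ∃ u : SobolevSpace E s, SobolevSpace.toDistr s u = U := by
  obtain ⟨u, hu⟩ := SobolevSpace.exists_hat_eq s (hg.toLp _)
  refine ⟨u, fourier_distr_injective ?_⟩
  refine IsGivenBy.ext (SobolevSpace.isGivenBy_fourier s u) (h.congr ?_)
  rw [hu]
  filter_upwards [hg.coeFn_toLp] with x hx
  rw [hx, ← mul_assoc, ← Complex.ofReal_mul, jap_neg_mul]; simp

end Basic

/-! ### Multiplication by a cut-off as convolution of Fourier transforms. -/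

section Convolution

variable {E : Type*} [NormedAddCommGroup E] [InnerProductSpace ℝ E] [FiniteDimensional ℝ E]
  [MeasurableSpace E] [BorelSpace E]

/-- The convolution `a * g`, as a function. -/
def convFun (a g : E → ℂ) (x : E) : ℂ := ∫ y, a (x - y) * g y

/-- A cut-off function as a Schwartz function. -/
def IsCutoff.toSchwartz {χ : E → ℂ} (h : IsCutoff χ) : 𝓢(E, ℂ) := h.2.toSchwartzMap h.1

theorem IsCutoff.toSchwartz_apply {χ : E → ℂ} (h : IsCutoff χ) (x : E) :
    h.toSchwartz x = χ x := rfl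

theorem IsCutoff.hasTemperateGrowth {χ : E → ℂ} (h : IsCutoff χ) :
    Function.HasTemperateGrowth χ := h.toSchwartz.hasTemperateGrowth

/-- Peetre's inequality splits the decay of a(x - y) into ⟨y⟩^{-N}, which pays for g, and a growth
⟨x⟩^N, which the weight in x absorbs. This licenses Fubini for convolutions. -/
theorem PolyInt.integrable_prod {g : E → ℂ} (h : PolyInt g) (a : 𝓢(E, ℂ)) :
    ∃ K : ℝ, Integrable (fun p : E × E => ((jap (-K) p.1 : ℝ) : ℂ) * (a (p.1 - p.2) * g p.2))
      (volume.prod volume) := by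
  obtain ⟨N₀, hN₀⟩ := h.mono
  set N := max N₀ 0
  have hN := hN₀ N (le_max_left _ _)
  have hN0 : 0 ≤ N := le_max_right _ _
  obtain ⟨C, hC0, hC⟩ := schwartz_decay a N
  set d : ℝ := Module.finrank ℝ E + 1
  refine ⟨N + d, ?_⟩
  have hI : Integrable (fun p : E × E => (C * 2 ^ (|-N| / 2) : ℝ) * (jap (-d) p.1 *
      ‖((jap (-N) p.2 : ℝ) : ℂ) * g p.2‖)) (volume.prod volume) :=
    ((integrable_jap volume (by simp [d])).mul_prod hN.norm).const_mul _
  have hgm : AEStronglyMeasurable g (volume : Measure E) := by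
    have h1 : g = fun x => ((jap N x : ℝ) : ℂ) * (((jap (-N) x : ℝ) : ℂ) * g x) := by
      ext x; rw [← mul_assoc, ← Complex.ofReal_mul, jap_mul_neg]; simp
    rw [h1]
    exact (by fun_prop : AEStronglyMeasurable (fun x : E => ((jap N x : ℝ) : ℂ))).mul hN.1
  refine hI.mono' ?_ (Filter.Eventually.of_forall fun p => ?_)
  · refine AEStronglyMeasurable.mul (by fun_prop) (AEStronglyMeasurable.mul ?_ hgm.comp_snd)
    exact (a.continuous.comp (continuous_fst.sub continuous_snd)).aestronglyMeasurable
  · have h1 := hC (p.1 - p.2)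
    have h2 := jap_peetre (-N) (p.1 - p.2) (-p.2)
    have h3 : jap (-N) (-p.2) = jap (-N) p.2 := by simp [jap]
    have h4 : p.1 - p.2 - -p.2 = p.1 := by abel
    have h5 : |-N| = N := by rw [abs_neg, abs_of_nonneg hN0]
    rw [h3, h4, h5] at h2
    rw [norm_mul, norm_mul, norm_mul, Complex.norm_real, Complex.norm_real,
      Real.norm_of_nonneg (jap_nonneg _ _), Real.norm_of_nonneg (jap_nonneg _ _), h5]
    calc jap (-(N + d)) p.1 * (‖a (p.1 - p.2)‖ * ‖g p.2‖)
        ≤ jap (-(N + d)) p.1 * ((C * (2 ^ (N / 2) * (jap (-N) p.2 * jap N p.1))) * ‖g p.2‖) := by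
          gcongr
          · exact jap_nonneg _ _
          · exact h1.trans (by gcongr)
      _ = C * 2 ^ (N / 2) * ((jap (-(N + d)) p.1 * jap N p.1) * (jap (-N) p.2 * ‖g p.2‖)) := by
          ring
      _ = _ := by rw [jap_mul, show -(N + d) + N = -d by ring]

theorem PolyInt.convFun {g : E → ℂ} (h : PolyInt g) (a : 𝓢(E, ℂ)) : PolyInt (convFun a g) := by
  obtain ⟨K, hK⟩ := h.integrable_prod a
  refine ⟨K, hK.integral_prod_left.congr (Filter.Eventually.of_forall fun x => ?_)⟩
  simp only [_root_.convFun]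
  rw [integral_const_mul]

theorem fourierInv_mul_fourier_apply (a ψ : 𝓢(E, ℂ)) (ξ : E) :
    (𝓕⁻ (SchwartzMap.smulLeftCLM ℂ a (𝓕 ψ)) : 𝓢(E, ℂ)) ξ
      = ∫ η, (𝓕 a : 𝓢(E, ℂ)) (η - ξ) * ψ η := by
  have h1 : Integrable (fun x => ((Real.fourierChar (inner ℝ x ξ) : Circle) : ℂ) * a x) := by
    refine a.integrable.bdd_mul (c := 1) ?_ (Filter.Eventually.of_forall fun x => (Circle.norm_coe _).le)
    exact (Continuous.aestronglyMeasurable (by fun_prop))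
  -- The Fourier integral is moved from ψ onto the modulated function a, where the modulation
  -- becomes the translation by ξ.
  have h2 := VectorFourier.integral_fourierIntegral_smul_eq_flip (μ := volume) (ν := volume)
    (L := innerₗ E) Real.continuous_fourierChar (by exact continuous_inner) ψ.integrable h1
  rw [SchwartzMap.fourierInv_coe, Real.fourierInv_eq]
  have h3 : ∀ w : E, VectorFourier.fourierIntegral Real.fourierChar volume (innerₗ E) ψ w
      = (𝓕 ψ : 𝓢(E, ℂ)) w := by
    intro w; rw [SchwartzMap.fourier_coe]; rfl
  have h4 : ∀ w : E, VectorFourier.fourierIntegral Real.fourierChar volume (innerₗ E).flip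
      (fun x => ((Real.fourierChar (inner ℝ x ξ) : Circle) : ℂ) * a x) w = (𝓕 a : 𝓢(E, ℂ)) (w - ξ) := by
    intro w
    rw [SchwartzMap.fourier_coe, Real.fourier_eq]
    unfold VectorFourier.fourierIntegral
    refine integral_congr_ae (Filter.Eventually.of_forall fun x => ?_)
    simp only [LinearMap.flip_apply, innerₗ_apply_apply, Circle.smul_def, smul_eq_mul]
    rw [← mul_assoc, ← Circle.coe_mul, ← AddChar.map_add_eq_mul, inner_sub_right,
      real_inner_comm w x]
    congr 3; ring
  calc _ = ∫ x, (𝓕 ψ : 𝓢(E, ℂ)) x • (((Real.fourierChar (inner ℝ x ξ) : Circle) : ℂ) * a x) := by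
        refine integral_congr_ae (Filter.Eventually.of_forall fun x => ?_)
        simp only [Circle.smul_def, smul_eq_mul]
        rw [SchwartzMap.smulLeftCLM_apply_apply a.hasTemperateGrowth]
        simp only [smul_eq_mul]; ring
    _ = _ := by
        simp only [h3, h4] at h2
        rw [h2]
        refine integral_congr_ae (Filter.Eventually.of_forall fun x => ?_)
        simp only [smul_eq_mul]; ring

theorem IsGivenBy.fourier_cutoffMul {χ : E → ℂ} (hχ : IsCutoff χ) {U : 𝓢'(E, ℂ)} {g : E → ℂ}
    (hU : IsGivenBy (𝓕 U) g) (hg : PolyInt g) :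
    IsGivenBy (𝓕 (cutoffMul χ U)) (convFun (𝓕 hχ.toSchwartz : 𝓢(E, ℂ)) g) := by
  intro ψ
  refine ⟨(hg.convFun _).integrable_schwartz_mul ψ, ?_⟩
  set a : 𝓢(E, ℂ) := 𝓕 hχ.toSchwartz
  have e1 : 𝓕 (cutoffMul χ U) ψ = U (SchwartzMap.smulLeftCLM ℂ hχ.toSchwartz (𝓕 ψ)) := rfl
  rw [e1, hU.apply_eq]
  simp only [fourierInv_mul_fourier_apply]
  obtain ⟨K, hK⟩ := hg.integrable_prod a
  obtain ⟨C, hC0, hC⟩ := schwartz_decay ψ K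
  have hI : Integrable (fun p : E × E => ψ p.1 * (a (p.1 - p.2) * g p.2))
      (volume.prod volume) := by
    have := hK.bdd_mul (c := C) (f := fun p : E × E => ((jap K p.1 : ℝ) : ℂ) * ψ p.1)
      (by
        refine AEStronglyMeasurable.mul (by fun_prop) ?_
        exact (ψ.continuous.comp continuous_fst).aestronglyMeasurable)
      (Filter.Eventually.of_forall fun p => by
        rw [norm_mul, Complex.norm_real, Real.norm_of_nonneg (jap_nonneg _ _)]
        calc jap K p.1 * ‖ψ p.1‖ ≤ jap K p.1 * (C * jap (-K) p.1) :=
              mul_le_mul_of_nonneg_left (hC _) (jap_nonneg _ _)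
          _ = C * (jap K p.1 * jap (-K) p.1) := by ring
          _ = C := by rw [jap_mul_neg, mul_one])
    refine this.congr (Filter.Eventually.of_forall fun p => ?_)
    have h1 : ((jap K p.1 : ℝ) : ℂ) * ((jap (-K) p.1 : ℝ) : ℂ) = 1 := by
      rw [← Complex.ofReal_mul, jap_mul_neg]; simp
    simp only
    linear_combination (ψ p.1 * (a (p.1 - p.2) * g p.2)) * h1
  have hF := integral_integral_swap (f := fun x y => ψ x * (a (x - y) * g y)) hI
  simp only [convFun]
  calc _ = ∫ y, ∫ x, ψ x * (a (x - y) * g y) := by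
        refine integral_congr_ae (Filter.Eventually.of_forall fun y => ?_)
        simp only
        rw [← integral_mul_const]
        refine integral_congr_ae (Filter.Eventually.of_forall fun x => ?_)
        simp only [a]; ring
    _ = _ := by
        rw [← hF]
        refine integral_congr_ae (Filter.Eventually.of_forall fun x => ?_)
        simp only
        rw [integral_const_mul]

end Convolution

/-! ### Integral operators on `L²` -/

section Kernel

open scoped ENNReal

variable {X : Type*} [MeasurableSpace X] {μ : Measure X} [SigmaFinite μ]

theorem sq_lintegral_mul_le {f g : X → ℝ≥0∞} (hf : AEMeasurable f μ) (hg : AEMeasurable g μ) :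
    (∫⁻ x, f x * g x ∂μ) ^ 2 ≤ (∫⁻ x, f x ^ 2 ∂μ) * ∫⁻ x, g x ^ 2 ∂μ := by
  have h := ENNReal.lintegral_mul_le_Lp_mul_Lq μ
    (Real.holderConjugate_iff.mpr ⟨by norm_num, by norm_num⟩ : Real.HolderConjugate 2 2) hf hg
  have h2 : (∫⁻ x, f x * g x ∂μ) ^ (2 : ℝ) ≤ ((∫⁻ a, f a ^ (2 : ℝ) ∂μ) ^ (1 / (2 : ℝ)) *
      (∫⁻ a, g a ^ (2 : ℝ) ∂μ) ^ (1 / (2 : ℝ))) ^ (2 : ℝ) := by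
    gcongr; exact h
  rw [ENNReal.mul_rpow_of_nonneg _ _ (by norm_num), ← ENNReal.rpow_mul, ← ENNReal.rpow_mul] at h2
  simpa using h2

/-- The integral operator with the kernel `|κ|` is bounded on `L²`, with norm at most `√C`. -/
def KerBound (μ : Measure X) (κ : X → X → ℂ) (C : ℝ≥0∞) : Prop :=
  Measurable (Function.uncurry κ) ∧ ∀ f : X → ℝ≥0∞, Measurable f →
    ∫⁻ x, (∫⁻ y, ‖κ x y‖ₑ * f y ∂μ) ^ 2 ∂μ ≤ C * ∫⁻ y, f y ^ 2 ∂μ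

/-- Schur's test. -/
theorem KerBound.of_schur {κ : X → X → ℂ} (hm : Measurable (Function.uncurry κ))
    {p q : X → ℝ≥0∞} (hp : Measurable p) (hq : Measurable q) (hq0 : ∀ᵐ y ∂μ, q y ≠ 0)
    (hqt : ∀ᵐ y ∂μ, q y ≠ ⊤) {A B : ℝ≥0∞}
    (h1 : ∀ᵐ x ∂μ, ∫⁻ y, ‖κ x y‖ₑ * q y ∂μ ≤ A * p x)
    (h2 : ∀ᵐ y ∂μ, ∫⁻ x, ‖κ x y‖ₑ * p x ∂μ ≤ B * q y) : KerBound μ κ (A * B) := by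
  refine ⟨hm, fun f hf => ?_⟩
  have hme : Measurable (Function.uncurry fun x y => ‖κ x y‖ₑ) := hm.enorm
  have hmx : ∀ x, Measurable fun y => ‖κ x y‖ₑ := fun x => hme.of_uncurry_left
  have hmy : ∀ y, Measurable fun x => ‖κ x y‖ₑ := fun y => hme.of_uncurry_right
  have key : ∀ᵐ x ∂μ, (∫⁻ y, ‖κ x y‖ₑ * f y ∂μ) ^ 2
      ≤ A * p x * ∫⁻ y, ‖κ x y‖ₑ * ((q y)⁻¹ * f y ^ 2) ∂μ := by
    filter_upwards [h1] with x hx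
    -- Cauchy–Schwarz for the splitting |κ| f = (|κ| q)^{1/2} (|κ| q⁻¹ f²)^{1/2}.
    have e : ∫⁻ y, ‖κ x y‖ₑ * f y ∂μ
        = ∫⁻ y, (‖κ x y‖ₑ * q y) ^ (1 / 2 : ℝ) *
          (‖κ x y‖ₑ * ((q y)⁻¹ * f y ^ 2)) ^ (1 / 2 : ℝ) ∂μ := by
      refine lintegral_congr_ae ?_
      filter_upwards [hq0, hqt] with y h0 ht
      rw [← ENNReal.mul_rpow_of_nonneg _ _ (by norm_num)]
      have : ‖κ x y‖ₑ * q y * (‖κ x y‖ₑ * ((q y)⁻¹ * f y ^ 2)) = (‖κ x y‖ₑ * f y) ^ 2 := by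
        rw [mul_mul_mul_comm, ← mul_assoc (q y), ENNReal.mul_inv_cancel h0 ht]; ring
      rw [this, ← ENNReal.rpow_natCast, ← ENNReal.rpow_mul]; simp
    rw [e]
    refine (sq_lintegral_mul_le ?_ ?_).trans ?_
    · exact (((hmx x).mul hq).pow_const _).aemeasurable
    · exact (((hmx x).mul (hq.inv.mul (hf.pow_const 2))).pow_const _).aemeasurable
    · have e2 : ∀ a : ℝ≥0∞, (a ^ (1 / 2 : ℝ)) ^ 2 = a := fun a => by
        rw [← ENNReal.rpow_natCast, ← ENNReal.rpow_mul]; simp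
      simp only [e2]
      gcongr
  calc ∫⁻ x, (∫⁻ y, ‖κ x y‖ₑ * f y ∂μ) ^ 2 ∂μ
      ≤ ∫⁻ x, A * p x * ∫⁻ y, ‖κ x y‖ₑ * ((q y)⁻¹ * f y ^ 2) ∂μ ∂μ := lintegral_mono_ae key
    _ = A * ∫⁻ x, ∫⁻ y, p x * (‖κ x y‖ₑ * ((q y)⁻¹ * f y ^ 2)) ∂μ ∂μ := by
        rw [← lintegral_const_mul]
        · refine lintegral_congr fun x => ?_
          have h : Measurable fun y => ‖κ x y‖ₑ * ((q y)⁻¹ * f y ^ 2) :=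
            (hmx x).mul (hq.inv.mul (hf.pow_const 2))
          rw [lintegral_const_mul _ h, mul_assoc]
        · refine Measurable.lintegral_prod_right' (f := fun z : X × X =>
            p z.1 * (‖κ z.1 z.2‖ₑ * ((q z.2)⁻¹ * f z.2 ^ 2))) ?_
          exact (hp.comp measurable_fst).mul (hme.mul
            ((hq.inv.mul (hf.pow_const 2)).comp measurable_snd))
    _ = A * ∫⁻ y, ∫⁻ x, p x * (‖κ x y‖ₑ * ((q y)⁻¹ * f y ^ 2)) ∂μ ∂μ := by
        rw [lintegral_lintegral_swap]
        exact ((hp.comp measurable_fst).mul (hme.mul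
            ((hq.inv.mul (hf.pow_const 2)).comp measurable_snd))).aemeasurable
    _ ≤ A * ∫⁻ y, B * f y ^ 2 ∂μ := by
        gcongr A * ?_
        refine lintegral_mono_ae ?_
        filter_upwards [h2, hq0, hqt] with y hy h0 ht
        calc ∫⁻ x, p x * (‖κ x y‖ₑ * ((q y)⁻¹ * f y ^ 2)) ∂μ
            = (∫⁻ x, ‖κ x y‖ₑ * p x ∂μ) * ((q y)⁻¹ * f y ^ 2) := by
              have h : Measurable fun x => ‖κ x y‖ₑ * p x := (hmy y).mul hp
              rw [← lintegral_mul_const _ h]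
              refine lintegral_congr fun x => ?_
              ring
          _ ≤ B * q y * ((q y)⁻¹ * f y ^ 2) := by gcongr
          _ = B * f y ^ 2 := by
              rw [mul_assoc, ← mul_assoc (q y), ENNReal.mul_inv_cancel h0 ht, one_mul]
    _ = A * B * ∫⁻ y, f y ^ 2 ∂μ := by
        rw [lintegral_const_mul _ (hf.pow_const 2), mul_assoc]

/-- A square integrable kernel is bounded on `L²`. -/
theorem KerBound.of_hilbertSchmidt {κ : X → X → ℂ} (hm : Measurable (Function.uncurry κ)) :
    KerBound μ κ (∫⁻ x, ∫⁻ y, ‖κ x y‖ₑ ^ 2 ∂μ ∂μ) := by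
  refine ⟨hm, fun f hf => ?_⟩
  have hme : Measurable (Function.uncurry fun x y => ‖κ x y‖ₑ) := hm.enorm
  have hmx : ∀ x, Measurable fun y => ‖κ x y‖ₑ := fun x => hme.of_uncurry_left
  rw [← lintegral_mul_const _ (Measurable.lintegral_prod_right (hme.pow_const 2))]
  exact lintegral_mono fun x => sq_lintegral_mul_le (hmx x).aemeasurable hf.aemeasurable

theorem KerBound.aemeasurable_le {κ : X → X → ℂ} {C : ℝ≥0∞} (h : KerBound μ κ C)
    {f : X → ℝ≥0∞} (hf : AEMeasurable f μ) :
    ∫⁻ x, (∫⁻ y, ‖κ x y‖ₑ * f y ∂μ) ^ 2 ∂μ ≤ C * ∫⁻ y, f y ^ 2 ∂μ := by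
  have e1 : ∀ x, ∫⁻ y, ‖κ x y‖ₑ * f y ∂μ = ∫⁻ y, ‖κ x y‖ₑ * hf.mk f y ∂μ := by
    intro x
    refine lintegral_congr_ae ?_
    filter_upwards [hf.ae_eq_mk] with y hy; rw [hy]
  have e2 : ∫⁻ y, f y ^ 2 ∂μ = ∫⁻ y, hf.mk f y ^ 2 ∂μ := by
    refine lintegral_congr_ae ?_
    filter_upwards [hf.ae_eq_mk] with y hy; rw [hy]
  simp only [e1, e2]
  exact h.2 _ hf.measurable_mk

theorem eLpNorm_two_sq (f : X → ℂ) : eLpNorm f 2 μ ^ 2 = ∫⁻ x, ‖f x‖ₑ ^ 2 ∂μ := by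
  have := eLpNorm_nnreal_pow_eq_lintegral (f := f) (μ := μ) (p := 2) (by norm_num)
  simpa only [ENNReal.coe_ofNat, NNReal.coe_ofNat, ENNReal.rpow_ofNat] using this

theorem memLp_two_iff_lintegral {f : X → ℂ} (hf : AEStronglyMeasurable f μ) :
    MemLp f 2 μ ↔ ∫⁻ x, ‖f x‖ₑ ^ 2 ∂μ < ⊤ := by
  rw [← eLpNorm_two_sq]
  simp [MemLp, hf, ENNReal.pow_lt_top_iff]

theorem Lp.lintegral_sq (f : Lp ℂ 2 μ) : ∫⁻ x, ‖f x‖ₑ ^ 2 ∂μ = ‖f‖ₑ ^ 2 := by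
  rw [← eLpNorm_two_sq, Lp.enorm_def]

theorem AEStronglyMeasurable.kernel_mul {κ : X → X → ℂ} (hm : Measurable (Function.uncurry κ))
    {f : X → ℂ} (hf : AEStronglyMeasurable f μ) :
    AEStronglyMeasurable (fun z : X × X => κ z.1 z.2 * f z.2) (μ.prod μ) :=
  hm.aestronglyMeasurable.mul hf.comp_snd

theorem KerBound.ae_lintegral_lt_top {κ : X → X → ℂ} {C : ℝ≥0∞} (h : KerBound μ κ C)
    (hC : C ≠ ⊤) {f : X → ℂ} (hf : MemLp f 2 μ) :
    ∀ᵐ x ∂μ, ∫⁻ y, ‖κ x y‖ₑ * ‖f y‖ₑ ∂μ < ⊤ := by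
  have h1 := h.aemeasurable_le hf.1.enorm
  have h2 : ∫⁻ x, (∫⁻ y, ‖κ x y‖ₑ * ‖f y‖ₑ ∂μ) ^ 2 ∂μ ≠ ⊤ :=
    (h1.trans_lt (ENNReal.mul_lt_top hC.lt_top ((memLp_two_iff_lintegral hf.1).mp hf))).ne
  have h3 : AEMeasurable (fun x => (∫⁻ y, ‖κ x y‖ₑ * ‖f y‖ₑ ∂μ) ^ 2) μ := by
    refine AEMeasurable.pow_const ?_ 2
    exact AEMeasurable.lintegral_prod_right' (f := fun z : X × X => ‖κ z.1 z.2‖ₑ * ‖f z.2‖ₑ)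
      (h.1.enorm.aemeasurable.mul hf.1.enorm.comp_snd)
  filter_upwards [ae_lt_top' h3 h2] with x hx
  simpa [ENNReal.pow_lt_top_iff] using hx

theorem KerBound.ae_integrable {κ : X → X → ℂ} {C : ℝ≥0∞} (h : KerBound μ κ C)
    (hC : C ≠ ⊤) {f : X → ℂ} (hf : MemLp f 2 μ) :
    ∀ᵐ x ∂μ, Integrable (fun y => κ x y * f y) μ := by
  filter_upwards [h.ae_lintegral_lt_top hC hf] with x hx
  refine ⟨(h.1.of_uncurry_left).aestronglyMeasurable.mul hf.1, ?_⟩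
  simpa [HasFiniteIntegral, enorm_mul] using hx

theorem KerBound.lintegral_integral_le {κ : X → X → ℂ} {C : ℝ≥0∞} (h : KerBound μ κ C)
    {f : X → ℂ} (hf : AEStronglyMeasurable f μ) :
    ∫⁻ x, ‖∫ y, κ x y * f y ∂μ‖ₑ ^ 2 ∂μ ≤ C * ∫⁻ y, ‖f y‖ₑ ^ 2 ∂μ := by
  refine le_trans (lintegral_mono fun x => ?_) (h.aemeasurable_le hf.enorm)
  simp only
  gcongr
  refine (enorm_integral_le_lintegral_enorm _).trans (le_of_eq ?_)
  simp only [enorm_mul]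

theorem KerBound.memLp {κ : X → X → ℂ} {C : ℝ≥0∞} (h : KerBound μ κ C) (hC : C ≠ ⊤)
    {f : X → ℂ} (hf : MemLp f 2 μ) : MemLp (fun x => ∫ y, κ x y * f y ∂μ) 2 μ := by
  refine (memLp_two_iff_lintegral ?_).mpr ?_
  · exact (AEStronglyMeasurable.kernel_mul h.1 hf.1).integral_prod_right'
  · exact (h.lintegral_integral_le hf.1).trans_lt
      (ENNReal.mul_lt_top hC.lt_top ((memLp_two_iff_lintegral hf.1).mp hf))

/-- A bounded kernel defines a bounded operator on `L²`. -/
theorem KerBound.exists_clm {κ : X → X → ℂ} {C : ℝ≥0∞} (h : KerBound μ κ C) (hC : C ≠ ⊤) :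
    ∃ T : Lp ℂ 2 μ →L[ℂ] Lp ℂ 2 μ, ‖T‖ ≤ √C.toReal ∧
      ∀ f : Lp ℂ 2 μ, T f =ᵐ[μ] fun x => ∫ y, κ x y * f y ∂μ := by
  have hM : ∀ f : Lp ℂ 2 μ, MemLp (fun x => ∫ y, κ x y * f y ∂μ) 2 μ :=
    fun f => h.memLp hC (Lp.memLp f)
  let T₀ : Lp ℂ 2 μ →ₗ[ℂ] Lp ℂ 2 μ :=
    { toFun := fun f => (hM f).toLp _
      map_add' := fun f g => by
        rw [← MemLp.toLp_add]
        refine MemLp.toLp_congr _ _ ?_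
        filter_upwards [h.ae_integrable hC (Lp.memLp f), h.ae_integrable hC (Lp.memLp g)]
          with x hf hg
        rw [Pi.add_apply, ← integral_add hf hg]
        refine integral_congr_ae ?_
        filter_upwards [Lp.coeFn_add f g] with y hy
        rw [hy, Pi.add_apply, mul_add]
      map_smul' := fun c f => by
        rw [RingHom.id_apply, ← MemLp.toLp_const_smul]
        refine MemLp.toLp_congr _ _ (Filter.Eventually.of_forall fun x => ?_)
        simp only [Pi.smul_apply, smul_eq_mul]
        rw [← integral_const_mul]
        refine integral_congr_ae ?_
        filter_upwards [Lp.coeFn_smul c f] with y hy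
        rw [hy, Pi.smul_apply, smul_eq_mul]; ring }
  have hT : ∀ f : Lp ℂ 2 μ, T₀ f =ᵐ[μ] fun x => ∫ y, κ x y * f y ∂μ := fun f => (hM f).coeFn_toLp
  have hb : ∀ f, ‖T₀ f‖ ≤ √C.toReal * ‖f‖ := by
    intro f
    have h1 := h.lintegral_integral_le (Lp.memLp f).1
    have h2 : ∫⁻ x, ‖T₀ f x‖ₑ ^ 2 ∂μ = ∫⁻ x, ‖∫ y, κ x y * f y ∂μ‖ₑ ^ 2 ∂μ := by
      refine lintegral_congr_ae ?_
      filter_upwards [hT f] with x hx; rw [hx]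
    rw [← h2, Lp.lintegral_sq, Lp.lintegral_sq] at h1
    have h3 := ENNReal.toReal_mono (ENNReal.mul_ne_top hC (by simp)) h1
    simp only [ENNReal.toReal_mul, ENNReal.toReal_pow, toReal_enorm] at h3
    rw [← Real.sqrt_sq (norm_nonneg f), ← Real.sqrt_mul ENNReal.toReal_nonneg]
    exact Real.le_sqrt_of_sq_le h3
  exact ⟨T₀.mkContinuous _ hb, T₀.mkContinuous_norm_le (Real.sqrt_nonneg _) hb, hT⟩

/-- The composition of the integral operators with the kernels `κ` and `m`. -/
theorem KerBound.ae_comp {κ m : X → X → ℂ} {C C' : ℝ≥0∞} (h : KerBound μ κ C) (hC : C ≠ ⊤)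
    (h' : KerBound μ m C') (hC' : C' ≠ ⊤) {f : X → ℂ} (hf : MemLp f 2 μ) :
    (fun x => ∫ y, κ x y * ∫ z, m y z * f z ∂μ ∂μ)
      =ᵐ[μ] fun x => ∫ z, (∫ y, κ x y * m y z ∂μ) * f z ∂μ := by
  have h1 : AEMeasurable (fun y => ∫⁻ z, ‖m y z‖ₑ * ‖f z‖ₑ ∂μ) μ :=
    AEMeasurable.lintegral_prod_right' (f := fun z : X × X => ‖m z.1 z.2‖ₑ * ‖f z.2‖ₑ)
      (h'.1.enorm.aemeasurable.mul hf.1.enorm.comp_snd)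
  have h2 : ∫⁻ x, (∫⁻ y, ‖κ x y‖ₑ * ∫⁻ z, ‖m y z‖ₑ * ‖f z‖ₑ ∂μ ∂μ) ^ 2 ∂μ ≠ ⊤ := by
    refine ((h.aemeasurable_le h1).trans_lt (ENNReal.mul_lt_top hC.lt_top ?_)).ne
    exact (h'.aemeasurable_le hf.1.enorm).trans_lt
      (ENNReal.mul_lt_top hC'.lt_top ((memLp_two_iff_lintegral hf.1).mp hf))
  have h3 : AEMeasurable (fun x => (∫⁻ y, ‖κ x y‖ₑ * ∫⁻ z, ‖m y z‖ₑ * ‖f z‖ₑ ∂μ ∂μ) ^ 2) μ := by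
    refine AEMeasurable.pow_const ?_ 2
    exact AEMeasurable.lintegral_prod_right' (f := fun z : X × X => ‖κ z.1 z.2‖ₑ * _)
      (h.1.enorm.aemeasurable.mul h1.comp_snd)
  filter_upwards [ae_lt_top' h3 h2] with x hx
  have hx' : ∫⁻ y, ‖κ x y‖ₑ * ∫⁻ z, ‖m y z‖ₑ * ‖f z‖ₑ ∂μ ∂μ < ⊤ := by
    simpa [ENNReal.pow_lt_top_iff] using hx
  have hI : Integrable (fun p : X × X => κ x p.1 * (m p.1 p.2 * f p.2)) (μ.prod μ) := by
    have hms : AEStronglyMeasurable (fun p : X × X => κ x p.1 * (m p.1 p.2 * f p.2))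
        (μ.prod μ) := by
      refine AEStronglyMeasurable.mul ?_ (AEStronglyMeasurable.kernel_mul h'.1 hf.1)
      exact ((h.1.of_uncurry_left).comp measurable_fst).aestronglyMeasurable
    refine ⟨hms, ?_⟩
    rw [HasFiniteIntegral, lintegral_prod _ hms.enorm]
    convert hx' using 3 with y
    simp only [enorm_mul]
    have hmy : AEMeasurable (fun z => ‖m y z‖ₑ * ‖f z‖ₑ) μ :=
      (h'.1.of_uncurry_left).enorm.aemeasurable.mul hf.1.enorm
    rw [lintegral_const_mul'' _ hmy]
  have hF := integral_integral_swap (f := fun y z => κ x y * (m y z * f z)) hI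
  simp only [integral_const_mul] at hF
  rw [hF]
  refine integral_congr_ae (Filter.Eventually.of_forall fun z => ?_)
  simp only
  rw [← integral_mul_const]
  refine integral_congr_ae (Filter.Eventually.of_forall fun y => ?_)
  simp only; ring

/-- For almost every x the values (T e_i)(x) are the coefficients of the conjugated row of κ at x,
so Bessel's inequality bounds the sum of their squares by the squared norm of the row; then
integrate over x. -/
theorem sum_norm_sq_le_of_kernel {κ : X → X → ℂ} (hm : Measurable (Function.uncurry κ))
    {ι : Type*} {e : ι → Lp ℂ 2 μ} (he : Orthonormal ℂ e) (T : Lp ℂ 2 μ →L[ℂ] Lp ℂ 2 μ)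
    (hT : ∀ f : Lp ℂ 2 μ, T f =ᵐ[μ] fun x => ∫ y, κ x y * f y ∂μ)
    (hfin : ∫⁻ x, ∫⁻ y, ‖κ x y‖ₑ ^ 2 ∂μ ∂μ ≠ ⊤) (s : Finset ι) :
    ∑ i ∈ s, ‖T (e i)‖ₑ ^ 2 ≤ ∫⁻ x, ∫⁻ y, ‖κ x y‖ₑ ^ 2 ∂μ ∂μ := by
  have hme : Measurable (Function.uncurry fun x y => ‖κ x y‖ₑ ^ 2) := hm.enorm.pow_const 2
  have hae := ae_lt_top (Measurable.lintegral_prod_right hme) hfin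
  simp only [← Lp.lintegral_sq]
  rw [← lintegral_finsetSum']
  · refine lintegral_mono_ae ?_
    have hall : ∀ᵐ x ∂μ, ∀ i ∈ s, T (e i) x = ∫ y, κ x y * e i y ∂μ := by
      rw [Filter.eventually_all_finset]
      exact fun i _ => hT (e i)
    filter_upwards [hae, hall] with x hx hall
    have hκ : MemLp (fun y => (starRingEnd ℂ) (κ x y)) 2 μ := by
      refine (memLp_two_iff_lintegral ?_).mpr ?_
      · exact (Complex.continuous_conj.measurable.comp hm.of_uncurry_left).aestronglyMeasurable
      · simpa using hx
    set k : Lp ℂ 2 μ := hκ.toLp _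
    have hk : ∀ i, inner ℂ k (e i) = ∫ y, κ x y * e i y ∂μ := by
      intro i
      rw [L2.inner_def]
      refine integral_congr_ae ?_
      filter_upwards [hκ.coeFn_toLp] with y hy
      rw [hy]; simp [mul_comm]
    have hB := he.sum_inner_products_le k (s := s)
    have h1 : ∀ i ∈ s, ‖T (e i) x‖ₑ ^ 2 = ENNReal.ofReal (‖inner ℂ (e i) k‖ ^ 2) := by
      intro i hi
      rw [hall i hi, ← hk i, norm_inner_symm, ← ofReal_norm, ENNReal.ofReal_pow (norm_nonneg _)]
    rw [Finset.sum_congr rfl h1, ← ENNReal.ofReal_sum_of_nonneg (fun i _ => by positivity)]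
    refine (ENNReal.ofReal_le_ofReal hB).trans (le_of_eq ?_)
    rw [ENNReal.ofReal_pow (norm_nonneg _), ofReal_norm, ← Lp.lintegral_sq]
    refine lintegral_congr_ae ?_
    filter_upwards [hκ.coeFn_toLp] with y hy
    rw [hy]; simp
  · intro i _
    exact (Lp.aestronglyMeasurable _).enorm.pow_const 2

/-- Hilbert–Schmidt operators are compact. -/
theorem isCompactOperator_of_kernel {κ : X → X → ℂ} (hm : Measurable (Function.uncurry κ))
    (T : Lp ℂ 2 μ →L[ℂ] Lp ℂ 2 μ)
    (hT : ∀ f : Lp ℂ 2 μ, T f =ᵐ[μ] fun x => ∫ y, κ x y * f y ∂μ)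
    (hfin : ∫⁻ x, ∫⁻ y, ‖κ x y‖ₑ ^ 2 ∂μ ∂μ ≠ ⊤) : IsCompactOperator T := by
  classical
  obtain ⟨w, b, hb⟩ := exists_hilbertBasis ℂ (Lp ℂ 2 μ)
  have hsum : Summable fun i => ‖T (b i)‖ ^ 2 := by
    refine summable_of_sum_le (c := (∫⁻ x, ∫⁻ y, ‖κ x y‖ₑ ^ 2 ∂μ ∂μ).toReal)
      (fun i => by positivity) fun s => ?_
    have h := ENNReal.toReal_mono hfin (sum_norm_sq_le_of_kernel hm b.orthonormal T hT hfin s)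
    rw [ENNReal.toReal_sum (by simp)] at h
    simpa using h
  have hcl := isClosed_setOfPred_isCompactOperator (𝕜₁ := ℂ) (𝕜₂ := ℂ) (σ₁₂ := RingHom.id ℂ)
    (M₁ := Lp ℂ 2 μ) (M₂ := Lp ℂ 2 μ)
  have : T ∈ {f : Lp ℂ 2 μ →L[ℂ] Lp ℂ 2 μ | IsCompactOperator f} := by
    rw [← hcl.closure_eq, Metric.mem_closure_iff]
    intro ε hε
    obtain ⟨F, hF⟩ := summable_iff_vanishing_norm.mp hsum ((ε / 2) ^ 2) (by positivity)
    -- The truncation of T to finitely many basis vectors has finite rank; by Cauchy–Schwarz the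
    -- error is controlled by the tail of ∑ ‖T b_i‖².
    let S : Lp ℂ 2 μ →L[ℂ] Lp ℂ 2 μ :=
      ∑ i ∈ F, (ContinuousLinearMap.toSpanSingleton ℂ (T (b i))) ∘L (innerSL ℂ (b i))
    have hS : ∀ v, S v = ∑ i ∈ F, (inner ℂ (b i) v) • T (b i) := by
      intro v; simp [S]
    refine ⟨S, ?_, ?_⟩
    · have : S ∈ compactOperator (RingHom.id ℂ) (Lp ℂ 2 μ) (Lp ℂ 2 μ) := by
        refine Submodule.sum_mem _ fun i _ => ?_
        have h : IsCompactOperator (ContinuousLinearMap.toSpanSingleton ℂ (T (b i))) :=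
          isCompactOperator_of_locallyCompactSpace_rng
            (ContinuousLinearMap.toSpanSingleton ℂ (T (b i)))
        exact h.comp_clm (innerSL ℂ (b i))
      exact this
    · rw [dist_eq_norm]
      refine lt_of_le_of_lt (ContinuousLinearMap.opNorm_le_bound _ (by positivity) fun v => ?_)
        (half_lt_self hε)
      have hs : HasSum (fun i => (inner ℂ (b i) v) • T (b i)) (T v) := by
        have := (b.hasSum_repr v).mapL T
        simpa [b.repr_apply_apply] using this
      have hlim : Filter.Tendsto (fun G : Finset w =>
          ∑ i ∈ G, (inner ℂ (b i) v) • T (b i) - S v) Filter.atTop (𝓝 (T v - S v)) :=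
        hs.sub_const (S v)
      refine le_of_tendsto hlim.norm ?_
      filter_upwards [Filter.eventually_ge_atTop F] with G hG
      rw [hS, ← Finset.sum_sdiff hG, add_sub_cancel_right]
      calc ‖∑ i ∈ G \ F, (inner ℂ (b i) v) • T (b i)‖
          ≤ ∑ i ∈ G \ F, ‖inner ℂ (b i) v‖ * ‖T (b i)‖ := by
            refine (norm_sum_le _ _).trans (le_of_eq ?_)
            simp only [norm_smul]
        _ ≤ √(∑ i ∈ G \ F, ‖inner ℂ (b i) v‖ ^ 2) * √(∑ i ∈ G \ F, ‖T (b i)‖ ^ 2) :=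
            Real.sum_mul_le_sqrt_mul_sqrt _ _ _
        _ ≤ ‖v‖ * (ε / 2) := by
            gcongr
            · exact Real.sqrt_le_iff.mpr ⟨norm_nonneg v, b.orthonormal.sum_inner_products_le v⟩
            · refine Real.sqrt_le_iff.mpr ⟨by positivity, ?_⟩
              have := hF (G \ F) Finset.sdiff_disjoint
              exact (le_abs_self _).trans this.le
        _ = ε / 2 * ‖v‖ := by ring
  exact this

end Kernel

/-! ### Substitutions -/

section Substitution

open scoped ENNReal

theorem lintegral_comp_affine (f : ℝ → ℝ≥0∞) (hf : Measurable f) {a : ℝ} (ha : a ≠ 0) (b : ℝ) :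
    ∫⁻ x, f x = ENNReal.ofReal |a| * ∫⁻ x, f (a * x + b) := by
  have h1 : ∫⁻ x, f (a * x + b) = ∫⁻ y, f (y + b) ∂(Measure.map (a * ·) volume) := by
    rw [lintegral_map (f := fun y => f (y + b)) (by fun_prop) (by fun_prop)]
  rw [h1, ← smul_eq_mul, ← lintegral_smul_measure, Real.smul_map_volume_mul_left ha, lintegral_add_right_eq_self]

theorem lintegral_smul_eq {E : Type*} [NormedAddCommGroup E] [NormedSpace ℝ E]
    [FiniteDimensional ℝ E] [MeasurableSpace E] [BorelSpace E] (μ : Measure E)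
    [μ.IsAddHaarMeasure] (f : E → ℝ≥0∞) (hf : Measurable f) {r : ℝ} (hr : 0 < r) :
    ∫⁻ x, f x ∂μ = ENNReal.ofReal (r ^ Module.finrank ℝ E) * ∫⁻ x, f (r • x) ∂μ := by
  have h1 : ∫⁻ x, f (r • x) ∂μ = ∫⁻ y, f y ∂(Measure.map (r • ·) μ) := by
    rw [lintegral_map hf (by fun_prop)]
  rw [h1, Measure.map_addHaar_smul μ hr.ne', lintegral_smul_measure, smul_eq_mul, ← mul_assoc,
    ← ENNReal.ofReal_mul (by positivity), abs_of_nonneg (by positivity),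
    mul_inv_cancel₀ (by positivity), ENNReal.ofReal_one, one_mul]

theorem measurePreserving_toE2 :
    MeasurePreserving (fun p : ℝ × ℝ => (!₂[p.1, p.2] : E2)) (volume.prod volume) volume :=
  (PiLp.volume_preserving_toLp (Fin 2)).comp (volume_preserving_finTwoArrow ℝ).symm

theorem measurable_toE2 : Measurable (fun p : ℝ × ℝ => (!₂[p.1, p.2] : E2)) :=
  measurePreserving_toE2.measurable

theorem lintegral_E2 {f : E2 → ℝ≥0∞} (hf : Measurable f) :
    ∫⁻ ζ, f ζ = ∫⁻ x : ℝ, ∫⁻ y : ℝ, f !₂[x, y] := by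
  rw [← measurePreserving_toE2.lintegral_comp hf,
    lintegral_prod (fun p : ℝ × ℝ => f !₂[p.1, p.2]) (hf.comp measurable_toE2).aemeasurable]

theorem E2.norm_sq (ζ : E2) : ‖ζ‖ ^ 2 = ζ 0 ^ 2 + ζ 1 ^ 2 := by
  simp [EuclideanSpace.norm_sq_eq, Fin.sum_univ_two]

theorem E3.norm_sq (ξ : E3) : ‖ξ‖ ^ 2 = ξ 0 ^ 2 + ξ 1 ^ 2 + ξ 2 ^ 2 := by
  simp [EuclideanSpace.norm_sq_eq, Fin.sum_univ_three]

theorem setLIntegral_ball_norm_rpow_lt_top {E : Type*} [NormedAddCommGroup E]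
    [InnerProductSpace ℝ E] [Nontrivial E] [FiniteDimensional ℝ E] [MeasurableSpace E]
    [BorelSpace E] {p : ℝ} (hp : -(Module.finrank ℝ E : ℝ) < p) :
    ∫⁻ x in Metric.ball (0 : E) 1, ENNReal.ofReal (‖x‖ ^ p) < ⊤ := by
  have h : IntegrableOn (fun x : E => ‖x‖ ^ p) (Metric.ball 0 1) := by
    rw [integrableOn_fun_norm_addHaar volume (f := fun y => y ^ p)]
    have h1 : IntegrableOn (fun y : ℝ => y ^ ((Module.finrank ℝ E : ℝ) - 1 + p))
        (Set.Ioo 0 1) :=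
      (intervalIntegral.integrableOn_Ioo_rpow_iff zero_lt_one).mpr (by linarith)
    refine h1.congr_fun (fun y hy => ?_) measurableSet_Ioo
    have hd : 1 ≤ Module.finrank ℝ E := Module.finrank_pos
    simp only
    rw [Real.rpow_add hy.1, smul_eq_mul, ← Real.rpow_natCast, Nat.cast_sub hd, Nat.cast_one]
  exact h.lintegral_lt_top

theorem lintegral_inv_add_sq {A : ℝ} (hA : 0 < A) (e : ℝ) :
    ∫⁻ y : ℝ, ENNReal.ofReal ((A + (y + e) ^ 2)⁻¹) = ENNReal.ofReal (Real.pi / √A) := by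
  have hs : 0 < √A := Real.sqrt_pos.mpr hA
  rw [lintegral_comp_affine _ (by fun_prop) hs.ne' (-e)]
  have h1 : ∀ x : ℝ, ENNReal.ofReal ((A + (√A * x + -e + e) ^ 2)⁻¹)
      = ENNReal.ofReal A⁻¹ * ENNReal.ofReal ((1 + x ^ 2)⁻¹) := by
    intro x
    rw [← ENNReal.ofReal_mul (by positivity), ← mul_inv]
    congr 2
    have := Real.sq_sqrt hA.le
    linear_combination x ^ 2 * this
  simp only [h1]
  rw [lintegral_const_mul _ (by fun_prop), ← ofReal_integral_eq_lintegral_ofReal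
    integrable_inv_one_add_sq (Filter.Eventually.of_forall fun x => by positivity),
    integral_univ_inv_one_add_sq, ← ENNReal.ofReal_mul (by positivity),
    ← ENNReal.ofReal_mul (by positivity)]
  congr 1
  rw [abs_of_pos hs]
  have := Real.sq_sqrt hA.le
  field_simp
  linear_combination this

/-- With c = √max(e, 0) one has |e - y²| ≥ (|y| - c)², and A² + w⁴ ≥ A(A + w²)/2, so two Lorentzians
centred at ±c dominate. The bound is uniform in e; the exponent -3/2 is the one forced by e = 0,
where both centres coincide. -/
theorem lintegral_inv_sq_add_sq_le {A : ℝ} (hA : 0 < A) (e : ℝ) :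
    ∫⁻ y : ℝ, ENNReal.ofReal ((A ^ 2 + (e - y ^ 2) ^ 2)⁻¹)
      ≤ ENNReal.ofReal (4 * Real.pi * A ^ (-(3 / 2) : ℝ)) := by
  set c := √(max e 0)
  have hc0 : 0 ≤ c := Real.sqrt_nonneg _
  have hc : c ^ 2 = max e 0 := Real.sq_sqrt (le_max_right _ _)
  have key : ∀ y : ℝ, (A ^ 2 + (e - y ^ 2) ^ 2)⁻¹
      ≤ 2 / A * ((A + (y + c) ^ 2)⁻¹ + (A + (y + -c) ^ 2)⁻¹) := by
    have aux : ∀ y w : ℝ, w ^ 4 ≤ (e - y ^ 2) ^ 2 →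
        (A ^ 2 + (e - y ^ 2) ^ 2)⁻¹ ≤ 2 / A * (A + w ^ 2)⁻¹ := by
      intro y w h
      rw [← div_eq_mul_inv, div_div, inv_le_comm₀ (by positivity) (by positivity), inv_div]
      have := sq_nonneg (A - w ^ 2)
      rw [div_le_iff₀ (by norm_num)]
      nlinarith
    have hcase : ∀ y : ℝ, 0 ≤ y → (y - c) ^ 4 ≤ (e - y ^ 2) ^ 2 := by
      intro y hy
      rcases le_total e 0 with he | he
      · have : c = 0 := by simp [c, max_eq_right he]
        rw [this, sub_zero]
        nlinarith [sq_nonneg y]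
      · rw [max_eq_left he] at hc
        have h1 : e - y ^ 2 = -((y - c) * (y + c)) := by rw [← hc]; ring
        have h2 : |y - c| ≤ y + c := abs_le.mpr ⟨by linarith, by linarith⟩
        have h3 : (y - c) ^ 2 ≤ (y + c) ^ 2 := by rw [← sq_abs]; gcongr
        rw [h1]
        calc (y - c) ^ 4 = (y - c) ^ 2 * (y - c) ^ 2 := by ring
          _ ≤ (y - c) ^ 2 * (y + c) ^ 2 := by gcongr
          _ = _ := by ring
    intro y
    rcases le_total 0 y with hy | hy
    · refine (aux y (y + -c) (by simpa [sub_eq_add_neg] using hcase y hy)).trans ?_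
      gcongr
      have : 0 ≤ (A + (y + c) ^ 2)⁻¹ := by positivity
      linarith
    · have h := hcase (-y) (by linarith)
      refine (aux y (y + c) ?_).trans ?_
      · calc (y + c) ^ 4 = (-y - c) ^ 4 := by ring
          _ ≤ _ := h
          _ = _ := by ring
      gcongr
      have : 0 ≤ (A + (y + -c) ^ 2)⁻¹ := by positivity
      linarith
  calc ∫⁻ y : ℝ, ENNReal.ofReal ((A ^ 2 + (e - y ^ 2) ^ 2)⁻¹)
      ≤ ∫⁻ y : ℝ, ENNReal.ofReal (2 / A) * (ENNReal.ofReal ((A + (y + c) ^ 2)⁻¹) +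
          ENNReal.ofReal ((A + (y + -c) ^ 2)⁻¹)) := by
        refine lintegral_mono fun y => ?_
        rw [← ENNReal.ofReal_add (by positivity) (by positivity),
          ← ENNReal.ofReal_mul (by positivity)]
        exact ENNReal.ofReal_le_ofReal (key y)
    _ = _ := by
        rw [lintegral_const_mul _ (by fun_prop), lintegral_add_left (by fun_prop),
          lintegral_inv_add_sq hA, lintegral_inv_add_sq hA,
          ← ENNReal.ofReal_add (by positivity) (by positivity),
          ← ENNReal.ofReal_mul (by positivity)]
        congr 1
        have h1 : A ^ (-(3 / 2) : ℝ) = (A * √A)⁻¹ := by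
          rw [Real.rpow_neg hA.le, show (3 / 2 : ℝ) = 1 + 1 / 2 by norm_num,
            Real.rpow_add hA, Real.rpow_one, ← Real.sqrt_eq_rpow]
        rw [h1]
        field_simp
        ring

end Substitution

/-! ### The kernel of the trace on the Fourier side -/

section TraceKernel

open scoped ENNReal

/-- The quadratic-type form `δ² (|η|² + t²)`, where `δ = η₀ - ζ₀` and `t` is the normal frequency
for which the circle through `η + tν` meets the fibre over `ζ`. -/
def qForm (α : ℝ) (η ζ : E2) : ℝ :=
  (η 0 - ζ 0) ^ 2 * (‖η‖ ^ 2 + ‖ζ‖ ^ 2) / 2 +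
    ((‖η‖ ^ 2 - ‖ζ‖ ^ 2) ^ 2 * (Real.cos α / Real.sin α) ^ 2 +
      (η 0 - ζ 0) ^ 4 * (Real.sin α / Real.cos α) ^ 2) / 4

/-- The kernel of the trace on the Fourier side. -/
def traceKernel (α : ℝ) (η ζ : E2) : ℝ := |η 0 - ζ 0| / (|Real.sin α| * qForm α η ζ)

/-- A majorant of the trace kernel. -/
def majKernel (α : ℝ) (η ζ : E2) : ℝ :=
  |η 0 - ζ 0| ^ (3 / 4 : ℝ) * (‖η‖ ^ 2 + ‖ζ‖ ^ 2) ^ (1 / 8 : ℝ) / qForm α η ζ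

theorem qForm_nonneg (α : ℝ) (η ζ : E2) : 0 ≤ qForm α η ζ := by unfold qForm; positivity

theorem qForm_symm (α : ℝ) (η ζ : E2) : qForm α η ζ = qForm α ζ η := by unfold qForm; ring

theorem traceKernel_nonneg (α : ℝ) (η ζ : E2) : 0 ≤ traceKernel α η ζ := by
  have := qForm_nonneg α η ζ
  unfold traceKernel; positivity

theorem majKernel_nonneg (α : ℝ) (η ζ : E2) : 0 ≤ majKernel α η ζ := by
  have := qForm_nonneg α η ζ
  unfold majKernel; positivity

theorem majKernel_symm (α : ℝ) (η ζ : E2) : majKernel α η ζ = majKernel α ζ η := by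
  unfold majKernel; rw [qForm_symm, abs_sub_comm, add_comm]

@[fun_prop] theorem measurable_qForm (α : ℝ) :
    Measurable (fun p : E2 × E2 => qForm α p.1 p.2) := by
  unfold qForm; fun_prop

@[fun_prop] theorem measurable_traceKernel (α : ℝ) :
    Measurable (fun p : E2 × E2 => traceKernel α p.1 p.2) := by
  unfold traceKernel; fun_prop

@[fun_prop] theorem measurable_majKernel (α : ℝ) :
    Measurable (fun p : E2 × E2 => majKernel α p.1 p.2) := by
  unfold majKernel; fun_prop

/-- The degree is 3/4 + 2/8 - 4. It reduces all row integrals to |η| = 1. -/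
theorem majKernel_smul (α : ℝ) {r : ℝ} (hr : 0 < r) (η ζ : E2) :
    majKernel α (r • η) (r • ζ) = r ^ (-3 : ℝ) * majKernel α η ζ := by
  have hq : qForm α (r • η) (r • ζ) = r ^ 4 * qForm α η ζ := by
    unfold qForm
    simp only [PiLp.smul_apply, smul_eq_mul, norm_smul, Real.norm_of_nonneg hr.le]
    ring
  unfold majKernel
  rw [hq]
  simp only [PiLp.smul_apply, smul_eq_mul, norm_smul, Real.norm_of_nonneg hr.le]
  rw [← mul_sub, abs_mul, abs_of_pos hr, mul_pow, mul_pow, ← mul_add,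
    Real.mul_rpow hr.le (abs_nonneg _), Real.mul_rpow (by positivity) (by positivity),
    ← Real.rpow_natCast r 2, ← Real.rpow_mul hr.le]
  have h1 : r ^ (-3 : ℝ) = r ^ (3 / 4 : ℝ) * r ^ (((2 : ℕ) : ℝ) * (1 / 8)) * (r ^ 4)⁻¹ := by
    rw [← Real.rpow_natCast r 4, ← Real.rpow_neg hr.le, ← Real.rpow_add hr, ← Real.rpow_add hr]
    norm_num
  rw [h1, mul_div_mul_comm, div_eq_mul_inv, div_eq_mul_inv, div_eq_mul_inv]
  field_simp

theorem diff_sq_le (η ζ : E2) : (η 0 - ζ 0) ^ 2 ≤ 2 * (‖η‖ ^ 2 + ‖ζ‖ ^ 2) := by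
  rw [E2.norm_sq, E2.norm_sq]
  nlinarith [sq_nonneg (η 0 + ζ 0), sq_nonneg (η 1), sq_nonneg (ζ 1)]

/-- For |η| = 1 the form q is of size |ζ|⁴ far away, thanks to the term with (|η|² - |ζ|²)². On
bounded sets it dominates (η₀ - ζ₀)² + (1 - |ζ|²)², which vanishes only at ζ = (η₀, ±η₁). -/
theorem majKernel_mul_le {α : ℝ} (hsin : Real.sin α ≠ 0) (hcos : Real.cos α ≠ 0) {c : ℝ}
    (hc0 : 0 ≤ c) (hc1 : c ≤ 1) : ∃ A B : ℝ, 0 ≤ A ∧ 0 ≤ B ∧ ∀ η ζ : E2, ‖η‖ = 1 →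
      majKernel α η ζ * ‖ζ‖ ^ c ≤ A * jap (c - 3) ζ +
        (if |ζ 0| ≤ 2 then B * (|η 0 - ζ 0| ^ (3 / 4 : ℝ) *
          (|η 0 - ζ 0| ^ 2 + (1 - ζ 0 ^ 2 - ζ 1 ^ 2) ^ 2)⁻¹) else 0) := by
  set k := (Real.cos α / Real.sin α) ^ 2
  have hk : 0 < k := by positivity
  set m := min (1 / 2) (k / 4)
  have hm : 0 < m := by positivity
  refine ⟨2 * (2 / (k / 4 * (9 / 25))), 4 / m, by positivity, by positivity, fun η ζ hη => ?_⟩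
  set N := ‖η‖ ^ 2 + ‖ζ‖ ^ 2 with hN
  have hN1 : N = jap 2 ζ := by rw [jap_two, hN, hη]; ring
  have hN1' : N = 1 + ‖ζ‖ ^ 2 := by rw [hN, hη]; ring
  have hNpos : 0 < N := by rw [hN1]; exact jap_pos _ _
  have hd := diff_sq_le η ζ
  rw [← hN] at hd
  have hζc : ‖ζ‖ ^ c ≤ jap c ζ := by
    calc ‖ζ‖ ^ c ≤ (jap 1 ζ) ^ c := Real.rpow_le_rpow (norm_nonneg _) (norm_le_jap ζ) hc0
      _ = _ := by rw [jap_rpow, one_mul]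
  have hRHS2 : 0 ≤ (if |ζ 0| ≤ 2 then 4 / m * (|η 0 - ζ 0| ^ (3 / 4 : ℝ) *
          (|η 0 - ζ 0| ^ 2 + (1 - ζ 0 ^ 2 - ζ 1 ^ 2) ^ 2)⁻¹) else 0) := by
    split_ifs <;> positivity
  -- Here N = 1 + |ζ|². If N ≥ 5, then |ζ|² - 1 = N - 2 ≥ 3N/5, whence the factor 9/25 below; if N <
  -- 5, then |ζ| ≤ 2.
  rcases le_or_gt 5 N with h5 | h5
  · have hnum : |η 0 - ζ 0| ^ (3 / 4 : ℝ) * N ^ (1 / 8 : ℝ) ≤ 2 * N ^ (1 / 2 : ℝ) := by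
      have h1 : |η 0 - ζ 0| ^ (3 / 4 : ℝ) ≤ (2 * N) ^ (3 / 8 : ℝ) := by
        calc |η 0 - ζ 0| ^ (3 / 4 : ℝ) = ((η 0 - ζ 0) ^ 2) ^ (3 / 8 : ℝ) := by
              rw [← sq_abs, ← Real.rpow_natCast, ← Real.rpow_mul (abs_nonneg _)]; norm_num
          _ ≤ _ := by gcongr
      have h2 : (2 : ℝ) ^ (3 / 8 : ℝ) ≤ 2 := by
        calc (2 : ℝ) ^ (3 / 8 : ℝ) ≤ 2 ^ (1 : ℝ) :=
              Real.rpow_le_rpow_of_exponent_le (by norm_num) (by norm_num)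
          _ = 2 := Real.rpow_one 2
      calc _ ≤ (2 * N) ^ (3 / 8 : ℝ) * N ^ (1 / 8 : ℝ) := by gcongr
        _ = 2 ^ (3 / 8 : ℝ) * N ^ (1 / 2 : ℝ) := by
            rw [Real.mul_rpow (by norm_num) hNpos.le, mul_assoc, ← Real.rpow_add hNpos]; norm_num
        _ ≤ _ := by gcongr
    have hq : k / 4 * (9 / 25) * N ^ 2 ≤ qForm α η ζ := by
      have hD : (‖η‖ ^ 2 - ‖ζ‖ ^ 2) ^ 2 ≥ 9 / 25 * N ^ 2 := by
        rw [hη]; nlinarith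
      have : qForm α η ζ ≥ (‖η‖ ^ 2 - ‖ζ‖ ^ 2) ^ 2 * k / 4 := by
        unfold qForm
        have h1 : 0 ≤ (η 0 - ζ 0) ^ 2 * (‖η‖ ^ 2 + ‖ζ‖ ^ 2) / 2 := by positivity
        have h2 : 0 ≤ (η 0 - ζ 0) ^ 4 * (Real.sin α / Real.cos α) ^ 2 := by positivity
        linarith
      nlinarith
    have h3 : majKernel α η ζ * ‖ζ‖ ^ c
        ≤ (2 * N ^ (1 / 2 : ℝ)) / (k / 4 * (9 / 25) * N ^ 2) * jap c ζ := by
      unfold majKernel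
      gcongr
    have h4 : (2 * N ^ (1 / 2 : ℝ)) / (k / 4 * (9 / 25) * N ^ 2) * jap c ζ
        = (2 / (k / 4 * (9 / 25))) * jap (c - 3) ζ := by
      have e1 : N ^ (1 / 2 : ℝ) = jap 1 ζ := by rw [hN1, jap_rpow]; norm_num
      have e2 : N ^ 2 = jap 4 ζ := by rw [hN1, jap_sq]; norm_num
      have e3 : jap (c - 3) ζ = jap 1 ζ * jap c ζ * jap (-4) ζ := by
        rw [jap_mul, jap_mul]; ring_nf
      have e4 : jap (-4) ζ = (jap 4 ζ)⁻¹ := eq_inv_of_mul_eq_one_left (jap_neg_mul 4 ζ)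
      rw [e1, e2, e3, e4]
      have := jap_pos 4 ζ
      field_simp
    rw [h4] at h3
    have : 0 ≤ (2 / (k / 4 * (9 / 25))) * jap (c - 3) ζ := by
      have := jap_nonneg (c - 3) ζ; positivity
    linarith
  · have hζ : |ζ 0| ≤ 2 := by
      have h1 := E2.norm_sq ζ
      exact abs_le_of_sq_le_sq (by nlinarith [sq_nonneg (ζ 1)]) (by norm_num)
    rw [if_pos hζ]
    have hA : 0 ≤ 2 * (2 / (k / 4 * (9 / 25))) * jap (c - 3) ζ := by
      have := jap_nonneg (c - 3) ζ; positivity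
    refine le_trans ?_ (le_add_of_nonneg_left hA)
    have hn2 : ‖ζ‖ ≤ 2 := by nlinarith [norm_nonneg ζ]
    have hb1 : ‖ζ‖ ^ c ≤ 2 := by
      calc ‖ζ‖ ^ c ≤ 2 ^ c := Real.rpow_le_rpow (norm_nonneg _) hn2 hc0
        _ ≤ 2 ^ (1 : ℝ) := Real.rpow_le_rpow_of_exponent_le (by norm_num) hc1
        _ = 2 := Real.rpow_one 2
    have hb2 : N ^ (1 / 8 : ℝ) ≤ 2 := by
      calc N ^ (1 / 8 : ℝ) ≤ (2 ^ (8 : ℝ)) ^ (1 / 8 : ℝ) :=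
            Real.rpow_le_rpow hNpos.le (by norm_num; linarith) (by norm_num)
        _ = 2 := by rw [← Real.rpow_mul (by norm_num)]; norm_num
    set P := |η 0 - ζ 0| ^ 2 + (1 - ζ 0 ^ 2 - ζ 1 ^ 2) ^ 2
    have hP : 0 ≤ P := by positivity
    have hq : m * P ≤ qForm α η ζ := by
      have e : ‖η‖ ^ 2 - ‖ζ‖ ^ 2 = 1 - ζ 0 ^ 2 - ζ 1 ^ 2 := by rw [hη, E2.norm_sq]; ring
      have h2 : 0 ≤ (η 0 - ζ 0) ^ 4 * (Real.sin α / Real.cos α) ^ 2 := by positivity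
      have hm1 : m ≤ 1 / 2 := min_le_left _ _
      have hm2 : m ≤ k / 4 := min_le_right _ _
      have hN1'' : 1 ≤ N := by rw [hN1']; nlinarith [sq_nonneg ‖ζ‖]
      have e1 : m * |η 0 - ζ 0| ^ 2 ≤ (η 0 - ζ 0) ^ 2 * N / 2 := by
        rw [sq_abs]
        have h3 := mul_le_mul_of_nonneg_left hN1'' (sq_nonneg (η 0 - ζ 0))
        have h4 := mul_le_mul_of_nonneg_right hm1 (sq_nonneg (η 0 - ζ 0))
        linarith
      have e2 : m * (1 - ζ 0 ^ 2 - ζ 1 ^ 2) ^ 2 ≤ (1 - ζ 0 ^ 2 - ζ 1 ^ 2) ^ 2 * k / 4 := by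
        have h4 := mul_le_mul_of_nonneg_right hm2 (sq_nonneg (1 - ζ 0 ^ 2 - ζ 1 ^ 2))
        linarith
      unfold qForm
      rw [e]
      simp only [P, mul_add]
      linarith
    rcases hP.eq_or_lt with hP0 | hP0
    · have hd0 : |η 0 - ζ 0| = 0 := by
        have h1 : 0 ≤ (1 - ζ 0 ^ 2 - ζ 1 ^ 2) ^ 2 := by positivity
        have h2 : |η 0 - ζ 0| ^ 2 ≤ 0 := by simp only [P] at hP0; linarith
        exact pow_eq_zero_iff two_ne_zero |>.mp (le_antisymm h2 (by positivity))
      unfold majKernel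
      rw [hd0, Real.zero_rpow (by norm_num)]; simp
    · unfold majKernel
      calc |η 0 - ζ 0| ^ (3 / 4 : ℝ) * N ^ (1 / 8 : ℝ) / qForm α η ζ * ‖ζ‖ ^ c
          ≤ |η 0 - ζ 0| ^ (3 / 4 : ℝ) * 2 / (m * P) * 2 := by gcongr
        _ = _ := by field_simp; ring

/-- The far part converges because c - 3 < -2. Near the singular points the integral over ζ₁ costs
|η₀ - ζ₀|^{-3/2}, uniformly in η, even when η₁ = 0 and the two singular points merge; together with
the numerator |η₀ - ζ₀|^{3/4} this leaves the integrable power -3/4. -/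
theorem lintegral_majKernel_unit {α : ℝ} (hsin : Real.sin α ≠ 0) (hcos : Real.cos α ≠ 0) {c : ℝ}
    (hc0 : 0 ≤ c) (hc1 : c < 1) : ∃ C : ℝ≥0∞, C ≠ ⊤ ∧ ∀ η : E2, ‖η‖ = 1 →
      ∫⁻ ζ, ENNReal.ofReal (majKernel α η ζ * ‖ζ‖ ^ c) ≤ C := by
  obtain ⟨A, B, hA, hB, h⟩ := majKernel_mul_le hsin hcos hc0 hc1.le
  set J := ∫⁻ ζ : E2, ENNReal.ofReal (A * jap (c - 3) ζ)
  have hJ : J ≠ ⊤ := by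
    have : Integrable (fun ζ : E2 => A * jap (c - 3) ζ) :=
      (integrable_jap volume (by simp; linarith)).const_mul A
    exact this.lintegral_lt_top.ne
  set I := ∫⁻ u : ℝ in Set.Icc (-3) 3, ENNReal.ofReal (|u| ^ (-(3 / 4) : ℝ))
  have hI : I ≠ ⊤ := by
    have h1 : IntegrableOn (fun u : ℝ => |u| ^ (-(3 / 4) : ℝ)) (Set.Icc (-3) 3) := by
      have h2 := (integrableOn_fun_norm_addHaar (E := ℝ) (volume : Measure ℝ) (r := 4)
        (f := fun y : ℝ => y ^ (-(3 / 4) : ℝ))).mpr ?_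
      · refine h2.mono_set fun u hu => ?_
        simp only [Metric.mem_ball, dist_zero_right, Real.norm_eq_abs]
        exact lt_of_le_of_lt (abs_le.mpr hu) (by norm_num)
      · simp only [Module.finrank_self, le_refl, tsub_eq_zero_of_le, pow_zero, one_smul]
        exact (intervalIntegral.integrableOn_Ioo_rpow_iff (by norm_num)).mpr (by norm_num)
    exact h1.lintegral_lt_top.ne
  refine ⟨J + ENNReal.ofReal (B * (4 * Real.pi)) * I,
    ENNReal.add_ne_top.mpr ⟨hJ, ENNReal.mul_ne_top ENNReal.ofReal_ne_top hI⟩, fun η hη => ?_⟩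
  set F : E2 → ℝ := fun ζ => if |ζ 0| ≤ 2 then B * (|η 0 - ζ 0| ^ (3 / 4 : ℝ) *
          (|η 0 - ζ 0| ^ 2 + (1 - ζ 0 ^ 2 - ζ 1 ^ 2) ^ 2)⁻¹) else 0
  have hFm : Measurable F := by
    refine Measurable.ite (measurableSet_le (by fun_prop) (by fun_prop)) (by fun_prop) (by fun_prop)
  have hF0 : ∀ ζ, 0 ≤ F ζ := fun ζ => by simp only [F]; split_ifs <;> positivity
  have hη0 : |η 0| ≤ 1 := by
    have h1 := E2.norm_sq η
    rw [hη] at h1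
    exact abs_le_of_sq_le_sq (by nlinarith [sq_nonneg (η 1)]) (by norm_num)
  have hF : ∫⁻ ζ, ENNReal.ofReal (F ζ) ≤ ENNReal.ofReal (B * (4 * Real.pi)) * I := by
    rw [lintegral_E2 hFm.ennreal_ofReal]
    have hin : ∀ᵐ x : ℝ, ∫⁻ y : ℝ, ENNReal.ofReal (F !₂[x, y]) ≤
        ENNReal.ofReal (B * (4 * Real.pi)) *
          (Set.Icc (-3) 3).indicator (fun u => ENNReal.ofReal (|u| ^ (-(3 / 4) : ℝ))) (x - η 0) := by
      have hne : ∀ᵐ x : ℝ, x ≠ η 0 := by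
        simp [ae_iff]
      filter_upwards [hne] with x hx
      by_cases h2 : |x| ≤ 2
      · have hA : 0 < |η 0 - x| := abs_pos.mpr (sub_ne_zero.mpr hx.symm)
        have hmem : x - η 0 ∈ Set.Icc (-3 : ℝ) 3 := by
          rw [abs_le] at h2 hη0; exact ⟨by linarith [h2.1, hη0.2], by linarith [h2.2, hη0.1]⟩
        have e1 : ∀ y : ℝ, ENNReal.ofReal (F !₂[x, y])
            = ENNReal.ofReal (B * |η 0 - x| ^ (3 / 4 : ℝ)) *
              ENNReal.ofReal ((|η 0 - x| ^ 2 + (1 - x ^ 2 - y ^ 2) ^ 2)⁻¹) := by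
          intro y
          rw [← ENNReal.ofReal_mul (by positivity)]
          simp only [F, Matrix.cons_val_zero, Matrix.cons_val_one, h2, if_true]
          congr 1; ring
        simp only [e1]
        rw [lintegral_const_mul _ (by fun_prop), Set.indicator_of_mem hmem]
        refine (mul_le_mul_right (lintegral_inv_sq_add_sq_le hA (1 - x ^ 2)) _).trans
          (le_of_eq ?_)
        rw [← ENNReal.ofReal_mul (by positivity), ← ENNReal.ofReal_mul (by positivity)]
        congr 1
        have e2 : |x - η 0| ^ (-(3 / 4) : ℝ)
            = |η 0 - x| ^ (3 / 4 : ℝ) * |η 0 - x| ^ (-(3 / 2) : ℝ) := by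
          rw [← Real.rpow_add hA, abs_sub_comm]; norm_num
        rw [e2]; ring
      · have e1 : ∀ y : ℝ, ENNReal.ofReal (F !₂[x, y]) = 0 := by
          intro y
          simp [F, h2]
        simp [e1]
    refine (lintegral_mono_ae hin).trans (le_of_eq ?_)
    have hmI : Measurable ((Set.Icc (-3 : ℝ) 3).indicator
        (fun u => ENNReal.ofReal (|u| ^ (-(3 / 4) : ℝ)))) :=
      Measurable.indicator (by fun_prop) measurableSet_Icc
    have hmI' : Measurable fun x : ℝ => (Set.Icc (-3 : ℝ) 3).indicator
        (fun u => ENNReal.ofReal (|u| ^ (-(3 / 4) : ℝ))) (x - η 0) :=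
      hmI.comp (measurable_id.sub_const _)
    rw [lintegral_const_mul _ hmI', lintegral_sub_right_eq_self,
      lintegral_indicator measurableSet_Icc]
  calc ∫⁻ ζ, ENNReal.ofReal (majKernel α η ζ * ‖ζ‖ ^ c)
      ≤ ∫⁻ ζ, (ENNReal.ofReal (A * jap (c - 3) ζ) + ENNReal.ofReal (F ζ)) := by
        refine lintegral_mono fun ζ => ?_
        rw [← ENNReal.ofReal_add (mul_nonneg hA (jap_nonneg _ _)) (hF0 ζ)]
        exact ENNReal.ofReal_le_ofReal (h η ζ hη)
    _ = J + ∫⁻ ζ, ENNReal.ofReal (F ζ) := lintegral_add_left (by fun_prop) _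
    _ ≤ _ := by gcongr

/-- The weighted row bound of the majorant kernel. -/
theorem lintegral_majKernel_le {α : ℝ} (hsin : Real.sin α ≠ 0) (hcos : Real.cos α ≠ 0) {c : ℝ}
    (hc0 : 0 ≤ c) (hc1 : c < 1) : ∃ C : ℝ≥0∞, C ≠ ⊤ ∧ ∀ η : E2, η ≠ 0 →
      ∫⁻ ζ, ENNReal.ofReal (majKernel α η ζ * ‖ζ‖ ^ c) ≤ C * ENNReal.ofReal (‖η‖ ^ (c - 1)) := by
  obtain ⟨C, hC, h⟩ := lintegral_majKernel_unit hsin hcos hc0 hc1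
  refine ⟨C, hC, fun η hη => ?_⟩
  set r := ‖η‖
  have hr : 0 < r := norm_pos_iff.mpr hη
  have hω : ‖r⁻¹ • η‖ = 1 := by
    rw [norm_smul, Real.norm_of_nonneg (by positivity)]; exact inv_mul_cancel₀ hr.ne'
  have hm : Measurable fun ζ : E2 => ENNReal.ofReal (majKernel α η ζ * ‖ζ‖ ^ c) := by
    have := (measurable_majKernel α).comp (measurable_prodMk_left (x := η))
    exact (Measurable.mul this (by fun_prop)).ennreal_ofReal
  -- Rescaling ζ by r = |η| produces r² from the area, r^{-3} from the kernel and r^c from the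
  -- weight.
  rw [lintegral_smul_eq volume _ hm hr]
  have e : ∀ ζ : E2, ENNReal.ofReal (majKernel α η (r • ζ) * ‖r • ζ‖ ^ c)
      = ENNReal.ofReal (r ^ (c - 3)) *
        ENNReal.ofReal (majKernel α (r⁻¹ • η) ζ * ‖ζ‖ ^ c) := by
    intro ζ
    rw [← ENNReal.ofReal_mul (by positivity)]
    congr 1
    have h1 := majKernel_smul α hr (r⁻¹ • η) ζ
    rw [smul_smul, mul_inv_cancel₀ hr.ne', one_smul] at h1
    rw [h1, norm_smul, Real.norm_of_nonneg hr.le, Real.mul_rpow hr.le (norm_nonneg _),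
      show c - 3 = -3 + c by ring, Real.rpow_add hr]
    ring
  simp only [e]
  rw [lintegral_const_mul']
  · have h1 : ENNReal.ofReal (r ^ Module.finrank ℝ E2) * ENNReal.ofReal (r ^ (c - 3))
        = ENNReal.ofReal (r ^ (c - 1)) := by
      rw [← ENNReal.ofReal_mul (by positivity), ← Real.rpow_natCast, ← Real.rpow_add hr]
      congr 2; simp; ring
    rw [← mul_assoc, h1, mul_comm]
    gcongr
    exact h _ hω
  · exact ENNReal.ofReal_ne_top

end TraceKernel

/-! ### Schur bounds for the trace kernel, and its regularisation. -/

section WeightedKernel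

open scoped ENNReal

/-- The kernel `|η|^a k(η, ζ) |ζ|^{1-a}`. -/
def weightedKernel (a : ℝ) (k : E2 → E2 → ℝ) (η ζ : E2) : ℂ :=
  ((‖η‖ ^ a * k η ζ * ‖ζ‖ ^ (1 - a) : ℝ) : ℂ)

theorem measurable_weightedKernel (a : ℝ) {k : E2 → E2 → ℝ}
    (hk : Measurable fun p : E2 × E2 => k p.1 p.2) :
    Measurable (Function.uncurry (weightedKernel a k)) := by
  unfold weightedKernel Function.uncurry
  fun_prop

-- The weighted kernel has degree -2, so constant Schur weights suffice: the row bound with exponent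
-- 1 - a gives |η|^{-a}, the column bound with exponent a gives |ζ|^{a-1}, and both cancel the outer
-- weights. The quadratic dependence on M, with C independent of k, is what later makes the
-- regularisation error small in norm.
set_option maxHeartbeats 1600000 in
theorem kerBound_weightedKernel {α : ℝ} (hsin : Real.sin α ≠ 0) (hcos : Real.cos α ≠ 0) {a : ℝ}
    (ha0 : 0 < a) (ha1 : a < 1) : ∃ C : ℝ≥0∞, C ≠ ⊤ ∧ ∀ (M : ℝ) (k : E2 → E2 → ℝ), 0 ≤ M →
      (Measurable fun p : E2 × E2 => k p.1 p.2) →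
      (∀ η ζ, |k η ζ| ≤ M * majKernel α η ζ) →
      KerBound volume (weightedKernel a k) (ENNReal.ofReal (M ^ 2) * C) := by
  obtain ⟨C₁, hC₁, h₁⟩ := lintegral_majKernel_le hsin hcos (c := 1 - a) (by linarith) (by linarith)
  obtain ⟨C₂, hC₂, h₂⟩ := lintegral_majKernel_le hsin hcos (c := a) (by linarith) (by linarith)
  refine ⟨C₁ * C₂, ENNReal.mul_ne_top hC₁ hC₂, fun M k hM hk hle => ?_⟩
  have hne : ∀ᵐ η : E2, η ≠ 0 := by simp [ae_iff]
  have hmaj : ∀ η : E2, Measurable fun ζ => majKernel α η ζ := fun η =>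
    (measurable_majKernel α).comp (measurable_prodMk_left (x := η))
  have hb : ∀ η ζ, ‖weightedKernel a k η ζ‖ₑ
      ≤ ENNReal.ofReal (‖η‖ ^ a * (M * majKernel α η ζ) * ‖ζ‖ ^ (1 - a)) := by
    intro η ζ
    rw [← ofReal_norm]
    refine ENNReal.ofReal_le_ofReal ?_
    unfold weightedKernel
    rw [Complex.norm_real, Real.norm_eq_abs, abs_mul, abs_mul, abs_of_nonneg (a := ‖η‖ ^ a)
      (by positivity), abs_of_nonneg (a := ‖ζ‖ ^ (1 - a)) (by positivity)]
    have := hle η ζ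
    gcongr
  have key : KerBound volume (weightedKernel a k)
      ((ENNReal.ofReal M * C₁) * (ENNReal.ofReal M * C₂)) := by
    refine KerBound.of_schur (measurable_weightedKernel a hk) (p := 1) (q := 1) measurable_one
      measurable_one (by simp) (by simp) ?_ ?_
    · filter_upwards [hne] with η hη
      have hr : 0 < ‖η‖ := norm_pos_iff.mpr hη
      simp only [Pi.one_apply, mul_one]
      calc ∫⁻ ζ, ‖weightedKernel a k η ζ‖ₑ
          ≤ ∫⁻ ζ, ENNReal.ofReal (‖η‖ ^ a * M) *
              ENNReal.ofReal (majKernel α η ζ * ‖ζ‖ ^ (1 - a)) := by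
            refine lintegral_mono fun ζ => (hb η ζ).trans (le_of_eq ?_)
            rw [← ENNReal.ofReal_mul (by positivity)]
            congr 1; ring
        _ = ENNReal.ofReal (‖η‖ ^ a * M) *
              ∫⁻ ζ, ENNReal.ofReal (majKernel α η ζ * ‖ζ‖ ^ (1 - a)) :=
            lintegral_const_mul' _ _ ENNReal.ofReal_ne_top
        _ ≤ ENNReal.ofReal (‖η‖ ^ a * M) * (C₁ * ENNReal.ofReal (‖η‖ ^ (1 - a - 1))) := by
            gcongr; exact h₁ η hη
        _ = ENNReal.ofReal M * C₁ := by
            rw [mul_left_comm, ← ENNReal.ofReal_mul (by positivity), mul_comm]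
            congr 2
            rw [mul_right_comm, ← Real.rpow_add hr]
            simp
    · filter_upwards [hne] with ζ hζ
      have hr : 0 < ‖ζ‖ := norm_pos_iff.mpr hζ
      simp only [Pi.one_apply, mul_one]
      calc ∫⁻ η, ‖weightedKernel a k η ζ‖ₑ
          ≤ ∫⁻ η, ENNReal.ofReal (‖ζ‖ ^ (1 - a) * M) *
              ENNReal.ofReal (majKernel α ζ η * ‖η‖ ^ a) := by
            refine lintegral_mono fun η => (hb η ζ).trans (le_of_eq ?_)
            rw [← ENNReal.ofReal_mul (by positivity), majKernel_symm]
            congr 1; ring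
        _ = ENNReal.ofReal (‖ζ‖ ^ (1 - a) * M) *
              ∫⁻ η, ENNReal.ofReal (majKernel α ζ η * ‖η‖ ^ a) :=
            lintegral_const_mul' _ _ ENNReal.ofReal_ne_top
        _ ≤ ENNReal.ofReal (‖ζ‖ ^ (1 - a) * M) * (C₂ * ENNReal.ofReal (‖ζ‖ ^ (a - 1))) := by
            gcongr; exact h₂ ζ hζ
        _ = ENNReal.ofReal M * C₂ := by
            rw [mul_left_comm, ← ENNReal.ofReal_mul (by positivity), mul_comm]
            congr 2
            rw [mul_right_comm, ← Real.rpow_add hr]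
            simp
  convert key using 1
  rw [ENNReal.ofReal_pow hM]; ring

theorem diff_sq_mul_le_qForm (α : ℝ) (η ζ : E2) :
    (η 0 - ζ 0) ^ 2 * (‖η‖ ^ 2 + ‖ζ‖ ^ 2) / 2 ≤ qForm α η ζ := by
  unfold qForm
  have : 0 ≤ ((‖η‖ ^ 2 - ‖ζ‖ ^ 2) ^ 2 * (Real.cos α / Real.sin α) ^ 2 +
      (η 0 - ζ 0) ^ 4 * (Real.sin α / Real.cos α) ^ 2) / 4 := by positivity
  linarith

theorem abs_diff_eq_rpow {d : ℝ} : |d| = |d| ^ (3 / 4 : ℝ) * (d ^ 2) ^ (1 / 8 : ℝ) := by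
  rcases eq_or_ne d 0 with rfl | hd
  · simp
  · have h : 0 < |d| := abs_pos.mpr hd
    rw [← sq_abs, ← Real.rpow_natCast, ← Real.rpow_mul h.le, ← Real.rpow_add h]
    norm_num

/-- Write |δ| = |δ|^{3/4} (δ²)^{1/8} for δ = η₀ - ζ₀ and use δ² ≤ 2(|η|² + |ζ|²). -/
theorem traceKernel_le {α : ℝ} (hsin : Real.sin α ≠ 0) (η ζ : E2) :
    traceKernel α η ζ ≤ 2 / |Real.sin α| * majKernel α η ζ := by
  have hs : 0 < |Real.sin α| := abs_pos.mpr hsin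
  have hq := qForm_nonneg α η ζ
  have hd := diff_sq_le η ζ
  set N := ‖η‖ ^ 2 + ‖ζ‖ ^ 2
  have hN : 0 ≤ N := by positivity
  have h1 : |η 0 - ζ 0| ≤ 2 * (|η 0 - ζ 0| ^ (3 / 4 : ℝ) * N ^ (1 / 8 : ℝ)) := by
    have h2 : ((η 0 - ζ 0) ^ 2) ^ (1 / 8 : ℝ) ≤ 2 * N ^ (1 / 8 : ℝ) := by
      calc ((η 0 - ζ 0) ^ 2) ^ (1 / 8 : ℝ) ≤ (2 * N) ^ (1 / 8 : ℝ) := by gcongr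
        _ = 2 ^ (1 / 8 : ℝ) * N ^ (1 / 8 : ℝ) := Real.mul_rpow (by norm_num) hN
        _ ≤ 2 ^ (1 : ℝ) * N ^ (1 / 8 : ℝ) := by
            gcongr
            · norm_num
            · norm_num
        _ = _ := by rw [Real.rpow_one]
    calc |η 0 - ζ 0| = |η 0 - ζ 0| ^ (3 / 4 : ℝ) * ((η 0 - ζ 0) ^ 2) ^ (1 / 8 : ℝ) :=
          abs_diff_eq_rpow
      _ ≤ |η 0 - ζ 0| ^ (3 / 4 : ℝ) * (2 * N ^ (1 / 8 : ℝ)) := by gcongr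
      _ = _ := by ring
  unfold traceKernel majKernel
  calc |η 0 - ζ 0| / (|Real.sin α| * qForm α η ζ)
      ≤ 2 * (|η 0 - ζ 0| ^ (3 / 4 : ℝ) * N ^ (1 / 8 : ℝ)) / (|Real.sin α| * qForm α η ζ) := by
        gcongr
    _ = _ := by rw [div_mul_div_comm]

/-- The regularised trace kernel. -/
def regKernel (α ε : ℝ) (η ζ : E2) : ℝ :=
  |η 0 - ζ 0| / (|Real.sin α| * (qForm α η ζ + ε * (1 + ‖η‖ ^ 2 + ‖ζ‖ ^ 2) ^ 2))

@[fun_prop] theorem measurable_regKernel (α ε : ℝ) :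
    Measurable (fun p : E2 × E2 => regKernel α ε p.1 p.2) := by
  unfold regKernel; fun_prop

theorem regKernel_nonneg (α : ℝ) {ε : ℝ} (hε : 0 ≤ ε) (η ζ : E2) : 0 ≤ regKernel α ε η ζ := by
  have := qForm_nonneg α η ζ
  unfold regKernel; positivity

/-- On the zero set of q the numerators of the kernels vanish too, so inequalities between the
quotients remain true there under the convention `x / 0 = 0`. -/
theorem eq_zero_of_qForm_eq_zero {α : ℝ} {η ζ : E2} (h : qForm α η ζ = 0) : |η 0 - ζ 0| = 0 := by
  have h1 := diff_sq_mul_le_qForm α η ζ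
  have h2 := diff_sq_le η ζ
  rw [h] at h1
  have h3 : ((η 0 - ζ 0) ^ 2) ^ 2 ≤ 0 := by
    nlinarith [sq_nonneg (η 0 - ζ 0), mul_le_mul_of_nonneg_left h2 (sq_nonneg (η 0 - ζ 0))]
  have h4 : (η 0 - ζ 0) ^ 2 = 0 := pow_eq_zero_iff two_ne_zero |>.mp (le_antisymm h3 (by positivity))
  rw [pow_eq_zero_iff two_ne_zero |>.mp h4, abs_zero]

theorem regKernel_le_traceKernel {α : ℝ} (hsin : Real.sin α ≠ 0) {ε : ℝ} (hε : 0 ≤ ε)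
    (η ζ : E2) : regKernel α ε η ζ ≤ traceKernel α η ζ := by
  have hs : 0 < |Real.sin α| := abs_pos.mpr hsin
  unfold regKernel traceKernel
  rcases (qForm_nonneg α η ζ).eq_or_lt with hq | hq
  · rw [eq_zero_of_qForm_eq_zero hq.symm]; simp
  · gcongr
    have : 0 ≤ ε * (1 + ‖η‖ ^ 2 + ‖ζ‖ ^ 2) ^ 2 := by positivity
    linarith

/-- This explains the exponents 3/4 and 1/8 of `majKernel`. The relative error x/(q + x) with x =
ε(1 + |η|² + |ζ|²)² is at most (x/q)^{1/8}. Put N = |η|² + |ζ|² and δ = η₀ - ζ₀. As |ζ| ≥ 1 gives x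
≤ 4εN², and q ≥ δ²N/2, this is at most (8εN/δ²)^{1/8}. A small power is needed for the row integrals
to stay finite; any exponent below 1/4 would serve. -/
theorem traceKernel_sub_regKernel_le {α : ℝ} (hsin : Real.sin α ≠ 0) {ε : ℝ} (hε : 0 ≤ ε)
    (η ζ : E2) (hζ : 1 ≤ ‖ζ‖) :
    traceKernel α η ζ - regKernel α ε η ζ
      ≤ (8 * ε) ^ (1 / 8 : ℝ) / |Real.sin α| * majKernel α η ζ := by
  have hs : 0 < |Real.sin α| := abs_pos.mpr hsin
  rcases (qForm_nonneg α η ζ).eq_or_lt with hq | hq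
  · unfold regKernel traceKernel majKernel
    rw [← hq, eq_zero_of_qForm_eq_zero hq.symm]; simp
  have h1 := diff_sq_mul_le_qForm α η ζ
  set d := η 0 - ζ 0 with hd
  set Q := qForm α η ζ with hQ
  set N := ‖η‖ ^ 2 + ‖ζ‖ ^ 2 with hN
  have hN1 : 1 ≤ N := by nlinarith [sq_nonneg ‖η‖]
  rcases eq_or_ne d 0 with h0 | h0
  · unfold regKernel traceKernel majKernel
    rw [← hd, h0]; simp
  have hdp : 0 < |d| := abs_pos.mpr h0
  set x := ε * (1 + ‖η‖ ^ 2 + ‖ζ‖ ^ 2) ^ 2 with hx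
  have hx0 : 0 ≤ x := by positivity
  have hx4 : x ≤ 4 * ε * N ^ 2 := by
    have : (1 + ‖η‖ ^ 2 + ‖ζ‖ ^ 2) ^ 2 ≤ (2 * N) ^ 2 := by
      gcongr; rw [add_assoc, ← hN]; linarith
    calc x ≤ ε * (2 * N) ^ 2 := by rw [hx]; gcongr
      _ = _ := by ring
  have hfrac : x / (Q + x) ≤ (x / Q) ^ (1 / 8 : ℝ) := by
    have hy0 : 0 ≤ x / (Q + x) := by positivity
    have hy1 : x / (Q + x) ≤ 1 := (div_le_one (by positivity)).mpr (by linarith)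
    calc x / (Q + x) = (x / (Q + x)) ^ (1 : ℝ) := (Real.rpow_one _).symm
      _ ≤ (x / (Q + x)) ^ (1 / 8 : ℝ) :=
          Real.rpow_le_rpow_of_exponent_ge_of_imp hy0 hy1 (by norm_num) (by norm_num)
      _ ≤ _ := by gcongr; linarith
  have hxQ : (x / Q) ^ (1 / 8 : ℝ) ≤ (8 * ε) ^ (1 / 8 : ℝ) * N ^ (1 / 8 : ℝ) /
      (d ^ 2) ^ (1 / 8 : ℝ) := by
    have hd2 : 0 < d ^ 2 := by positivity
    rw [← Real.mul_rpow (by positivity) (by positivity),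
      ← Real.div_rpow (by positivity) (by positivity)]
    refine Real.rpow_le_rpow (by positivity) ?_ (by norm_num)
    rw [div_le_div_iff₀ hq hd2]
    calc x * d ^ 2 ≤ 4 * ε * N ^ 2 * d ^ 2 := by gcongr
      _ = 8 * ε * N * (d ^ 2 * N / 2) := by ring
      _ ≤ _ := by gcongr
  have e1 : traceKernel α η ζ - regKernel α ε η ζ = |d| / (|Real.sin α| * Q) * (x / (Q + x)) := by
    unfold traceKernel regKernel
    rw [← hd, ← hQ, ← hx]
    field_simp
    ring
  rw [e1]
  calc |d| / (|Real.sin α| * Q) * (x / (Q + x))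
      ≤ |d| / (|Real.sin α| * Q) * ((8 * ε) ^ (1 / 8 : ℝ) * N ^ (1 / 8 : ℝ) /
      (d ^ 2) ^ (1 / 8 : ℝ)) := 
          mul_le_mul_of_nonneg_left (hfrac.trans hxQ) (by positivity)
    _ = (|d| / (d ^ 2) ^ (1 / 8 : ℝ)) * N ^ (1 / 8 : ℝ) / Q *
          ((8 * ε) ^ (1 / 8 : ℝ) / |Real.sin α|) := by field_simp
    _ = _ := by
        have e2 : |d| / (d ^ 2) ^ (1 / 8 : ℝ) = |d| ^ (3 / 4 : ℝ) := by
          have : 0 < (d ^ 2) ^ (1 / 8 : ℝ) := by positivity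
          rw [div_eq_iff this.ne']; exact abs_diff_eq_rpow
        rw [e2]; unfold majKernel; rw [← hd, ← hQ, ← hN]; ring

/-- A mean value bound for the regularised quartic form, with x, y, y' in the role of |η|², |ζ|²,
|ζ'|²: a shift of size h changes a form of degree 4 by at most a constant times h T³, where T bounds
the sizes. -/
theorem abs_quarticForm_sub_le {k l ε x y y' d d' T h : ℝ} (hk : 0 ≤ k) (hl : 0 ≤ l) (hε : 0 ≤ ε)
    (hx : 0 ≤ x) (hy : 0 ≤ y) (hy' : 0 ≤ y') (hh : 0 ≤ h) (hT : 0 ≤ T)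
    (hL : 1 + x + y ≤ T ^ 2) (hL' : 1 + x + y' ≤ T ^ 2) (hd : d ^ 2 ≤ 4 * T ^ 2)
    (hd' : d' ^ 2 ≤ 4 * T ^ 2) (hdd : |d' ^ 2 - d ^ 2| ≤ 4 * h * T) (hyy : |y' - y| ≤ 2 * h * T) :
    |(d' ^ 2 * (x + y') / 2 + ((x - y') ^ 2 * k + d' ^ 4 * l) / 4 + ε * (1 + x + y') ^ 2) -
      (d ^ 2 * (x + y) / 2 + ((x - y) ^ 2 * k + d ^ 4 * l) / 4 + ε * (1 + x + y) ^ 2)|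
      ≤ (6 + k + 8 * l + 4 * ε) * h * T ^ 3 := by
  have e : (d' ^ 2 * (x + y') / 2 + ((x - y') ^ 2 * k + d' ^ 4 * l) / 4 + ε * (1 + x + y') ^ 2) -
      (d ^ 2 * (x + y) / 2 + ((x - y) ^ 2 * k + d ^ 4 * l) / 4 + ε * (1 + x + y) ^ 2) =
      (d' ^ 2 - d ^ 2) * ((x + y') / 2 + l * (d' ^ 2 + d ^ 2) / 4) +
      (y' - y) * (d ^ 2 / 2 - k * ((x - y') + (x - y)) / 4
        + ε * ((1 + x + y') + (1 + x + y))) := by ring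
  rw [e]
  have b1 : |(x + y') / 2 + l * (d' ^ 2 + d ^ 2) / 4| ≤ (1 / 2 + 2 * l) * T ^ 2 := by
    rw [abs_of_nonneg (by positivity)]
    have : l * (d' ^ 2 + d ^ 2) ≤ l * (8 * T ^ 2) := mul_le_mul_of_nonneg_left (by linarith) hl
    linarith
  have b2 : |d ^ 2 / 2 - k * ((x - y') + (x - y)) / 4
        + ε * ((1 + x + y') + (1 + x + y))| ≤ (2 + k / 2 + 2 * ε) * T ^ 2 := by
    have c2 : |k * ((x - y') + (x - y))| ≤ k * (2 * T ^ 2) := by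
      rw [abs_mul, abs_of_nonneg hk]
      exact mul_le_mul_of_nonneg_left (abs_le.mpr ⟨by linarith, by linarith⟩) hk
    have c3 : 0 ≤ ε * ((1 + x + y') + (1 + x + y)) := by positivity
    have c4 : ε * ((1 + x + y') + (1 + x + y)) ≤ ε * (2 * T ^ 2) :=
      mul_le_mul_of_nonneg_left (by linarith) hε
    have c5 : 0 ≤ ε * T ^ 2 := by positivity
    have c6 := sq_nonneg d
    have c7 := sq_nonneg T
    rw [abs_le] at c2 ⊢
    constructor
    · linarith [c2.1, c2.2]
    · linarith [c2.1, c2.2]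
  calc _ ≤ |d' ^ 2 - d ^ 2| * |(x + y') / 2 + l * (d' ^ 2 + d ^ 2) / 4| +
        |y' - y| * |d ^ 2 / 2 - k * ((x - y') + (x - y)) / 4
          + ε * ((1 + x + y') + (1 + x + y))| := by
        rw [← abs_mul, ← abs_mul]; exact abs_add_le _ _
    _ ≤ (4 * h * T) * ((1 / 2 + 2 * l) * T ^ 2) +
        (2 * h * T) * ((2 + k / 2 + 2 * ε) * T ^ 2) :=
        add_le_add (mul_le_mul hdd b1 (abs_nonneg _) (by positivity))
          (mul_le_mul hyy b2 (abs_nonneg _) (by positivity))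
    _ = (6 + k + 8 * l + 4 * ε) * h * T ^ 3 := by ring

/-- The quotient rule in finite form. Of the power w⁹, one factor bounds h and the other eight come
from the losses w⁴ in P' and in P' - P. -/
theorem abs_div_sub_div_le {B ε d d' P P' L w h : ℝ} (hB : 0 ≤ B) (hε : 0 < ε) (hL : 0 < L)
    (hw : 1 ≤ w) (hh : 0 ≤ h) (hhw : h ≤ w) (hdd : |d' - d| ≤ h)
    (hP : ε * L ^ 2 ≤ P) (hP' : ε * L ^ 2 / w ^ 4 ≤ P')
    (hPP : |d| * |P' - P| ≤ 2 * B * h * (L ^ 2 * w ^ 4)) :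
    |(|d'| / P' - |d| / P)| ≤ (1 / ε + 2 * B / ε ^ 2) * w ^ 9 * (L ^ 2)⁻¹ := by
  have hw0 : 0 < w := by linarith
  have hPpos : 0 < P := lt_of_lt_of_le (by positivity) hP
  have hP'pos : 0 < P' := lt_of_lt_of_le (by positivity) hP'
  have e1 : |d'| / P' - |d| / P = (|d'| - |d|) / P' + |d| * (P - P') / (P * P') := by
    field_simp
    ring
  have t1 : |(|d'| - |d|) / P'| ≤ (1 / ε) * (h * w ^ 8) * (L ^ 2)⁻¹ := by
    rw [abs_div, abs_of_pos hP'pos]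
    calc |(|d'| - |d|)| / P' ≤ h / (ε * L ^ 2 / w ^ 4) :=
          div_le_div₀ hh ((abs_abs_sub_abs_le d' d).trans hdd) (by positivity) hP'
      _ = (1 / ε) * (h * w ^ 4) * (L ^ 2)⁻¹ := by field_simp
      _ ≤ _ := by
        have : w ^ 4 ≤ w ^ 8 := pow_le_pow_right₀ hw (by norm_num)
        gcongr
  have t2 : |(|d| * (P - P') / (P * P'))| ≤ (2 * B / ε ^ 2) * (h * w ^ 8) * (L ^ 2)⁻¹ := by
    rw [abs_div, abs_mul, abs_abs, abs_of_pos (mul_pos hPpos hP'pos), abs_sub_comm]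
    calc |d| * |P' - P| / (P * P')
        ≤ 2 * B * h * (L ^ 2 * w ^ 4) / ((ε * L ^ 2) * (ε * L ^ 2 / w ^ 4)) :=
          div_le_div₀ (by positivity) hPP (by positivity)
            (mul_le_mul hP hP' (by positivity) hPpos.le)
      _ = _ := by field_simp
  rw [e1]
  calc _ ≤ (1 / ε) * (h * w ^ 8) * (L ^ 2)⁻¹ + (2 * B / ε ^ 2) * (h * w ^ 8) * (L ^ 2)⁻¹ :=
        (abs_add_le _ _).trans (add_le_add t1 t2)
    _ = (1 / ε + 2 * B / ε ^ 2) * (h * w ^ 8) * (L ^ 2)⁻¹ := by ring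
    _ ≤ (1 / ε + 2 * B / ε ^ 2) * (w * w ^ 8) * (L ^ 2)⁻¹ := by gcongr
    _ = _ := by ring

/-- The regularised kernel behaves like a symbol of order -3 in (η, ζ), so a difference in ζ gains
one order: (1 + |η|² + |ζ|²)^{-2} instead of the power -3/2. The growth in ζ' - ζ is harmless, since
it will be integrated against a rapidly decreasing function. -/
theorem regKernel_sub_le {α : ℝ} (hsin : Real.sin α ≠ 0) {ε : ℝ} (hε : 0 < ε) :
    ∃ C : ℝ, 0 ≤ C ∧ ∀ η ζ ζ' : E2, |regKernel α ε η ζ' - regKernel α ε η ζ|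
      ≤ C * jap 9 (ζ' - ζ) * ((1 + ‖η‖ ^ 2 + ‖ζ‖ ^ 2) ^ 2)⁻¹ := by
  have hs : 0 < |Real.sin α| := abs_pos.mpr hsin
  obtain ⟨k, hk⟩ : ∃ k, k = (Real.cos α / Real.sin α) ^ 2 := ⟨_, rfl⟩
  obtain ⟨l, hl⟩ : ∃ l, l = (Real.sin α / Real.cos α) ^ 2 := ⟨_, rfl⟩
  have hk0 : 0 ≤ k := by rw [hk]; positivity
  have hl0 : 0 ≤ l := by rw [hl]; positivity
  obtain ⟨B, hBdef⟩ : ∃ B, B = 6 + k + 8 * l + 4 * ε := ⟨_, rfl⟩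
  have hB : 0 ≤ B := by rw [hBdef]; positivity
  refine ⟨2 ^ (9 / 2 : ℝ) * ((1 / ε + 2 * B / ε ^ 2) / |Real.sin α|), by positivity,
    fun η ζ ζ' => ?_⟩
  obtain ⟨h, hh⟩ : ∃ h, h = ‖ζ' - ζ‖ := ⟨_, rfl⟩
  -- This w makes 1 + |η|² + |ζ|² and 1 + |η|² + |ζ'|² comparable up to the factor w².
  obtain ⟨w, hw⟩ : ∃ w, w = √(2 * (1 + h ^ 2)) := ⟨_, rfl⟩
  obtain ⟨x, hx⟩ : ∃ x, x = ‖η‖ := ⟨_, rfl⟩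
  obtain ⟨y, hy⟩ : ∃ y, y = ‖ζ‖ := ⟨_, rfl⟩
  obtain ⟨y', hy'⟩ : ∃ y', y' = ‖ζ'‖ := ⟨_, rfl⟩
  obtain ⟨d, hd⟩ : ∃ d, d = η 0 - ζ 0 := ⟨_, rfl⟩
  obtain ⟨d', hd'⟩ : ∃ d', d' = η 0 - ζ' 0 := ⟨_, rfl⟩
  have hz1 : y' ≤ y + h := by
    rw [hy, hy', hh]
    calc ‖ζ'‖ = ‖ζ + (ζ' - ζ)‖ := by congr 1; abel
      _ ≤ _ := norm_add_le _ _
  have hz2 : y ≤ y' + h := by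
    rw [hy, hy', hh]
    calc ‖ζ‖ = ‖ζ' - (ζ' - ζ)‖ := by congr 1; abel
      _ ≤ _ := norm_sub_le _ _
  have hdd : |d' - d| ≤ h := by
    have e : d' - d = -((ζ' - ζ) 0) := by rw [hd, hd']; simp
    rw [e, abs_neg, hh]
    exact PiLp.norm_apply_le (ζ' - ζ) 0
  have hds : d ^ 2 ≤ 2 * (x ^ 2 + y ^ 2) := by rw [hd, hx, hy]; exact diff_sq_le η ζ
  have hds' : d' ^ 2 ≤ 2 * (x ^ 2 + y' ^ 2) := by rw [hd', hx, hy']; exact diff_sq_le η ζ'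
  have hx0 : 0 ≤ x := hx ▸ norm_nonneg _
  have hy0 : 0 ≤ y := hy ▸ norm_nonneg _
  have hy0' : 0 ≤ y' := hy' ▸ norm_nonneg _
  have hh0 : 0 ≤ h := hh ▸ norm_nonneg _
  have ek : regKernel α ε η ζ = |d| / (d ^ 2 * (x ^ 2 + y ^ 2) / 2 +
      ((x ^ 2 - y ^ 2) ^ 2 * k + d ^ 4 * l) / 4 + ε * (1 + x ^ 2 + y ^ 2) ^ 2) / |Real.sin α| := by
    rw [hd, hx, hy, hk, hl]; unfold regKernel qForm; rw [div_div, mul_comm |Real.sin α|]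
  have ek' : regKernel α ε η ζ' = |d'| / (d' ^ 2 * (x ^ 2 + y' ^ 2) / 2 +
      ((x ^ 2 - y' ^ 2) ^ 2 * k + d' ^ 4 * l) / 4 + ε * (1 + x ^ 2 + y' ^ 2) ^ 2) /
        |Real.sin α| := by
    rw [hd', hx, hy', hk, hl]; unfold regKernel qForm; rw [div_div, mul_comm |Real.sin α|]
  have hj : w ^ 9 = 2 ^ (9 / 2 : ℝ) * jap 9 (ζ' - ζ) := by
    rw [hw, Real.sqrt_eq_rpow, ← Real.rpow_natCast, ← Real.rpow_mul (by positivity),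
      Real.mul_rpow (by norm_num) (by positivity)]
    unfold jap
    rw [← hh]
    norm_num
  have hw2 : w ^ 2 = 2 * (1 + h ^ 2) := by rw [hw]; exact Real.sq_sqrt (by positivity)
  have hw1 : 1 ≤ w := by rw [hw]; exact Real.one_le_sqrt.mpr (by nlinarith [sq_nonneg h])
  have hhw : h ≤ w := by rw [hw]; exact Real.le_sqrt_of_sq_le (by nlinarith [sq_nonneg h])
  rw [ek, ek', ← sub_div, abs_div, abs_abs, ← hx, ← hy]
  clear ek ek' hk hl hx hy hy' hd hd' hw
  obtain ⟨L, hL⟩ : ∃ L, L = 1 + x ^ 2 + y ^ 2 := ⟨_, rfl⟩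
  obtain ⟨L', hL'⟩ : ∃ L', L' = 1 + x ^ 2 + y' ^ 2 := ⟨_, rfl⟩
  have hL0 : 0 < L := by rw [hL]; positivity
  have hL0' : 0 < L' := by rw [hL']; positivity
  have hsq1 : y' ^ 2 ≤ 2 * y ^ 2 + 2 * h ^ 2 := by
    nlinarith [sq_nonneg (y - h), pow_le_pow_left₀ hy0' hz1 2]
  have hsq2 : y ^ 2 ≤ 2 * y' ^ 2 + 2 * h ^ 2 := by
    nlinarith [sq_nonneg (y' - h), pow_le_pow_left₀ hy0 hz2 2]
  have hLL' : L' ≤ L * w ^ 2 := by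
    have h1 : 0 ≤ x ^ 2 * h ^ 2 := by positivity
    have h2 : 0 ≤ y ^ 2 * h ^ 2 := by positivity
    have h3 := sq_nonneg x
    rw [hw2, hL', hL]; linarith
  have hL'L : L ≤ L' * w ^ 2 := by
    have h1 : 0 ≤ x ^ 2 * h ^ 2 := by positivity
    have h2 : 0 ≤ y' ^ 2 * h ^ 2 := by positivity
    have h3 := sq_nonneg x
    rw [hw2, hL', hL]; linarith
  -- A common bound for the sizes of both points: |ζ|, |ζ'| ≤ T and |d|, |d'| ≤ 2T.
  obtain ⟨T, hT⟩ : ∃ T, T = √L * w := ⟨_, rfl⟩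
  have hT0 : 0 ≤ T := by rw [hT]; positivity
  have hT2 : T ^ 2 = L * w ^ 2 := by rw [hT, mul_pow, Real.sq_sqrt hL0.le]
  have hLT : L ≤ T ^ 2 := by
    rw [hT2]; exact le_mul_of_one_le_right hL0.le (one_le_pow₀ hw1)
  have hL'T : L' ≤ T ^ 2 := hT2 ▸ hLL'
  have hyT : y ≤ T := abs_le_of_sq_le_sq' (by linarith [sq_nonneg x]) hT0 |>.2
  have hyT' : y' ≤ T := abs_le_of_sq_le_sq' (by linarith [sq_nonneg x]) hT0 |>.2
  have hd4 : d ^ 2 ≤ 4 * T ^ 2 := by linarith [sq_nonneg T]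
  have hd4' : d' ^ 2 ≤ 4 * T ^ 2 := by linarith [sq_nonneg T]
  have hdT : |d| ≤ 2 * T := abs_le_of_sq_le_sq (by linarith) (by positivity)
  have hdT' : |d'| ≤ 2 * T := abs_le_of_sq_le_sq (by linarith) (by positivity)
  have hsqd : |d' ^ 2 - d ^ 2| ≤ 4 * h * T := by
    have e : d' ^ 2 - d ^ 2 = (d' - d) * (d' + d) := by ring
    rw [e, abs_mul]
    calc |d' - d| * |d' + d| ≤ h * (4 * T) :=
          mul_le_mul hdd ((abs_add_le d' d).trans (by linarith)) (abs_nonneg _) hh0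
      _ = _ := by ring
  have hNN : |y' ^ 2 - y ^ 2| ≤ 2 * h * T := by
    have e : y' ^ 2 - y ^ 2 = (y' - y) * (y' + y) := by ring
    rw [e, abs_mul, abs_of_nonneg (a := y' + y) (by positivity)]
    calc |y' - y| * (y' + y) ≤ h * (2 * T) :=
          mul_le_mul (abs_le.mpr ⟨by linarith, by linarith⟩) (by linarith) (by positivity) hh0
      _ = _ := by ring
  have hQQ := abs_quarticForm_sub_le hk0 hl0 hε.le (sq_nonneg x) (sq_nonneg y) (sq_nonneg y') hh0
    hT0 (hL ▸ hLT) (hL' ▸ hL'T) hd4 hd4' hsqd hNN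
  rw [← hBdef] at hQQ
  have hfin := abs_div_sub_div_le (d := d) (d' := d') hB hε hL0 hw1 hh0 hhw hdd
    (P := d ^ 2 * (x ^ 2 + y ^ 2) / 2 +
      ((x ^ 2 - y ^ 2) ^ 2 * k + d ^ 4 * l) / 4 + ε * (1 + x ^ 2 + y ^ 2) ^ 2)
    (P' := d' ^ 2 * (x ^ 2 + y' ^ 2) / 2 +
      ((x ^ 2 - y' ^ 2) ^ 2 * k + d' ^ 4 * l) / 4 + ε * (1 + x ^ 2 + y' ^ 2) ^ 2)
    (by rw [← hL]; exact le_add_of_nonneg_left (by positivity))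
    (by
      rw [← hL', div_le_iff₀ (by positivity)]
      calc ε * L ^ 2 ≤ ε * (L' * w ^ 2) ^ 2 := by gcongr
        _ = ε * L' ^ 2 * w ^ 4 := by ring
        _ ≤ _ := mul_le_mul_of_nonneg_right (le_add_of_nonneg_left (by positivity))
          (by positivity))
    (by
      calc _ ≤ (2 * T) * (B * h * T ^ 3) := mul_le_mul hdT hQQ (abs_nonneg _) (by positivity)
        _ = 2 * B * h * (T ^ 2) ^ 2 := by ring
        _ = _ := by rw [hT2]; ring)
  rw [hj] at hfin
  rw [← hL] at hfin ⊢
  calc _ ≤ (1 / ε + 2 * B / ε ^ 2) * (2 ^ (9 / 2 : ℝ) * jap 9 (ζ' - ζ)) * (L ^ 2)⁻¹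
        / |Real.sin α| := by gcongr
    _ = _ := by ring

end WeightedKernel

/-! ### Cut-offs as operators between bracket weights and homogeneous weights. -/

section MultKernel

open scoped ENNReal

theorem jap_sub_comm {E : Type*} [NormedAddCommGroup E] (s : ℝ) (x y : E) :
    jap s (x - y) = jap s (y - x) := by
  unfold jap; rw [norm_sub_rev]

/-- The kernel of multiplication by a function with the Fourier transform `a`, with the weights
`‖ζ‖^s` and `⟨ζ'⟩^{-s}`. -/
def multKernel (s : ℝ) (a : E2 → ℂ) (ζ ζ' : E2) : ℂ :=
  ((‖ζ‖ ^ s * jap (-s) ζ' : ℝ) : ℂ) * a (ζ - ζ')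

theorem measurable_multKernel (s : ℝ) {a : E2 → ℂ} (ha : Measurable a) :
    Measurable (Function.uncurry (multKernel s a)) := by
  unfold multKernel Function.uncurry
  fun_prop

/-- Peetre's inequality moves the bracket from ζ' to ζ at the cost of one power of ⟨ζ - ζ'⟩, leaving
a function of ζ times a convolution kernel. -/
theorem enorm_multKernel_le {s : ℝ} (hs : -1 < s) (hs0 : s < 0) {a : E2 → ℂ} {D : ℝ}
    (ha : ∀ ξ, ‖a ξ‖ ≤ D * jap (-12) ξ) (ζ ζ' : E2) :
    ‖multKernel s a ζ ζ'‖ₑ ≤ ENNReal.ofReal (‖ζ‖ ^ s * jap (-s) ζ) *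
      ENNReal.ofReal (2 * D * jap (-11) (ζ - ζ')) := by
  have hj := jap_nonneg (-s) ζ
  have hj' := jap_nonneg (-s) ζ'
  have hj11 := jap_nonneg (-11) (ζ - ζ')
  have hj12 := jap_nonneg (-12) (ζ - ζ')
  rw [← ENNReal.ofReal_mul (by positivity), ← ofReal_norm]
  refine ENNReal.ofReal_le_ofReal ?_
  unfold multKernel
  rw [norm_mul, Complex.norm_real, Real.norm_of_nonneg (by positivity)]
  have h1 : jap (-s) ζ' ≤ 2 * (jap (-s) ζ * jap 1 (ζ - ζ')) := by
    refine (jap_peetre (-s) ζ' ζ).trans ?_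
    rw [abs_neg, abs_of_neg hs0, jap_sub_comm]
    have h2 : (2 : ℝ) ^ (-s / 2) ≤ 2 := by
      calc (2 : ℝ) ^ (-s / 2) ≤ 2 ^ (1 : ℝ) :=
            Real.rpow_le_rpow_of_exponent_le (by norm_num) (by linarith)
        _ = 2 := Real.rpow_one 2
    have h3 : jap (-s) (ζ - ζ') ≤ jap 1 (ζ - ζ') := jap_mono (by linarith) _
    have := jap_nonneg (-s) (ζ - ζ')
    gcongr
  have h4 : jap 1 (ζ - ζ') * jap (-12) (ζ - ζ') = jap (-11) (ζ - ζ') := by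
    rw [jap_mul]; norm_num
  calc ‖ζ‖ ^ s * jap (-s) ζ' * ‖a (ζ - ζ')‖
      ≤ ‖ζ‖ ^ s * (2 * (jap (-s) ζ * jap 1 (ζ - ζ'))) * (D * jap (-12) (ζ - ζ')) := by
        have := ha (ζ - ζ')
        have := jap_nonneg 1 (ζ - ζ')
        gcongr
    _ = ‖ζ‖ ^ s * jap (-s) ζ * (2 * D * (jap 1 (ζ - ζ') * jap (-12) (ζ - ζ'))) := by ring
    _ = _ := by rw [h4]

/-- The quotient of the homogeneous weight by the bracket is bounded away from the origin; near it
the square is of size |ζ|^{2s}, integrable on the plane exactly because s > -1. -/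
theorem sq_weight_le {s : ℝ} (hs : -1 < s) (hs0 : s < 0) (ζ : E2) :
    ENNReal.ofReal (‖ζ‖ ^ s * jap (-s) ζ) ^ 2 ≤
      2 + (Metric.ball (0 : E2) 1).indicator (fun ζ => 2 * ENNReal.ofReal (‖ζ‖ ^ (2 * s))) ζ := by
  have hj := jap_nonneg (-s) ζ
  have h22 : (2 : ℝ) ^ (-s) ≤ 2 := by
    calc (2 : ℝ) ^ (-s) ≤ 2 ^ (1 : ℝ) :=
          Real.rpow_le_rpow_of_exponent_le (by norm_num) (by linarith)
      _ = 2 := Real.rpow_one 2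
  have hjp : jap (-s) ζ ^ 2 = (1 + ‖ζ‖ ^ 2) ^ (-s) := by
    rw [jap_sq]; unfold jap; congr 1; ring
  have hn : (‖ζ‖ ^ s) ^ 2 = ‖ζ‖ ^ (2 * s) := by
    rw [← Real.rpow_natCast, ← Real.rpow_mul (norm_nonneg _)]; congr 1; push_cast; ring
  rw [← ENNReal.ofReal_pow (by positivity), mul_pow, hjp, hn]
  by_cases hζ : ζ ∈ Metric.ball (0 : E2) 1
  · rw [Set.indicator_of_mem hζ]
    refine le_trans ?_ le_add_self
    have h1 : ‖ζ‖ < 1 := by simpa using hζ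
    have h3 : (1 + ‖ζ‖ ^ 2) ^ (-s) ≤ 2 := by
      refine le_trans (Real.rpow_le_rpow (by positivity) ?_ (by linarith)) h22
      nlinarith [norm_nonneg ζ]
    calc ENNReal.ofReal (‖ζ‖ ^ (2 * s) * (1 + ‖ζ‖ ^ 2) ^ (-s))
        ≤ ENNReal.ofReal (2 * ‖ζ‖ ^ (2 * s)) := by
          refine ENNReal.ofReal_le_ofReal ?_
          rw [mul_comm]; gcongr
      _ = _ := by rw [ENNReal.ofReal_mul (by norm_num)]; simp
  · rw [Set.indicator_of_notMem hζ, add_zero]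
    refine (ENNReal.ofReal_le_ofReal ?_).trans (ENNReal.ofReal_ofNat 2).le
    have h1 : 1 ≤ ‖ζ‖ := by simpa using hζ
    have h0 : 0 < ‖ζ‖ := by linarith
    have e : ‖ζ‖ ^ (2 * s) = ((‖ζ‖ ^ 2)⁻¹) ^ (-s) := by
      rw [Real.inv_rpow (by positivity), Real.rpow_neg (by positivity), inv_inv,
        ← Real.rpow_natCast, ← Real.rpow_mul h0.le]; norm_num
    rw [e, ← Real.mul_rpow (by positivity) (by positivity)]
    refine le_trans (Real.rpow_le_rpow (by positivity) ?_ (by linarith)) h22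
    rw [inv_mul_le_iff₀ (by positivity)]; nlinarith

theorem lintegral_ball_weight_lt_top {s : ℝ} (hs : -1 < s) :
    ∫⁻ ζ : E2, (Metric.ball (0 : E2) 1).indicator
      (fun ζ => 2 * ENNReal.ofReal (‖ζ‖ ^ (2 * s))) ζ < ⊤ := by
  rw [lintegral_indicator Metric.isOpen_ball.measurableSet, lintegral_const_mul _ (by fun_prop)]
  exact ENNReal.mul_lt_top (by simp)
    (setLIntegral_ball_norm_rpow_lt_top (by simp; linarith))

theorem lintegral_jap_lt_top {s : ℝ} (hs : s < -2) (c : ℝ) :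
    ∫⁻ ζ : E2, ENNReal.ofReal (c * jap s ζ) < ⊤ :=
  ((integrable_jap volume (by simp; linarith)).const_mul c).lintegral_lt_top

theorem measurable_weight (s : ℝ) :
    Measurable fun ζ : E2 => ENNReal.ofReal (‖ζ‖ ^ s * jap (-s) ζ) := by fun_prop

/-- Schur's conditions for the multiplication kernel. -/
theorem multKernel_schur {s : ℝ} (hs : -1 < s) (hs0 : s < 0) {a : E2 → ℂ} {D : ℝ} (hD : 0 ≤ D)
    (ha : ∀ ξ, ‖a ξ‖ ≤ D * jap (-12) ξ) : ∃ A B : ℝ≥0∞, A ≠ ⊤ ∧ B ≠ ⊤ ∧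
      (∀ ζ, ∫⁻ ζ', ‖multKernel s a ζ ζ'‖ₑ ≤ A * ENNReal.ofReal (‖ζ‖ ^ s * jap (-s) ζ)) ∧
      ∀ ζ', ∫⁻ ζ, ‖multKernel s a ζ ζ'‖ₑ * ENNReal.ofReal (‖ζ‖ ^ s * jap (-s) ζ) ≤ B := by
  set J := ∫⁻ ζ : E2, ENNReal.ofReal (2 * D * jap (-11) ζ)
  have hJ : J < ⊤ := lintegral_jap_lt_top (by norm_num) _
  have hW := lintegral_ball_weight_lt_top hs
  set W := ∫⁻ ζ : E2, (Metric.ball (0 : E2) 1).indicator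
      (fun ζ => 2 * ENNReal.ofReal (‖ζ‖ ^ (2 * s))) ζ
  refine ⟨J, 2 * J + W * ENNReal.ofReal (2 * D), hJ.ne, ?_, fun ζ => ?_, fun ζ' => ?_⟩
  · exact ENNReal.add_ne_top.mpr ⟨ENNReal.mul_ne_top (by simp) hJ.ne,
      ENNReal.mul_ne_top hW.ne ENNReal.ofReal_ne_top⟩
  · calc ∫⁻ ζ', ‖multKernel s a ζ ζ'‖ₑ
        ≤ ∫⁻ ζ', ENNReal.ofReal (‖ζ‖ ^ s * jap (-s) ζ) *
            ENNReal.ofReal (2 * D * jap (-11) (ζ - ζ')) :=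
          lintegral_mono fun ζ' => enorm_multKernel_le hs hs0 ha ζ ζ'
      _ = _ := by
          rw [lintegral_const_mul _ (by fun_prop), mul_comm]
          congr 1
          exact lintegral_sub_left_eq_self (fun x => ENNReal.ofReal (2 * D * jap (-11) x)) ζ
  · have hm : Measurable ((Metric.ball (0 : E2) 1).indicator
      (fun ζ => 2 * ENNReal.ofReal (‖ζ‖ ^ (2 * s)))) :=
      Measurable.indicator (by fun_prop) Metric.isOpen_ball.measurableSet
    calc ∫⁻ ζ, ‖multKernel s a ζ ζ'‖ₑ * ENNReal.ofReal (‖ζ‖ ^ s * jap (-s) ζ)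
        ≤ ∫⁻ ζ, (2 * ENNReal.ofReal (2 * D * jap (-11) (ζ - ζ')) +
          (Metric.ball (0 : E2) 1).indicator (fun ζ => 2 * ENNReal.ofReal (‖ζ‖ ^ (2 * s))) ζ *
            ENNReal.ofReal (2 * D)) := by
          refine lintegral_mono fun ζ => ?_
          calc _ ≤ (ENNReal.ofReal (‖ζ‖ ^ s * jap (-s) ζ) *
                ENNReal.ofReal (2 * D * jap (-11) (ζ - ζ'))) *
                ENNReal.ofReal (‖ζ‖ ^ s * jap (-s) ζ) := by
                gcongr; exact enorm_multKernel_le hs hs0 ha ζ ζ'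
            _ = ENNReal.ofReal (‖ζ‖ ^ s * jap (-s) ζ) ^ 2 *
                ENNReal.ofReal (2 * D * jap (-11) (ζ - ζ')) := by ring
            _ ≤ (2 + (Metric.ball (0 : E2) 1).indicator
                (fun ζ => 2 * ENNReal.ofReal (‖ζ‖ ^ (2 * s))) ζ) *
                ENNReal.ofReal (2 * D * jap (-11) (ζ - ζ')) := by
                gcongr; exact sq_weight_le hs hs0 ζ
            _ ≤ _ := by
                have h1 : jap (-11) (ζ - ζ') ≤ 1 := by
                  simpa using jap_mono (by norm_num : (-11 : ℝ) ≤ 0) (ζ - ζ')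
                have h2 : 2 * D * jap (-11) (ζ - ζ') ≤ 2 * D :=
                  mul_le_of_le_one_right (by linarith) h1
                rw [add_mul]
                gcongr
      _ = _ := by
          rw [lintegral_add_left (by fun_prop), lintegral_const_mul _ (by fun_prop),
            lintegral_mul_const _ hm]
          congr 2
          exact lintegral_sub_right_eq_self (fun x => ENNReal.ofReal (2 * D * jap (-11) x)) ζ'

theorem ae_weight_ne (s : ℝ) :
    (∀ᵐ ζ : E2, ENNReal.ofReal (‖ζ‖ ^ s * jap (-s) ζ) ≠ 0) := by
  have hne : ∀ᵐ η : E2, η ≠ 0 := by simp [ae_iff]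
  filter_upwards [hne] with ζ hζ
  have h1 := jap_pos (-s) ζ
  have h2 : 0 < ‖ζ‖ := norm_pos_iff.mpr hζ
  have : 0 < ‖ζ‖ ^ s * jap (-s) ζ := by positivity
  simpa using this

theorem kerBound_multKernel {s : ℝ} (hs : -1 < s) (hs0 : s < 0) {a : E2 → ℂ} (ham : Measurable a)
    {D : ℝ} (hD : 0 ≤ D) (ha : ∀ ξ, ‖a ξ‖ ≤ D * jap (-12) ξ) :
    ∃ C : ℝ≥0∞, C ≠ ⊤ ∧ KerBound volume (multKernel s a) C := by
  obtain ⟨A, B, hA, hB, h1, h2⟩ := multKernel_schur hs hs0 hD ha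
  refine ⟨A * B, ENNReal.mul_ne_top hA hB, KerBound.of_schur (measurable_multKernel s ham)
    (measurable_weight s) measurable_one (by simp) (by simp)
    (Filter.Eventually.of_forall fun ζ => ?_) (Filter.Eventually.of_forall fun ζ' => ?_)⟩
  · simpa using h1 ζ
  · simpa using h2 ζ'

/-- The kernel of multiplication by a function with the Fourier transform `b`, with the weights
`⟨η⟩^r` and `‖η'‖^{-r}`. -/
def multKernelOut (r : ℝ) (b : E2 → ℂ) (η η' : E2) : ℂ :=
  ((jap r η * ‖η'‖ ^ (-r) : ℝ) : ℂ) * b (η - η')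

/-- This kernel is the transpose of `multKernel` with the exponent -r and b reflected, so the two
conditions of Schur's test exchange their roles. -/
theorem kerBound_multKernelOut {r : ℝ} (hr0 : 0 < r) (hr : r < 1) {b : E2 → ℂ}
    (hbm : Measurable b) {D : ℝ} (hD : 0 ≤ D) (hb : ∀ ξ, ‖b ξ‖ ≤ D * jap (-12) ξ) :
    ∃ C : ℝ≥0∞, C ≠ ⊤ ∧ KerBound volume (multKernelOut r b) C := by
  have e : ∀ η η', multKernelOut r b η η' = multKernel (-r) (fun ξ => b (-ξ)) η' η := by
    intro η η'
    simp only [multKernelOut, multKernel, neg_neg, neg_sub]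
    rw [mul_comm (jap r η)]
  obtain ⟨A, B, hA, hB, h1, h2⟩ := multKernel_schur (s := -r) (a := fun ξ => b (-ξ))
    (by linarith) (by linarith) hD
    (fun ξ => by
      have := hb (-ξ)
      simpa [jap] using this)
  have hm : Measurable (Function.uncurry (multKernelOut r b)) := by
    unfold multKernelOut Function.uncurry
    fun_prop
  refine ⟨B * A, ENNReal.mul_ne_top hB hA, KerBound.of_schur hm
    measurable_one (measurable_weight (-r)) (ae_weight_ne (-r)) (by simp)
    (Filter.Eventually.of_forall fun η => ?_) (Filter.Eventually.of_forall fun η' => ?_)⟩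
  · simp only [e]
    simpa using h2 η
  · simp only [e]
    simpa using h1 η'

/-- Disposes of the region |ζ| < 1, where k_ε need not be close to k relative to the homogeneous
majorant. There the squared weight is integrable in ζ and the decay of a gives integrability in ζ'.
-/
theorem hilbertSchmidt_indicator_multKernel {s : ℝ} (hs : -1 < s) (hs0 : s < 0) {a : E2 → ℂ}
    {D : ℝ} (hD : 0 ≤ D) (ha : ∀ ξ, ‖a ξ‖ ≤ D * jap (-12) ξ) :
    ∫⁻ ζ, ∫⁻ ζ', ‖(Metric.ball (0 : E2) 1).indicator (fun ζ => multKernel s a ζ ζ') ζ‖ₑ ^ 2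
      ≠ ⊤ := by
  set J := ∫⁻ ζ : E2, ENNReal.ofReal ((2 * D) ^ 2 * jap (-22) ζ)
  have hJ : J < ⊤ := lintegral_jap_lt_top (by norm_num) _
  have hW := lintegral_ball_weight_lt_top hs
  have hm : Measurable ((Metric.ball (0 : E2) 1).indicator
      (fun ζ => 2 * ENNReal.ofReal (‖ζ‖ ^ (2 * s)))) :=
      Measurable.indicator (by fun_prop) Metric.isOpen_ball.measurableSet
  have hb : ∀ ζ ζ', ‖(Metric.ball (0 : E2) 1).indicator (fun ζ => multKernel s a ζ ζ') ζ‖ₑ ^ 2 ≤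
      ((Metric.ball (0 : E2) 1).indicator (fun _ => 2) ζ +
        (Metric.ball (0 : E2) 1).indicator (fun ζ => 2 * ENNReal.ofReal (‖ζ‖ ^ (2 * s))) ζ) *
        ENNReal.ofReal ((2 * D) ^ 2 * jap (-22) (ζ - ζ')) := by
    intro ζ ζ'
    by_cases hζ : ζ ∈ Metric.ball (0 : E2) 1
    · have h1 := sq_weight_le hs hs0 ζ
      have h2 := enorm_multKernel_le hs hs0 ha ζ ζ'
      rw [Set.indicator_of_mem hζ] at h1 ⊢
      rw [Set.indicator_of_mem hζ, Set.indicator_of_mem hζ]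
      calc _ ≤ (ENNReal.ofReal (‖ζ‖ ^ s * jap (-s) ζ) *
            ENNReal.ofReal (2 * D * jap (-11) (ζ - ζ'))) ^ 2 := by gcongr
        _ = ENNReal.ofReal (‖ζ‖ ^ s * jap (-s) ζ) ^ 2 *
            ENNReal.ofReal ((2 * D) ^ 2 * jap (-22) (ζ - ζ')) := by
            have := jap_nonneg (-11) (ζ - ζ')
            rw [mul_pow, ← ENNReal.ofReal_pow (n := 2) (p := 2 * D * jap (-11) (ζ - ζ'))
              (by positivity), mul_pow, jap_sq]
            norm_num
        _ ≤ _ := by gcongr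
    · simp [Set.indicator_of_notMem hζ]
  refine ne_of_lt (lt_of_le_of_lt (lintegral_mono fun ζ => lintegral_mono fun ζ' => hb ζ ζ') ?_)
  have e : ∀ ζ : E2, ∫⁻ ζ', ((Metric.ball (0 : E2) 1).indicator (fun _ => 2) ζ +
        (Metric.ball (0 : E2) 1).indicator (fun ζ => 2 * ENNReal.ofReal (‖ζ‖ ^ (2 * s))) ζ) *
        ENNReal.ofReal ((2 * D) ^ 2 * jap (-22) (ζ - ζ')) =
      ((Metric.ball (0 : E2) 1).indicator (fun _ => 2) ζ +
        (Metric.ball (0 : E2) 1).indicator (fun ζ => 2 * ENNReal.ofReal (‖ζ‖ ^ (2 * s))) ζ) * J := by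
    intro ζ
    rw [lintegral_const_mul _ (by fun_prop)]
    congr 1
    exact lintegral_sub_left_eq_self (fun x => ENNReal.ofReal ((2 * D) ^ 2 * jap (-22) x)) ζ
  simp only [e]
  rw [lintegral_mul_const' _ _ hJ.ne, lintegral_add_right _ hm]
  refine ENNReal.mul_lt_top (ENNReal.add_lt_top.mpr ⟨?_, hW⟩) hJ
  rw [lintegral_indicator Metric.isOpen_ball.measurableSet]
  rw [setLIntegral_const]
  exact ENNReal.mul_lt_top ENNReal.ofNat_lt_top measure_ball_lt_top

end MultKernel

/-! ### The regularised composition is Hilbert–Schmidt. -/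

section Compact

open scoped ENNReal

theorem regKernel_le_const (α : ℝ) {ε : ℝ} (hε : 0 < ε) (η ζ : E2) :
    regKernel α ε η ζ ≤ 2 / (|Real.sin α| * ε) := by
  have hq := qForm_nonneg α η ζ
  have hd := diff_sq_le η ζ
  rcases (abs_nonneg (Real.sin α)).eq_or_lt with hs | hs
  · unfold regKernel; rw [← hs]; simp
  set L := 1 + ‖η‖ ^ 2 + ‖ζ‖ ^ 2
  have hL : 1 ≤ L := by
    have := sq_nonneg ‖η‖; have := sq_nonneg ‖ζ‖; simp only [L]; linarith
  have h1 : |η 0 - ζ 0| ≤ 2 * L ^ 2 := by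
    refine abs_le_of_sq_le_sq ?_ (by positivity)
    have h2 : 2 * (‖η‖ ^ 2 + ‖ζ‖ ^ 2) ≤ 2 * L := by simp only [L]; linarith
    have h3 : L ≤ L ^ 4 := le_self_pow₀ hL (by norm_num)
    nlinarith
  unfold regKernel
  calc |η 0 - ζ 0| / (|Real.sin α| * (qForm α η ζ + ε * L ^ 2))
      ≤ 2 * L ^ 2 / (|Real.sin α| * (ε * L ^ 2)) := by
        gcongr; linarith
    _ = _ := by field_simp

/-- The composition of the regularised kernel with the multiplication kernel. -/
def compKernel (α ε s : ℝ) (a : E2 → ℂ) (η ζ : E2) : ℂ :=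
  ∫ ζ', weightedKernel (s + 1) (regKernel α ε) η ζ' * multKernel s a ζ' ζ

theorem measurable_compKernel (α ε s : ℝ) {a : E2 → ℂ} (ha : Measurable a) :
    Measurable (Function.uncurry (compKernel α ε s a)) := by
  have h1 := measurable_weightedKernel (s + 1) (measurable_regKernel α ε)
  have h2 := measurable_multKernel s ha
  have h3 : Measurable fun q : (E2 × E2) × E2 =>
      weightedKernel (s + 1) (regKernel α ε) q.1.1 q.2 * multKernel s a q.2 q.1.2 :=
    (h1.comp (g := Function.uncurry (weightedKernel (s + 1) (regKernel α ε)))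
      (f := fun q : (E2 × E2) × E2 => (q.1.1, q.2)) (by fun_prop)).mul
    (h2.comp (g := Function.uncurry (multKernel s a))
      (f := fun q : (E2 × E2) × E2 => (q.2, q.1.2)) (by fun_prop))
  exact (h3.stronglyMeasurable.integral_prod_right').measurable

/-- The cancellation ∫ a = 0 is decisive. With L = 1 + |η|² + |ζ|², the differences of k_ε
contribute L^{-2} and the weights L^{1/2}, so the kernel is O(L^{-3/2}), square integrable on ℝ⁴;
without the cancellation the same estimates give only L^{-1}, which is not. -/
theorem norm_compKernel_le {α : ℝ} (hsin : Real.sin α ≠ 0) {ε s : ℝ} (hε : 0 < ε) (hs : -1 < s)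
    (hs0 : s < 0) {a : E2 → ℂ} (ham : Measurable a) {D : ℝ} (hD : 0 ≤ D)
    (ha : ∀ ξ, ‖a ξ‖ ≤ D * jap (-12) ξ) (hint : ∫ ξ, a ξ = 0) :
    ∃ C : ℝ, 0 ≤ C ∧ ∀ η ζ, ‖compKernel α ε s a η ζ‖ ≤ C * (jap (-(3 / 2)) η * jap (-(3 / 2)) ζ) := by
  obtain ⟨C, hC, hreg⟩ := regKernel_sub_le hsin hε
  have hj3 : Integrable (fun ξ : E2 => jap (-3) ξ) := integrable_jap volume (by simp; norm_num)
  have hj12 : Integrable (fun ξ : E2 => jap (-12) ξ) := integrable_jap volume (by simp; norm_num)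
  have haI : Integrable a :=
    (hj12.const_mul D).mono' ham.aestronglyMeasurable (Filter.Eventually.of_forall ha)
  set J := ∫ ξ : E2, C * D * jap (-3) ξ
  have hJ : 0 ≤ J := integral_nonneg fun ξ => by
    have := jap_nonneg (-3) ξ; simp only [Pi.zero_apply]; positivity
  refine ⟨J, hJ, fun η ζ => ?_⟩
  have haζ : Integrable fun ζ' => a (ζ' - ζ) := haI.comp_sub_right ζ
  have hmreg : Measurable fun ζ' => regKernel α ε η ζ' :=
    (measurable_regKernel α ε).comp (measurable_prodMk_left (x := η))
  have hI1 : Integrable fun ζ' => ((regKernel α ε η ζ' : ℝ) : ℂ) * a (ζ' - ζ) := by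
    refine haζ.bdd_mul (c := 2 / (|Real.sin α| * ε)) (by fun_prop)
      (Filter.Eventually.of_forall fun ζ' => ?_)
    rw [Complex.norm_real, Real.norm_of_nonneg (regKernel_nonneg α hε.le _ _)]
    exact regKernel_le_const α hε η ζ'
  have hI2 : Integrable fun ζ' => ((regKernel α ε η ζ : ℝ) : ℂ) * a (ζ' - ζ) := haζ.const_mul _
  -- The inner weights |ζ'|^{-s} and |ζ'|^s cancel, and ∫ a = 0 allows k_ε(η, ζ) to be subtracted.
  have e1 : compKernel α ε s a η ζ = ((‖η‖ ^ (s + 1) * jap (-s) ζ : ℝ) : ℂ) *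
      ∫ ζ', ((regKernel α ε η ζ' - regKernel α ε η ζ : ℝ) : ℂ) * a (ζ' - ζ) := by
    have e2 : ∫ ζ', ((regKernel α ε η ζ' - regKernel α ε η ζ : ℝ) : ℂ) * a (ζ' - ζ)
        = ∫ ζ', ((regKernel α ε η ζ' : ℝ) : ℂ) * a (ζ' - ζ) := by
      push_cast
      simp only [sub_mul]
      rw [integral_sub hI1 hI2, integral_const_mul, integral_sub_right_eq_self, hint]
      simp
    rw [e2, ← integral_const_mul]
    unfold compKernel
    refine integral_congr_ae ?_
    have hne : ∀ᵐ η : E2, η ≠ 0 := by simp [ae_iff]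
    filter_upwards [hne] with ζ' hζ'
    have hp : 0 < ‖ζ'‖ := norm_pos_iff.mpr hζ'
    have e3 : ‖ζ'‖ ^ (1 - (s + 1)) * ‖ζ'‖ ^ s = 1 := by
      rw [← Real.rpow_add hp]; simp
    unfold weightedKernel multKernel
    rw [← mul_assoc, ← mul_assoc, ← Complex.ofReal_mul, ← Complex.ofReal_mul]
    congr 2
    linear_combination (‖η‖ ^ (s + 1) * jap (-s) ζ * regKernel α ε η ζ') * e3
  set L := 1 + ‖η‖ ^ 2 + ‖ζ‖ ^ 2 with hL
  have hL0 : 0 < L := by positivity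
  have e4 : ‖∫ ζ', ((regKernel α ε η ζ' - regKernel α ε η ζ : ℝ) : ℂ) * a (ζ' - ζ)‖
      ≤ J * (L ^ 2)⁻¹ := by
    have h1 : Integrable (fun ζ' : E2 => C * D * jap (-3) (ζ' - ζ) * (L ^ 2)⁻¹) :=
      ((hj3.comp_sub_right ζ).const_mul (C * D)).mul_const _
    refine (norm_integral_le_of_norm_le h1 (Filter.Eventually.of_forall fun ζ' => ?_)).trans
      (le_of_eq ?_)
    · rw [norm_mul, Complex.norm_real, Real.norm_eq_abs]
      have e5 : jap 9 (ζ' - ζ) * jap (-12) (ζ' - ζ) = jap (-3) (ζ' - ζ) := by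
        rw [jap_mul]; norm_num
      have j1 := jap_nonneg 9 (ζ' - ζ)
      calc _ ≤ (C * jap 9 (ζ' - ζ) * (L ^ 2)⁻¹) * (D * jap (-12) (ζ' - ζ)) :=
            mul_le_mul (hreg η ζ ζ') (ha _) (norm_nonneg _) (by positivity)
        _ = C * D * (jap 9 (ζ' - ζ) * jap (-12) (ζ' - ζ)) * (L ^ 2)⁻¹ := by ring
        _ = _ := by rw [e5]
    · rw [integral_mul_const, integral_sub_right_eq_self (fun x : E2 => C * D * jap (-3) x)]
  have jη : jap 2 η ≤ L := by rw [jap_two, hL]; nlinarith [sq_nonneg ‖ζ‖]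
  have jζ : jap 2 ζ ≤ L := by rw [jap_two, hL]; nlinarith [sq_nonneg ‖η‖]
  have p1 : ‖η‖ ^ (s + 1) * jap (-s) ζ ≤ L ^ (1 / 2 : ℝ) := by
    have q1 : ‖η‖ ^ (s + 1) ≤ L ^ ((s + 1) / 2) := by
      calc ‖η‖ ^ (s + 1) ≤ (jap 1 η) ^ (s + 1) :=
            Real.rpow_le_rpow (norm_nonneg _) (norm_le_jap η) (by linarith)
        _ = (jap 2 η) ^ ((s + 1) / 2) := by rw [jap_rpow, jap_rpow]; congr 1; ring
        _ ≤ _ := Real.rpow_le_rpow (jap_nonneg _ _) jη (by linarith)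
    have q2 : jap (-s) ζ ≤ L ^ (-s / 2) := by
      calc jap (-s) ζ = (jap 2 ζ) ^ (-s / 2) := by rw [jap_rpow]; congr 1; ring
        _ ≤ _ := Real.rpow_le_rpow (jap_nonneg _ _) jζ (by linarith)
    calc _ ≤ L ^ ((s + 1) / 2) * L ^ (-s / 2) :=
          mul_le_mul q1 q2 (jap_nonneg _ _) (by positivity)
      _ = _ := by rw [← Real.rpow_add hL0]; congr 1; ring
  have p2 : L ^ (1 / 2 : ℝ) * (L ^ 2)⁻¹ ≤ jap (-(3 / 2)) η * jap (-(3 / 2)) ζ := by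
    have r1 : L ^ (-(3 / 4) : ℝ) ≤ jap (-(3 / 2)) η := by
      calc L ^ (-(3 / 4) : ℝ) ≤ (jap 2 η) ^ (-(3 / 4) : ℝ) :=
            Real.rpow_le_rpow_of_nonpos (jap_pos _ _) jη (by norm_num)
        _ = _ := by rw [jap_rpow]; congr 1; norm_num
    have r2 : L ^ (-(3 / 4) : ℝ) ≤ jap (-(3 / 2)) ζ := by
      calc L ^ (-(3 / 4) : ℝ) ≤ (jap 2 ζ) ^ (-(3 / 4) : ℝ) :=
            Real.rpow_le_rpow_of_nonpos (jap_pos _ _) jζ (by norm_num)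
        _ = _ := by rw [jap_rpow]; congr 1; norm_num
    calc L ^ (1 / 2 : ℝ) * (L ^ 2)⁻¹ = L ^ (-(3 / 4) : ℝ) * L ^ (-(3 / 4) : ℝ) := by
          rw [← Real.rpow_natCast L 2, ← Real.rpow_neg hL0.le, ← Real.rpow_add hL0,
            ← Real.rpow_add hL0]
          norm_num
      _ ≤ _ := mul_le_mul r1 r2 (by positivity) (jap_nonneg _ _)
  rw [e1, norm_mul, Complex.norm_real,
    Real.norm_of_nonneg (mul_nonneg (by positivity) (jap_nonneg _ _))]
  calc _ ≤ L ^ (1 / 2 : ℝ) * (J * (L ^ 2)⁻¹) :=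
        mul_le_mul p1 e4 (norm_nonneg _) (by positivity)
    _ = J * (L ^ (1 / 2 : ℝ) * (L ^ 2)⁻¹) := by ring
    _ ≤ _ := by gcongr

theorem hilbertSchmidt_compKernel {α : ℝ} (hsin : Real.sin α ≠ 0) {ε s : ℝ} (hε : 0 < ε)
    (hs : -1 < s) (hs0 : s < 0) {a : E2 → ℂ} (ham : Measurable a) {D : ℝ} (hD : 0 ≤ D)
    (ha : ∀ ξ, ‖a ξ‖ ≤ D * jap (-12) ξ) (hint : ∫ ξ, a ξ = 0) :
    ∫⁻ η, ∫⁻ ζ, ‖compKernel α ε s a η ζ‖ₑ ^ 2 ≠ ⊤ := by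
  obtain ⟨C, hC, h⟩ := norm_compKernel_le hsin hε hs hs0 ham hD ha hint
  set J := ∫⁻ ζ : E2, ENNReal.ofReal (C * jap (-3) ζ)
  have hJ : J < ⊤ := lintegral_jap_lt_top (by norm_num) _
  have hb : ∀ η ζ, ‖compKernel α ε s a η ζ‖ₑ ^ 2 ≤
      ENNReal.ofReal (C * jap (-3) η) * ENNReal.ofReal (C * jap (-3) ζ) := by
    intro η ζ
    have j1 := jap_nonneg (-3) η
    have j2 := jap_nonneg (-3) ζ
    rw [← ofReal_norm, ← ENNReal.ofReal_pow (norm_nonneg _), ← ENNReal.ofReal_mul (by positivity)]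
    refine ENNReal.ofReal_le_ofReal ((pow_le_pow_left₀ (norm_nonneg _) (h η ζ) 2).trans
      (le_of_eq ?_))
    rw [mul_pow, mul_pow, jap_sq, jap_sq]
    norm_num
    ring
  refine ne_of_lt (lt_of_le_of_lt (lintegral_mono fun η => lintegral_mono fun ζ => hb η ζ) ?_)
  have e : ∀ η : E2, ∫⁻ ζ, ENNReal.ofReal (C * jap (-3) η) * ENNReal.ofReal (C * jap (-3) ζ)
      = ENNReal.ofReal (C * jap (-3) η) * J := fun η => lintegral_const_mul _ (by fun_prop)
  simp only [e]
  rw [lintegral_mul_const _ (by fun_prop)]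
  exact ENNReal.mul_lt_top hJ hJ

end Compact

/-! ### Compactness of the trace operator after a cut-off vanishing at the origin. -/

section Compact

open scoped ENNReal

local notation "L2" => Lp ℂ 2 (volume : Measure E2)

-- The approximant is assembled from the low-frequency part of the multiplication operator, compact
-- whatever acts after it, and from the regularised composition. What remains is k - k_ε on |ζ| ≥ 1,
-- whose norm is O(ε^{1/8}).
set_option maxHeartbeats 1000000 in
theorem exists_regularisation {α : ℝ} (hsin : Real.sin α ≠ 0) (hcos : Real.cos α ≠ 0) {s : ℝ}
    (hs : -1 < s) (hs0 : s < 0) {a : E2 → ℂ} (ham : Measurable a) {D : ℝ} (hD : 0 ≤ D)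
    (ha : ∀ ξ, ‖a ξ‖ ≤ D * jap (-12) ξ) (hint : ∫ ξ, a ξ = 0) (TK TM : L2 →L[ℂ] L2)
    (hTK : ∀ f : L2, TK f =ᵐ[volume] fun η =>
      ∫ ζ, weightedKernel (s + 1) (traceKernel α) η ζ * f ζ)
    (hTM : ∀ f : L2, TM f =ᵐ[volume] fun η => ∫ ζ, multKernel s a η ζ * f ζ) :
    ∃ C : ℝ, ∀ ε : ℝ, 0 < ε → ∃ S : L2 →L[ℂ] L2, IsCompactOperator S ∧
      ‖TK ∘L TM - S‖ ≤ C * (8 * ε) ^ (1 / 8 : ℝ) := by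
  obtain ⟨C, hC, hK⟩ := kerBound_weightedKernel hsin hcos (a := s + 1) (by linarith) (by linarith)
  have hsp : 0 < |Real.sin α| := abs_pos.mpr hsin
  refine ⟨(|Real.sin α|)⁻¹ * √C.toReal * ‖TM‖, fun ε hε => ?_⟩
  have hMm := measurable_multKernel s ham
  obtain ⟨CM, hCM, hM⟩ := kerBound_multKernel hs hs0 ham hD ha
  let mB : E2 → E2 → ℂ := fun ζ ζ' =>
    (Metric.ball (0 : E2) 1).indicator (fun ζ => multKernel s a ζ ζ') ζ
  have hmBm : Measurable (Function.uncurry mB) := by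
    have : Function.uncurry mB = (Prod.fst ⁻¹' Metric.ball (0 : E2) 1).indicator
        (Function.uncurry (multKernel s a)) := by
      ext ⟨x, y⟩
      rfl
    rw [this]
    exact hMm.indicator (measurable_fst Metric.isOpen_ball.measurableSet)
  have hHS := hilbertSchmidt_indicator_multKernel hs hs0 hD ha
  obtain ⟨TB, -, hTB⟩ := (KerBound.of_hilbertSchmidt (μ := volume) hmBm).exists_clm hHS
  have hTBc : IsCompactOperator TB := isCompactOperator_of_kernel hmBm TB hTB hHS
  have hTB' : ∀ f : L2, TB f =ᵐ[volume] (Metric.ball (0 : E2) 1).indicator (TM f) := by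
    intro f
    filter_upwards [hTB f, hTM f] with x h1 h2
    rw [h1]
    by_cases hx : x ∈ Metric.ball (0 : E2) 1
    · simp only [mB, Set.indicator_of_mem hx, h2]
    · simp [mB, Set.indicator_of_notMem hx]
  have hreg : KerBound volume (weightedKernel (s + 1) (regKernel α ε))
      (ENNReal.ofReal ((2 / |Real.sin α|) ^ 2) * C) :=
    hK _ _ (by positivity) (measurable_regKernel α ε) fun η ζ => by
      rw [abs_of_nonneg (regKernel_nonneg α hε.le _ _)]
      exact (regKernel_le_traceKernel hsin hε.le η ζ).trans (traceKernel_le hsin η ζ)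
  have htr : KerBound volume (weightedKernel (s + 1) (traceKernel α))
      (ENNReal.ofReal ((2 / |Real.sin α|) ^ 2) * C) :=
    hK _ _ (by positivity) (measurable_traceKernel α) fun η ζ => by
      rw [abs_of_nonneg (traceKernel_nonneg α _ _)]
      exact traceKernel_le hsin η ζ
  have hCr : ENNReal.ofReal ((2 / |Real.sin α|) ^ 2) * C ≠ ⊤ :=
    ENNReal.mul_ne_top ENNReal.ofReal_ne_top hC
  obtain ⟨Te, -, hTe⟩ := hreg.exists_clm hCr
  let kd : E2 → E2 → ℝ := fun η ζ =>
    if ‖ζ‖ < 1 then 0 else traceKernel α η ζ - regKernel α ε η ζ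
  have hkdm : Measurable fun p : E2 × E2 => kd p.1 p.2 := by
    refine Measurable.ite (measurableSet_lt (by fun_prop) (by fun_prop)) (by fun_prop) ?_
    fun_prop
  set M := (8 * ε) ^ (1 / 8 : ℝ) / |Real.sin α|
  have hM0 : 0 ≤ M := by positivity
  have hkd : KerBound volume (weightedKernel (s + 1) kd) (ENNReal.ofReal (M ^ 2) * C) := by
    refine hK _ _ hM0 hkdm fun η ζ => ?_
    have hmaj := majKernel_nonneg α η ζ
    by_cases hζ : ‖ζ‖ < 1
    · simp only [kd, hζ, if_true, abs_zero]; positivity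
    · simp only [kd, hζ, if_false]
      rw [abs_of_nonneg (sub_nonneg.mpr (regKernel_le_traceKernel hsin hε.le η ζ))]
      exact traceKernel_sub_regKernel_le hsin hε.le η ζ (not_lt.mp hζ)
  obtain ⟨Td, hTdn, hTd⟩ := hkd.exists_clm (ENNReal.mul_ne_top ENNReal.ofReal_ne_top hC)
  have hcomp : IsCompactOperator (Te ∘L TM) := by
    refine isCompactOperator_of_kernel (measurable_compKernel α ε s ham) _ (fun f => ?_)
      (hilbertSchmidt_compKernel hsin hε hs hs0 ham hD ha hint)
    refine (hTe (TM f)).trans ?_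
    refine Filter.EventuallyEq.trans (Filter.Eventually.of_forall fun η => ?_)
      (hreg.ae_comp hCr hM hCM (Lp.memLp f))
    refine integral_congr_ae ?_
    filter_upwards [hTM f] with ζ hζ
    rw [hζ]
  -- The left side is (TK - Te)(TM - TB), and TM - TB has its output supported in |ζ| ≥ 1, where
  -- `kd` is the difference of the two kernels.
  have hsplit : TK ∘L TM - (TK ∘L TB + Te ∘L TM - Te ∘L TB) = Td ∘L TM := by
    have key : ∀ f : L2, TK (TM f - TB f) = Te (TM f - TB f) + Td (TM f) := by
      intro f
      refine Lp.ext ?_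
      filter_upwards [hTK (TM f - TB f), hTe (TM f - TB f), hTd (TM f),
        Lp.coeFn_add (Te (TM f - TB f)) (Td (TM f)),
        hreg.ae_integrable hCr (Lp.memLp (TM f - TB f)),
        hkd.ae_integrable (ENNReal.mul_ne_top ENNReal.ofReal_ne_top hC) (Lp.memLp (TM f))]
        with η h1 h2 h3 h4 h5 h6
      rw [h4, Pi.add_apply, h1, h2, h3, ← integral_add h5 h6]
      refine integral_congr_ae ?_
      filter_upwards [hTB' f, Lp.coeFn_sub (TM f) (TB f)] with ζ h7 h8
      rw [h8, Pi.sub_apply, h7]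
      by_cases hζ : ‖ζ‖ < 1
      · have hζ' : ζ ∈ Metric.ball (0 : E2) 1 := by simpa using hζ
        simp [weightedKernel, kd, hζ]
      · have hζ' : ζ ∉ Metric.ball (0 : E2) 1 := by simpa using hζ
        simp only [Set.indicator_of_notMem hζ', weightedKernel, kd, hζ, if_false]
        push_cast
        ring
    ext1 f
    have h := key f
    simp only [map_sub] at h
    simp only [sub_apply, add_apply,
      ContinuousLinearMap.comp_apply]
    rw [eq_add_of_sub_eq h]
    abel
  refine ⟨TK ∘L TB + Te ∘L TM - Te ∘L TB,
    ((hTBc.clm_comp TK).add hcomp).sub (hTBc.clm_comp Te), ?_⟩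
  rw [hsplit]
  calc ‖Td ∘L TM‖ ≤ ‖Td‖ * ‖TM‖ := ContinuousLinearMap.opNorm_comp_le _ _
    _ ≤ (M * √C.toReal) * ‖TM‖ := by
        gcongr
        refine hTdn.trans (le_of_eq ?_)
        rw [ENNReal.toReal_mul, ENNReal.toReal_ofReal (by positivity),
          Real.sqrt_mul (by positivity), Real.sqrt_sq hM0]
    _ = _ := by simp only [M]; ring

theorem isCompactOperator_comp {α : ℝ} (hsin : Real.sin α ≠ 0) (hcos : Real.cos α ≠ 0) {s : ℝ}
    (hs : -1 < s) (hs0 : s < 0) {a : E2 → ℂ} (ham : Measurable a) {D : ℝ} (hD : 0 ≤ D)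
    (ha : ∀ ξ, ‖a ξ‖ ≤ D * jap (-12) ξ) (hint : ∫ ξ, a ξ = 0) (TK TM : L2 →L[ℂ] L2)
    (hTK : ∀ f : L2, TK f =ᵐ[volume] fun η =>
      ∫ ζ, weightedKernel (s + 1) (traceKernel α) η ζ * f ζ)
    (hTM : ∀ f : L2, TM f =ᵐ[volume] fun η => ∫ ζ, multKernel s a η ζ * f ζ) :
    IsCompactOperator (TK ∘L TM) := by
  obtain ⟨C, hC⟩ := exists_regularisation hsin hcos hs hs0 ham hD ha hint TK TM hTK hTM
  have hcl : IsClosed {f : L2 →L[ℂ] L2 | IsCompactOperator f} :=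
    isClosed_setOfPred_isCompactOperator
  refine hcl.closure_subset (Metric.mem_closure_iff.mpr fun δ hδ => ?_)
  have hlim : Filter.Tendsto (fun ε : ℝ => C * (8 * ε) ^ (1 / 8 : ℝ)) (𝓝[>] 0) (𝓝 0) := by
    have : ContinuousAt (fun ε : ℝ => C * (8 * ε) ^ (1 / 8 : ℝ)) 0 :=
      continuousAt_const.mul ((Real.continuousAt_rpow_const _ _ (Or.inr (by norm_num))).comp
        (by fun_prop))
    have h2 := this.tendsto
    norm_num at h2
    exact h2.mono_left nhdsWithin_le_nhds
  obtain ⟨ε, h1, h2⟩ := ((hlim.eventually_lt_const hδ).and self_mem_nhdsWithin).exists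
  obtain ⟨S, hS, hn⟩ := hC ε h2
  exact ⟨S, hS, by rw [dist_eq_norm]; exact hn.trans_lt h1⟩

end Compact

/-! ### Tangential and normal coordinates adapted to the plane. -/

section Coordinates

open scoped ENNReal

/-- The unit normal of the plane `X`. -/
def nuX (α : ℝ) : E3 := !₂[-Real.sin α, 0, Real.cos α]

/-- The orthogonal projection onto `X`, in the coordinates on `X`. -/
def projX (α : ℝ) (p : E3) : E2 := !₂[p 0 * Real.cos α + p 2 * Real.sin α, p 1]

/-- The point of `ℝ³` with the tangential coordinates `p.1` and the normal coordinate `p.2`. -/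
def sliceX (α : ℝ) (p : E2 × ℝ) : E3 := embX α p.1 + p.2 • nuX α

theorem embX_apply (α : ℝ) (q : E2) :
    embX α q = !₂[q 0 * Real.cos α, q 1, q 0 * Real.sin α] := rfl

theorem rotZ_apply (θ : ℝ) (p : E3) :
    rotZ θ p = !₂[p 0 * Real.cos θ - p 1 * Real.sin θ, p 0 * Real.sin θ + p 1 * Real.cos θ, p 2] :=
  rfl

theorem sliceX_apply (α : ℝ) (p : E2 × ℝ) : sliceX α p =
    !₂[p.1 0 * Real.cos α - p.2 * Real.sin α, p.1 1, p.1 0 * Real.sin α + p.2 * Real.cos α] := by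
  unfold sliceX nuX
  rw [embX_apply]
  ext j; fin_cases j <;> simp; ring

@[fun_prop] theorem continuous_sliceX (α : ℝ) : Continuous (sliceX α) := by
  unfold sliceX
  exact ((embX α).continuous.comp continuous_fst).add (continuous_snd.smul continuous_const)

@[fun_prop] theorem measurable_sliceX (α : ℝ) : Measurable (sliceX α) :=
  (continuous_sliceX α).measurable

@[fun_prop] theorem continuous_projX (α : ℝ) : Continuous (projX α) := by
  unfold projX
  refine (PiLp.continuous_toLp 2 _).comp (continuous_pi fun j => ?_)
  fin_cases j <;> (simp; fun_prop)

@[fun_prop] theorem measurable_projX (α : ℝ) : Measurable (projX α) :=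
  (continuous_projX α).measurable

theorem projX_sliceX (α : ℝ) (p : E2 × ℝ) : projX α (sliceX α p) = p.1 := by
  have h := Real.sin_sq_add_cos_sq α
  rw [sliceX_apply]
  unfold projX
  ext j; fin_cases j
  · simp; linear_combination p.1 0 * h
  · simp

theorem norm_sq_sliceX (α : ℝ) (p : E2 × ℝ) : ‖sliceX α p‖ ^ 2 = ‖p.1‖ ^ 2 + p.2 ^ 2 := by
  have h := Real.sin_sq_add_cos_sq α
  rw [sliceX_apply, E3.norm_sq, E2.norm_sq]
  simp
  linear_combination (p.1 0 ^ 2 + p.2 ^ 2) * h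

theorem sliceX_neg (α : ℝ) (p : E2 × ℝ) : sliceX α (-p) = -sliceX α p := by
  unfold sliceX
  simp [add_comm]

theorem sliceX_sub (α : ℝ) (p q : E2 × ℝ) : sliceX α (p - q) = sliceX α p - sliceX α q := by
  unfold sliceX
  simp [sub_smul]; abel

theorem inner_sliceX_embX (α : ℝ) (p : E2 × ℝ) (x : E2) :
    inner ℝ (sliceX α p) (embX α x) = inner ℝ p.1 x := by
  have h := Real.sin_sq_add_cos_sq α
  rw [sliceX_apply, embX_apply]
  simp [PiLp.inner_apply, Fin.sum_univ_three, Fin.sum_univ_two]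
  linear_combination p.1 0 * x 0 * h

/-- The isometry of `ℝ³` which takes the coordinate axes to the adapted axes of `X`. -/
def tiltE3 (α : ℝ) : E3 ≃ₗᵢ[ℝ] E3 :=
  LinearIsometry.toLinearIsometryEquiv
    { toFun := fun p => !₂[p 0 * Real.cos α - p 2 * Real.sin α, p 1,
        p 0 * Real.sin α + p 2 * Real.cos α]
      map_add' := fun p q => by ext j; fin_cases j <;> simp <;> ring
      map_smul' := fun c q => by ext j; fin_cases j <;> simp <;> ring
      norm_map' := fun p => by
        rw [← sq_eq_sq₀ (norm_nonneg _) (norm_nonneg _), E3.norm_sq, E3.norm_sq]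
        have h := Real.sin_sq_add_cos_sq α
        simp
        linear_combination (p 0 ^ 2 + p 2 ^ 2) * h } rfl

/-- The rotation `rotZ θ` as an isometry. -/
def rotZIso (θ : ℝ) : E3 ≃ₗᵢ[ℝ] E3 :=
  { (rotZ θ).toLinearEquiv with
    norm_map' := fun p => by
      change ‖rotZ θ p‖ = ‖p‖
      rw [← sq_eq_sq₀ (norm_nonneg _) (norm_nonneg _), rotZ_apply, E3.norm_sq, E3.norm_sq]
      have h := Real.sin_sq_add_cos_sq θ
      simp
      linear_combination (p 0 ^ 2 + p 1 ^ 2) * h }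

theorem rotZIso_apply (θ : ℝ) (p : E3) : rotZIso θ p = rotZ θ p := rfl

theorem norm_rotZ (θ : ℝ) (p : E3) : ‖rotZ θ p‖ = ‖p‖ := (rotZIso θ).norm_map p

theorem measurePreserving_rotZ (θ : ℝ) : MeasurePreserving (rotZ θ) volume volume :=
  (rotZIso θ).measurePreserving

theorem rotZ_neg_apply (θ : ℝ) (p : E3) : rotZ (-θ) (rotZ θ p) = p := by
  have h := Real.sin_sq_add_cos_sq θ
  rw [rotZ_apply, rotZ_apply]
  ext j; fin_cases j
  · simp; linear_combination p 0 * h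
  · simp; linear_combination p 1 * h
  · simp

@[fun_prop] theorem continuous_rotZ_uncurry : Continuous fun q : ℝ × E3 => rotZ q.1 q.2 := by
  simp only [rotZ_apply]
  refine (PiLp.continuous_toLp 2 _).comp (continuous_pi fun j => ?_)
  fin_cases j <;> simp <;> fun_prop

theorem measurePreserving_sliceX (α : ℝ) :
    MeasurePreserving (sliceX α) (volume.prod volume) volume := by
  have h1 : MeasurePreserving (fun p : E2 × ℝ => (p.2, WithLp.ofLp p.1))
      (volume.prod volume) (volume.prod volume) :=
    ((MeasurePreserving.id volume).prod (PiLp.volume_preserving_ofLp (Fin 2))).comp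
      (Measure.measurePreserving_swap (μ := (volume : Measure E2)) (ν := (volume : Measure ℝ)))
  have h2 := (volume_preserving_piFinSuccAbove (fun _ : Fin 3 => ℝ) 2).symm
  have h3 := PiLp.volume_preserving_toLp (Fin 3)
  have h4 := (tiltE3 α).measurePreserving
  have h := ((h4.comp h3).comp h2).comp h1
  suffices hE : sliceX α = (((tiltE3 α ∘ WithLp.toLp 2) ∘
      (MeasurableEquiv.piFinSuccAbove (fun _ : Fin 3 => ℝ) 2).symm) ∘
      fun p : E2 × ℝ => (p.2, WithLp.ofLp p.1)) by rw [hE]; exact h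
  funext p
  simp only [Function.comp]
  have e : (MeasurableEquiv.piFinSuccAbove (fun _ : Fin 3 => ℝ) 2).symm (p.2, WithLp.ofLp p.1)
      = ![p.1 0, p.1 1, p.2] := by
    rw [MeasurableEquiv.symm_apply_eq]
    refine Prod.ext rfl ?_
    funext j; fin_cases j <;> rfl
  rw [e, sliceX_apply]
  ext j; fin_cases j <;> rfl

theorem lintegral_sliceX (α : ℝ) {f : E3 → ℝ≥0∞} (hf : Measurable f) :
    ∫⁻ ξ, f ξ = ∫⁻ η, ∫⁻ t : ℝ, f (sliceX α (η, t)) := by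
  rw [← (measurePreserving_sliceX α).lintegral_comp hf,
    lintegral_prod (fun p => f (sliceX α p)) (hf.comp (measurable_sliceX α)).aemeasurable]

theorem measurableEmbedding_sliceX (α : ℝ) : MeasurableEmbedding (sliceX α) := by
  refine (measurable_sliceX α).measurableEmbedding fun p q h => ?_
  have h1 : p.1 = q.1 := by rw [← projX_sliceX α p, h, projX_sliceX]
  have h2 : p.2 • nuX α = q.2 • nuX α := by
    unfold sliceX at h; rw [h1] at h; exact add_left_cancel h
  have h3 : nuX α ≠ 0 := fun h0 => by
    have h := Real.sin_sq_add_cos_sq α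
    have a0 := congrArg (fun v : E3 => v 0) h0
    have a2 := congrArg (fun v : E3 => v 2) h0
    simp [nuX] at a0 a2
    simp [a0, a2] at h
  exact Prod.ext h1 (smul_left_injective ℝ h3 h2)

theorem integrable_sliceX_iff (α : ℝ) {f : E3 → ℂ} :
    Integrable (fun p => f (sliceX α p)) (volume.prod volume) ↔ Integrable f :=
  (measurePreserving_sliceX α).integrable_comp_emb (measurableEmbedding_sliceX α)

theorem integral_sliceX (α : ℝ) {f : E3 → ℂ} (hf : Integrable f) :
    ∫ ξ, f ξ = ∫ η, ∫ t : ℝ, f (sliceX α (η, t)) := by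
  rw [← (measurePreserving_sliceX α).integral_comp (measurableEmbedding_sliceX α),
    integral_prod _ ((integrable_sliceX_iff α).mpr hf)]

end Coordinates

/-! ### From (t, θ) to ζ: derivation of the trace kernel. -/

section ChangeOfVariables

open scoped ENNReal

/-- The substitution `θ = π - 2 arctan c`. -/
theorem lintegral_circle_eq (f : ℝ → ℝ≥0∞) :
    ∫⁻ θ in Set.Ioo 0 (2 * Real.pi), f θ =
      ∫⁻ c : ℝ, ENNReal.ofReal (2 / (1 + c ^ 2)) * f (Real.pi - 2 * Real.arctan c) := by
  have himg : (fun c : ℝ => Real.pi - 2 * Real.arctan c) '' Set.univ =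
      Set.Ioo 0 (2 * Real.pi) := by
    ext θ
    constructor
    · rintro ⟨c, -, rfl⟩
      exact ⟨by linarith [Real.arctan_lt_pi_div_two c], by linarith [Real.neg_pi_div_two_lt_arctan c]⟩
    · rintro ⟨h1, h2⟩
      refine ⟨Real.tan ((Real.pi - θ) / 2), trivial, ?_⟩
      simp only
      rw [Real.arctan_tan (by linarith) (by linarith)]
      ring
  rw [← himg, lintegral_image_eq_lintegral_abs_deriv_mul MeasurableSet.univ
    (f' := fun c => -(2 * (1 / (1 + c ^ 2))))]
  · rw [Measure.restrict_univ]
    refine lintegral_congr fun c => ?_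
    rw [abs_neg, abs_of_nonneg (by positivity)]
    congr 2
    ring
  · intro c _
    exact (((Real.hasDerivAt_arctan c).const_mul 2).const_sub Real.pi).hasDerivWithinAt
  · intro a _ b _ h
    simp only at h
    exact Real.arctan_injective (by linarith)

theorem cos_pi_sub_two_arctan (c : ℝ) :
    Real.cos (Real.pi - 2 * Real.arctan c) = 1 - 2 / (1 + c ^ 2) := by
  have h : (1 + c ^ 2) ≠ 0 := by positivity
  rw [Real.cos_pi_sub, Real.cos_two_mul, Real.cos_sq_arctan]
  field_simp
  ring

theorem sin_pi_sub_two_arctan (c : ℝ) :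
    Real.sin (Real.pi - 2 * Real.arctan c) = 2 * c / (1 + c ^ 2) := by
  have h : (1 + c ^ 2) ≠ 0 := by positivity
  have hc := Real.cos_arctan_pos c
  rw [Real.sin_pi_sub, Real.sin_two_mul]
  have h1 : Real.sin (Real.arctan c) = c * Real.cos (Real.arctan c) := by
    have := Real.tan_eq_sin_div_cos (Real.arctan c)
    rw [Real.tan_arctan] at this
    field_simp at this; linarith
  rw [h1]
  have h2 := Real.cos_sq_arctan c
  have : 2 * (c * Real.cos (Real.arctan c)) * Real.cos (Real.arctan c)
      = 2 * c * Real.cos (Real.arctan c) ^ 2 := by ring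
  rw [this, h2]; ring

/-- The projection of the point of the circle through `η + tν` with the parameter `c`. -/
theorem projX_rotZ_sliceX (α c : ℝ) (hcos : Real.cos α ≠ 0) (η : E2) (t : ℝ) :
    projX α (rotZ (Real.pi - 2 * Real.arctan c) (sliceX α (η, t))) =
      !₂[η 0 - 2 * Real.cos α * (η 0 * Real.cos α - t * Real.sin α + c * η 1) / (1 + c ^ 2),
        -η 1 + c * (2 * Real.cos α * (η 0 * Real.cos α - t * Real.sin α + c * η 1) / (1 + c ^ 2)) /
          Real.cos α] := by
  have h : (1 + c ^ 2) ≠ 0 := by positivity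
  have h1 := Real.sin_sq_add_cos_sq α
  rw [sliceX_apply, rotZ_apply, cos_pi_sub_two_arctan, sin_pi_sub_two_arctan]
  unfold projX
  ext j; fin_cases j
  · simp
    field_simp
    linear_combination (1 + c ^ 2) * η 0 * h1
  · simp
    field_simp
    ring

/-- The normal frequency for which the circle with the parameter `c` meets the line
`ζ₀ = x`. -/
def normalFreq (α : ℝ) (η : E2) (c x : ℝ) : ℝ :=
  (1 + c ^ 2) / (2 * Real.cos α * Real.sin α) * x +
    (η 0 * Real.cos α + c * η 1 - (1 + c ^ 2) * η 0 / (2 * Real.cos α)) / Real.sin α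

theorem normalFreq_spec {α : ℝ} (hsin : Real.sin α ≠ 0) (hcos : Real.cos α ≠ 0) (η : E2)
    (c x : ℝ) : 2 * Real.cos α * (η 0 * Real.cos α - normalFreq α η c x * Real.sin α + c * η 1) /
      (1 + c ^ 2) = η 0 - x := by
  have h : (1 + c ^ 2) ≠ 0 := by positivity
  unfold normalFreq
  field_simp
  ring

/-- With ζ = (x, y) and δ = η₀ - x, solving for the normal frequency t gives 2δt = (|η|² - |ζ|²) cot
α - δ² tan α. In δ²|η|² + (δt)² the cross term replaces |η|² by the mean of |η|² and |ζ|²; hence the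
symmetry of q. -/
theorem qForm_eq {α : ℝ} (hsin : Real.sin α ≠ 0) (hcos : Real.cos α ≠ 0) (η : E2) {x y : ℝ}
    (hx : η 0 - x ≠ 0) :
    qForm α η !₂[x, y] = (η 0 - x) ^ 2 *
      (‖η‖ ^ 2 + normalFreq α η (Real.cos α / (η 0 - x) * y + Real.cos α * η 1 / (η 0 - x)) x ^ 2) := by
  have hs := Real.sin_sq_add_cos_sq α
  set t := normalFreq α η (Real.cos α / (η 0 - x) * y + Real.cos α * η 1 / (η 0 - x)) x with ht
  have hst : (η 0 - x) * t * (2 * Real.sin α * Real.cos α) =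
      (η 0 ^ 2 + η 1 ^ 2 - x ^ 2 - y ^ 2) * Real.cos α ^ 2 - (η 0 - x) ^ 2 * Real.sin α ^ 2 := by
    have hsa : Real.sin α ^ 2 = 1 - Real.cos α ^ 2 := by linarith
    rw [hsa, ht]
    unfold normalFreq
    field_simp
    ring
  unfold qForm
  rw [E2.norm_sq, E2.norm_sq]
  simp only [Matrix.cons_val_zero, Matrix.cons_val_one]
  have h2 : ((η 0 - x) * t) ^ 2 * (4 * Real.sin α ^ 2 * Real.cos α ^ 2) =
      ((η 0 ^ 2 + η 1 ^ 2 - x ^ 2 - y ^ 2) * Real.cos α ^ 2 - (η 0 - x) ^ 2 * Real.sin α ^ 2) ^ 2 := by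
    rw [← hst]; ring
  have h3 : ((η 0 - x) * t) ^ 2 =
      ((η 0 ^ 2 + η 1 ^ 2 - x ^ 2 - y ^ 2) * Real.cos α ^ 2 - (η 0 - x) ^ 2 * Real.sin α ^ 2) ^ 2 /
        (4 * Real.sin α ^ 2 * Real.cos α ^ 2) := by
    rw [eq_div_iff (by positivity), h2]
  have h4 : (η 0 - x) ^ 2 * (η 0 ^ 2 + η 1 ^ 2 + t ^ 2) =
      (η 0 - x) ^ 2 * (η 0 ^ 2 + η 1 ^ 2) + ((η 0 - x) * t) ^ 2 := by ring
  rw [h4, h3]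
  field_simp
  ring

/-- The point with the first coordinate `x` on the projection of the circle with the
parameter `c`. -/
def circlePt (α : ℝ) (η : E2) (c x : ℝ) : E2 := !₂[x, -η 1 + c * (η 0 - x) / Real.cos α]

theorem measurable_circlePt (α : ℝ) (η : E2) :
    Measurable fun p : ℝ × ℝ => circlePt α η p.1 p.2 :=
  measurable_toE2.comp (f := fun p : ℝ × ℝ => (p.2, -η 1 + p.1 * (η 0 - p.2) / Real.cos α))
    (by fun_prop)

theorem measurable_normalFreq (α : ℝ) (η : E2) :
    Measurable fun p : ℝ × ℝ => normalFreq α η p.1 p.2 := by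
  unfold normalFreq; fun_prop

theorem measurable_rotZ_sliceX (α : ℝ) (η : E2) :
    Measurable fun p : ℝ × ℝ => projX α (rotZ p.2 (sliceX α (η, p.1))) :=
  (measurable_projX α).comp (continuous_rotZ_uncurry.comp (f := fun p : ℝ × ℝ =>
    (p.2, sliceX α (η, p.1))) (by fun_prop)).measurable

/-- The slope of `normalFreq` in x carries the factor 1 + c², which cancels the density of dθ with
respect to dc. -/
theorem lintegral_normalFreq {α : ℝ} (hsin : Real.sin α ≠ 0) (hcos : Real.cos α ≠ 0) (η : E2)
    (c : ℝ) {f : ℝ → ℝ≥0∞} (hf : Measurable f) :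
    ∫⁻ t : ℝ, ENNReal.ofReal (2 / (1 + c ^ 2)) * f t =
      ∫⁻ x : ℝ, ENNReal.ofReal (|Real.cos α * Real.sin α|⁻¹) * f (normalFreq α η c x) := by
  have hc : 0 < 1 + c ^ 2 := by positivity
  have ha : (1 + c ^ 2) / (2 * Real.cos α * Real.sin α) ≠ 0 := by positivity
  rw [lintegral_comp_affine _ (hf.const_mul _) ha
    ((η 0 * Real.cos α + c * η 1 - (1 + c ^ 2) * η 0 / (2 * Real.cos α)) / Real.sin α),
    ← lintegral_const_mul' _ _ ENNReal.ofReal_ne_top]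
  refine lintegral_congr fun x => ?_
  rw [← mul_assoc, ← ENNReal.ofReal_mul (abs_nonneg _)]
  unfold normalFreq
  congr 2
  rw [abs_div, abs_of_pos hc, mul_assoc, abs_mul, abs_of_pos (by norm_num : (0 : ℝ) < 2)]
  field_simp

theorem traceKernel_eq {α : ℝ} (hsin : Real.sin α ≠ 0) (hcos : Real.cos α ≠ 0) (η : E2)
    {x y : ℝ} (hx : η 0 - x ≠ 0) :
    |Real.cos α / (η 0 - x)| * (|Real.cos α * Real.sin α|⁻¹ * (‖η‖ ^ 2 + normalFreq α η
      (Real.cos α / (η 0 - x) * y + Real.cos α * η 1 / (η 0 - x)) x ^ 2)⁻¹) =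
      traceKernel α η !₂[x, y] := by
  unfold traceKernel
  rw [qForm_eq hsin hcos η hx]
  simp only [Matrix.cons_val_zero]
  rw [abs_div, abs_mul, ← sq_abs (η 0 - x)]
  have hd' : 0 < |η 0 - x| := abs_pos.mpr hx
  have hc' : 0 < |Real.cos α| := abs_pos.mpr hcos
  have hs' : 0 < |Real.sin α| := abs_pos.mpr hsin
  generalize ‖η‖ ^ 2 + normalFreq α η
    (Real.cos α / (η 0 - x) * y + Real.cos α * η 1 / (η 0 - x)) x ^ 2 = A
  rcases eq_or_ne A 0 with rfl | hA
  · simp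
  · field_simp

theorem lintegral_circlePt {α : ℝ} (hsin : Real.sin α ≠ 0) (hcos : Real.cos α ≠ 0) (η : E2)
    {x : ℝ} (hx : x ≠ η 0) {Φ : E2 → ℝ≥0∞} (hΦ : Measurable Φ) :
    ∫⁻ c : ℝ, ENNReal.ofReal (|Real.cos α * Real.sin α|⁻¹) *
      (ENNReal.ofReal ((‖η‖ ^ 2 + normalFreq α η c x ^ 2)⁻¹) * Φ (circlePt α η c x)) =
    ∫⁻ y : ℝ, ENNReal.ofReal (traceKernel α η !₂[x, y]) * Φ !₂[x, y] := by
  have hd : η 0 - x ≠ 0 := sub_ne_zero.mpr hx.symm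
  have hnf := (measurable_normalFreq α η).comp (measurable_prodMk_right (y := x))
  have hpt := (measurable_circlePt α η).comp (measurable_prodMk_right (y := x))
  have hm3 : Measurable fun c : ℝ => ENNReal.ofReal (|Real.cos α * Real.sin α|⁻¹) *
      (ENNReal.ofReal ((‖η‖ ^ 2 + normalFreq α η c x ^ 2)⁻¹) * Φ (circlePt α η c x)) :=
    ((((hnf.pow_const 2).const_add _).inv.ennreal_ofReal).mul (hΦ.comp hpt)).const_mul _
  rw [lintegral_comp_affine _ hm3 (a := Real.cos α / (η 0 - x)) (div_ne_zero hcos hd)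
    (Real.cos α * η 1 / (η 0 - x)), ← lintegral_const_mul' _ _ ENNReal.ofReal_ne_top]
  refine lintegral_congr fun y => ?_
  have e1 : circlePt α η (Real.cos α / (η 0 - x) * y + Real.cos α * η 1 / (η 0 - x)) x
      = !₂[x, y] := by
    have : -η 1 + (Real.cos α / (η 0 - x) * y + Real.cos α * η 1 / (η 0 - x)) * (η 0 - x) /
      Real.cos α = y := by field_simp; ring
    unfold circlePt
    rw [this]
  rw [e1, ← mul_assoc, ← mul_assoc, ← ENNReal.ofReal_mul (abs_nonneg _),
    ← ENNReal.ofReal_mul (by positivity), mul_assoc, traceKernel_eq hsin hcos η hd]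

/-- With the parameter c = cot(θ/2), the first coordinate x of the projected point is affine in t
for fixed c, and its second coordinate is affine in c for fixed x. So two affine substitutions on ℝ,
with Tonelli in between, replace a Jacobian in two variables. The line x = η₀, where the second
substitution degenerates, is null. -/
theorem lintegral_rotation_eq {α : ℝ} (hsin : Real.sin α ≠ 0) (hcos : Real.cos α ≠ 0) (η : E2)
    {Φ : E2 → ℝ≥0∞} (hΦ : Measurable Φ) :
    ∫⁻ t : ℝ, ∫⁻ θ in Set.Ioo 0 (2 * Real.pi),
      ENNReal.ofReal ((‖η‖ ^ 2 + t ^ 2)⁻¹) * Φ (projX α (rotZ θ (sliceX α (η, t)))) =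
    ∫⁻ ζ, ENNReal.ofReal (traceKernel α η ζ) * Φ ζ := by
  have htk : Measurable fun ζ => traceKernel α η ζ :=
    (measurable_traceKernel α).comp (measurable_prodMk_left (x := η))
  have hm1 : Measurable fun p : ℝ × ℝ => Φ (projX α (rotZ (Real.pi - 2 * Real.arctan p.2)
      (sliceX α (η, p.1)))) :=
    hΦ.comp ((measurable_rotZ_sliceX α η).comp (f := fun p : ℝ × ℝ =>
      (p.1, Real.pi - 2 * Real.arctan p.2)) (by fun_prop))
  have hw : Measurable fun t : ℝ => ENNReal.ofReal ((‖η‖ ^ 2 + t ^ 2)⁻¹) := by fun_prop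
  simp only [lintegral_circle_eq]
  rw [lintegral_lintegral_swap (Measurable.aemeasurable
    (((by fun_prop : Measurable fun p : ℝ × ℝ => ENNReal.ofReal (2 / (1 + p.2 ^ 2)))).mul
      ((hw.comp measurable_fst).mul hm1)))]
  have step : ∀ c : ℝ, ∫⁻ t : ℝ, ENNReal.ofReal (2 / (1 + c ^ 2)) *
        (ENNReal.ofReal ((‖η‖ ^ 2 + t ^ 2)⁻¹) *
        Φ (projX α (rotZ (Real.pi - 2 * Real.arctan c) (sliceX α (η, t))))) =
      ∫⁻ x : ℝ, ENNReal.ofReal (|Real.cos α * Real.sin α|⁻¹) *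
        (ENNReal.ofReal ((‖η‖ ^ 2 + normalFreq α η c x ^ 2)⁻¹) * Φ (circlePt α η c x)) := by
    intro c
    refine (lintegral_normalFreq hsin hcos η c
      (hw.mul (hm1.comp (measurable_prodMk_right (y := c))))).trans ?_
    refine lintegral_congr fun x => ?_
    simp only [Pi.mul_apply, Function.comp]
    rw [projX_rotZ_sliceX α c hcos, normalFreq_spec hsin hcos, sub_sub_cancel]
    rfl
  simp only [step]
  rw [lintegral_lintegral_swap (Measurable.aemeasurable
      (((((measurable_normalFreq α η).pow_const 2).const_add _).inv.ennreal_ofReal.mul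
        (hΦ.comp (measurable_circlePt α η))).const_mul _)), lintegral_E2 (by fun_prop)]
  have hne : ∀ᵐ x : ℝ, x ≠ η 0 := by simp [ae_iff]
  refine lintegral_congr_ae ?_
  filter_upwards [hne] with x hx
  exact lintegral_circlePt hsin hcos η hx hΦ

/-- The image of the measure `dθ dt / |η + tν|²` under the projection of the rotated point. -/
theorem map_rotation_measure {α : ℝ} (hsin : Real.sin α ≠ 0) (hcos : Real.cos α ≠ 0) (η : E2) :
    Measure.map (fun p : ℝ × ℝ => projX α (rotZ p.2 (sliceX α (η, p.1))))
      ((volume.prod (volume.restrict (Set.Ioo 0 (2 * Real.pi)))).withDensity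
        fun p => ENNReal.ofReal ((‖η‖ ^ 2 + p.1 ^ 2)⁻¹)) =
    volume.withDensity fun ζ => ENNReal.ofReal (traceKernel α η ζ) := by
  have hm : Measurable fun p : ℝ × ℝ => projX α (rotZ p.2 (sliceX α (η, p.1))) :=
    (measurable_projX α).comp (continuous_rotZ_uncurry.comp (f := fun p : ℝ × ℝ =>
      (p.2, sliceX α (η, p.1))) (by fun_prop)).measurable
  have htk : Measurable fun ζ => traceKernel α η ζ :=
    (measurable_traceKernel α).comp (measurable_prodMk_left (x := η))
  refine Measure.ext_of_lintegral _ fun Φ hΦ => ?_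
  have hw : Measurable fun p : ℝ × ℝ => ENNReal.ofReal ((‖η‖ ^ 2 + p.1 ^ 2)⁻¹) := by fun_prop
  rw [lintegral_map hΦ hm, lintegral_withDensity_eq_lintegral_mul _ (by fun_prop) hΦ]
  refine (lintegral_withDensity_eq_lintegral_mul _ hw (hΦ.comp hm)).trans ?_
  rw [lintegral_prod _ (hw.mul (hΦ.comp hm)).aemeasurable]
  exact lintegral_rotation_eq hsin hcos η hΦ

end ChangeOfVariables

/-! ### Integration along normal lines and the trace theorem in L². -/

section Slice

open scoped ENNReal

/-- The integral of a function over the normal line. -/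
def sliceInt (α : ℝ) (G : E3 → ℂ) (η : E2) : ℂ := ∫ t : ℝ, G (sliceX α (η, t))

theorem jap_sliceX_le (α : ℝ) {a b : ℝ} (ha : 0 ≤ a) (hb : 0 ≤ b) (η : E2) (t : ℝ) :
    jap (-(a + b)) (sliceX α (η, t)) ≤ jap (-a) η * jap (-b) t := by
  have h := norm_sq_sliceX α (η, t)
  simp only at h
  have h1 : jap (-a) (sliceX α (η, t)) ≤ jap (-a) η := by
    unfold jap
    exact Real.rpow_le_rpow_of_nonpos (by positivity) (by rw [h]; nlinarith [sq_nonneg t])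
      (by linarith)
  have h2 : jap (-b) (sliceX α (η, t)) ≤ jap (-b) t := by
    unfold jap
    refine Real.rpow_le_rpow_of_nonpos (by positivity) ?_ (by linarith)
    rw [h, Real.norm_eq_abs, sq_abs]; nlinarith [sq_nonneg ‖η‖]
  rw [neg_add, ← jap_mul]
  exact mul_le_mul h1 h2 (jap_nonneg _ _) (jap_nonneg _ _)

/-- The integral of a power of the bracket over the normal line. -/
theorem lintegral_jap_sliceX (α p : ℝ) (η : E2) :
    ∫⁻ t : ℝ, ENNReal.ofReal (jap (-p) (sliceX α (η, t))) =
      (∫⁻ t : ℝ, ENNReal.ofReal (jap (-p) t)) * ENNReal.ofReal (jap (1 - p) η) := by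
  have hj := jap_pos 1 η
  have hm : Measurable fun t : ℝ => ENNReal.ofReal (jap (-p) (sliceX α (η, t))) := by fun_prop
  -- Substituting ⟨η⟩t for t factors 1 + |η|² + ⟨η⟩²t² as ⟨η⟩²(1 + t²).
  rw [lintegral_comp_affine _ hm hj.ne' 0, abs_of_pos hj, mul_comm,
    ← lintegral_mul_const' _ _ ENNReal.ofReal_ne_top, ← lintegral_mul_const' _ _ ENNReal.ofReal_ne_top]
  refine lintegral_congr fun t => ?_
  rw [← ENNReal.ofReal_mul (jap_nonneg _ _), ← ENNReal.ofReal_mul (jap_nonneg _ _)]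
  congr 1
  have e : jap (-p) (sliceX α (η, jap 1 η * t + 0)) = jap (-p) η * jap (-p) t := by
    unfold jap
    rw [← Real.mul_rpow (by positivity) (by positivity), norm_sq_sliceX]
    congr 1
    simp only [add_zero]
    have : ((1 + ‖η‖ ^ 2) ^ ((1 : ℝ) / 2)) ^ 2 = 1 + ‖η‖ ^ 2 := by
      rw [← Real.rpow_natCast, ← Real.rpow_mul (by positivity)]; norm_num
    rw [mul_pow, this, Real.norm_eq_abs, sq_abs]; ring
  rw [e, sub_eq_add_neg, ← jap_mul]; ring

theorem lintegral_jap_real_lt_top {p : ℝ} (hp : 1 < p) :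
    ∫⁻ t : ℝ, ENNReal.ofReal (jap (-p) t) < ⊤ :=
  (integrable_jap volume (by simpa using hp)).lintegral_lt_top

/-- The classical trace estimate: Cauchy–Schwarz on each normal line, where the integral of the
bracket to the power -2t is a constant times ⟨η⟩^{1-2t}, finite because t > 1/2. -/
theorem lintegral_sliceX_sq_le (α : ℝ) {t : ℝ} (ht : 1 / 2 < t) : ∃ C : ℝ≥0∞, C ≠ ⊤ ∧
    ∀ f : E3 → ℝ≥0∞, AEMeasurable f volume →
      ∫⁻ η, (ENNReal.ofReal (jap (t - 1 / 2) η) *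
        ∫⁻ τ : ℝ, ENNReal.ofReal (jap (-t) (sliceX α (η, τ))) * f (sliceX α (η, τ))) ^ 2 ≤
      C * ∫⁻ ξ, f ξ ^ 2 := by
  refine ⟨∫⁻ τ : ℝ, ENNReal.ofReal (jap (-(2 * t)) τ),
    (lintegral_jap_real_lt_top (by linarith)).ne, ?_⟩
  have key : ∀ f : E3 → ℝ≥0∞, Measurable f →
      ∫⁻ η, (ENNReal.ofReal (jap (t - 1 / 2) η) *
        ∫⁻ τ : ℝ, ENNReal.ofReal (jap (-t) (sliceX α (η, τ))) * f (sliceX α (η, τ))) ^ 2 ≤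
      (∫⁻ τ : ℝ, ENNReal.ofReal (jap (-(2 * t)) τ)) * ∫⁻ ξ, f ξ ^ 2 := by
    intro f hf
    have hf2 : Measurable fun p : E2 × ℝ => f (sliceX α p) ^ 2 :=
      (hf.comp (measurable_sliceX α)).pow_const 2
    rw [lintegral_sliceX α (hf.pow_const 2), ← lintegral_const_mul _ hf2.lintegral_prod_right']
    refine lintegral_mono fun η => ?_
    have hfη : Measurable fun τ : ℝ => f (sliceX α (η, τ)) := hf.comp (by fun_prop)
    have h1 := sq_lintegral_mul_le (μ := (volume : Measure ℝ))
      (f := fun τ => ENNReal.ofReal (jap (-t) (sliceX α (η, τ))))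
      (g := fun τ => f (sliceX α (η, τ))) (by fun_prop) hfη.aemeasurable
    have h2 : ∫⁻ τ : ℝ, ENNReal.ofReal (jap (-t) (sliceX α (η, τ))) ^ 2 =
        (∫⁻ τ : ℝ, ENNReal.ofReal (jap (-(2 * t)) τ)) * ENNReal.ofReal (jap (1 - 2 * t) η) := by
      rw [← lintegral_jap_sliceX α]
      refine lintegral_congr fun τ => ?_
      rw [← ENNReal.ofReal_pow (jap_nonneg _ _), jap_sq, mul_neg]
    rw [h2] at h1
    rw [mul_pow]
    refine (mul_le_mul_right h1 _).trans (le_of_eq ?_)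
    have h3 : ENNReal.ofReal (jap (t - 1 / 2) η) ^ 2 * ENNReal.ofReal (jap (1 - 2 * t) η) = 1 := by
      rw [← ENNReal.ofReal_pow (jap_nonneg _ _), jap_sq, ← ENNReal.ofReal_mul (jap_nonneg _ _),
        jap_mul]
      ring_nf
      simp
    calc _ = (ENNReal.ofReal (jap (t - 1 / 2) η) ^ 2 * ENNReal.ofReal (jap (1 - 2 * t) η)) *
        ((∫⁻ τ : ℝ, ENNReal.ofReal (jap (-(2 * t)) τ)) *
          ∫⁻ τ : ℝ, f (sliceX α (η, τ)) ^ 2) := by ring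
      _ = _ := by rw [h3, one_mul]
  intro f hf
  have e1 : ∫⁻ ξ, f ξ ^ 2 = ∫⁻ ξ, hf.mk f ξ ^ 2 := by
    refine lintegral_congr_ae ?_
    filter_upwards [hf.ae_eq_mk] with ξ h; rw [h]
  have e2 : ∀ᵐ η : E2, ∀ᵐ τ : ℝ, f (sliceX α (η, τ)) = hf.mk f (sliceX α (η, τ)) :=
    Measure.ae_ae_of_ae_prod ((measurePreserving_sliceX α).quasiMeasurePreserving.ae hf.ae_eq_mk)
  rw [e1]
  refine le_trans (le_of_eq ?_) (key _ hf.measurable_mk)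
  refine lintegral_congr_ae ?_
  filter_upwards [e2] with η h
  congr 2
  refine lintegral_congr_ae ?_
  filter_upwards [h] with τ h'
  rw [h']

theorem ae_sliceX (α : ℝ) {P : E3 → Prop} (h : ∀ᵐ ξ, P ξ) :
    ∀ᵐ η : E2, ∀ᵐ τ : ℝ, P (sliceX α (η, τ)) :=
  Measure.ae_ae_of_ae_prod ((measurePreserving_sliceX α).quasiMeasurePreserving.ae h)

theorem aestronglyMeasurable_sliceInt (α : ℝ) {G : E3 → ℂ} (hG : AEStronglyMeasurable G volume) :
    AEStronglyMeasurable (sliceInt α G) volume :=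
  (hG.comp_quasiMeasurePreserving
    (measurePreserving_sliceX α).quasiMeasurePreserving).integral_prod_right'

theorem ae_integrable_sliceX (α : ℝ) {t : ℝ} (ht : 1 / 2 < t) {G : E3 → ℂ}
    (hG : MemLp (fun ξ => ((jap t ξ : ℝ) : ℂ) * G ξ) 2 volume) :
    ∀ᵐ η : E2, Integrable fun τ : ℝ => G (sliceX α (η, τ)) := by
  obtain ⟨C, hC, hb⟩ := lintegral_sliceX_sq_le α ht
  set f : E3 → ℝ≥0∞ := fun ξ => ‖((jap t ξ : ℝ) : ℂ) * G ξ‖ₑ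
  have hfm : AEMeasurable f volume := hG.1.enorm
  have h1 := hb f hfm
  have h2 : ∫⁻ ξ, f ξ ^ 2 < ⊤ := (memLp_two_iff_lintegral hG.1).mp hG
  have hprod : AEMeasurable (fun p : E2 × ℝ =>
      ENNReal.ofReal (jap (-t) (sliceX α p)) * f (sliceX α p)) (volume.prod volume) :=
    AEMeasurable.mul (by fun_prop)
      (hfm.comp_quasiMeasurePreserving (measurePreserving_sliceX α).quasiMeasurePreserving)
  have hfin := ae_lt_top' (((measurable_jap (t - 1 / 2)).ennreal_ofReal.aemeasurable.mul
    hprod.lintegral_prod_right').pow_const 2)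
    (h1.trans_lt (ENNReal.mul_lt_top hC.lt_top h2)).ne
  have hGm : AEStronglyMeasurable G volume := by
    have : AEStronglyMeasurable (fun ξ => ((jap (-t) ξ : ℝ) : ℂ) * (((jap t ξ : ℝ) : ℂ) * G ξ))
      volume := AEStronglyMeasurable.mul (by fun_prop) hG.1
    refine this.congr (Filter.Eventually.of_forall fun ξ => ?_)
    simp only
    rw [← mul_assoc, ← Complex.ofReal_mul, jap_neg_mul]; simp
  have hm := (hGm.comp_quasiMeasurePreserving
    (measurePreserving_sliceX α).quasiMeasurePreserving).prodMk_left
  filter_upwards [hfin, hm] with η h3 h4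
  refine ⟨h4, ?_⟩
  have h5 : ENNReal.ofReal (jap (t - 1 / 2) η) ≠ 0 := by simpa using jap_pos _ η
  have h6 : (∫⁻ τ : ℝ, ENNReal.ofReal (jap (-t) (sliceX α (η, τ))) * f (sliceX α (η, τ))) < ⊤ := by
    by_contra h7
    rw [not_lt, top_le_iff] at h7
    simp only [Pi.mul_apply] at h3
    rw [h7, ENNReal.mul_top h5] at h3
    simp at h3
  refine lt_of_eq_of_lt (lintegral_congr fun τ => ?_) h6
  simp only [f]
  rw [enorm_mul, ← mul_assoc, ← ofReal_norm, ← ofReal_norm, Complex.norm_real,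
    Real.norm_of_nonneg (jap_nonneg _ _), ← ENNReal.ofReal_mul (jap_nonneg _ _), jap_neg_mul,
    ENNReal.ofReal_one, one_mul]

theorem lintegral_sliceInt_sq_le (α : ℝ) {t : ℝ} (ht : 1 / 2 < t) : ∃ C : ℝ≥0∞, C ≠ ⊤ ∧
    ∀ G : E3 → ℂ, MemLp (fun ξ => ((jap t ξ : ℝ) : ℂ) * G ξ) 2 volume →
      ∫⁻ η, ‖((jap (t - 1 / 2) η : ℝ) : ℂ) * sliceInt α G η‖ₑ ^ 2 ≤
        C * ∫⁻ ξ, ‖((jap t ξ : ℝ) : ℂ) * G ξ‖ₑ ^ 2 := by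
  obtain ⟨C, hC, hb⟩ := lintegral_sliceX_sq_le α ht
  refine ⟨C, hC, fun G hG => le_trans (lintegral_mono fun η => ?_) (hb _ hG.1.enorm)⟩
  gcongr
  rw [enorm_mul, ← ofReal_norm, Complex.norm_real, Real.norm_of_nonneg (jap_nonneg _ _)]
  gcongr
  refine (enorm_integral_le_lintegral_enorm _).trans (le_of_eq (lintegral_congr fun τ => ?_))
  rw [enorm_mul, ← mul_assoc, ← ofReal_norm ((jap t _ : ℝ) : ℂ), Complex.norm_real,
    Real.norm_of_nonneg (jap_nonneg _ _), ← ENNReal.ofReal_mul (jap_nonneg _ _), jap_neg_mul,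
    ENNReal.ofReal_one, one_mul]

theorem memLp_sliceInt (α : ℝ) {t : ℝ} (ht : 1 / 2 < t) {G : E3 → ℂ} (hGm : AEStronglyMeasurable G)
    (hG : MemLp (fun ξ => ((jap t ξ : ℝ) : ℂ) * G ξ) 2 volume) :
    MemLp (fun η => ((jap (t - 1 / 2) η : ℝ) : ℂ) * sliceInt α G η) 2 volume := by
  obtain ⟨C, hC, hb⟩ := lintegral_sliceInt_sq_le α ht
  have hm : AEStronglyMeasurable (fun η => ((jap (t - 1 / 2) η : ℝ) : ℂ) * sliceInt α G η) volume :=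
    AEStronglyMeasurable.mul (by fun_prop) (aestronglyMeasurable_sliceInt α hGm)
  exact (memLp_two_iff_lintegral hm).mpr ((hb G hG).trans_lt
    (ENNReal.mul_lt_top hC.lt_top ((memLp_two_iff_lintegral hG.1).mp hG)))

/-- The boundary operator on the Fourier side. -/
theorem exists_traceCLM (α : ℝ) {t : ℝ} (ht : 1 / 2 < t) :
    ∃ T : Lp ℂ 2 (volume : Measure E3) →L[ℂ] Lp ℂ 2 (volume : Measure E2),
      ∀ h : Lp ℂ 2 (volume : Measure E3), T h =ᵐ[volume] fun η => ((jap (t - 1 / 2) η : ℝ) : ℂ) *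
        sliceInt α (fun ξ => ((jap (-t) ξ : ℝ) : ℂ) * h ξ) η := by
  obtain ⟨C, hC, hb⟩ := lintegral_sliceInt_sq_le α ht
  have hcancel : ∀ h : Lp ℂ 2 (volume : Measure E3),
      (fun ξ => ((jap t ξ : ℝ) : ℂ) * (((jap (-t) ξ : ℝ) : ℂ) * h ξ)) = h := by
    intro h; funext ξ; rw [← mul_assoc, ← Complex.ofReal_mul, jap_mul_neg]; simp
  have hL : ∀ h : Lp ℂ 2 (volume : Measure E3),
      MemLp (fun ξ => ((jap t ξ : ℝ) : ℂ) * (((jap (-t) ξ : ℝ) : ℂ) * h ξ)) 2 volume := fun h => by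
    rw [hcancel h]; exact Lp.memLp h
  have hGm : ∀ h : Lp ℂ 2 (volume : Measure E3),
      AEStronglyMeasurable (fun ξ => ((jap (-t) ξ : ℝ) : ℂ) * h ξ) volume := fun h =>
    AEStronglyMeasurable.mul (by fun_prop) (Lp.memLp h).1
  have hM := fun h => memLp_sliceInt α ht (hGm h) (hL h)
  let T₀ : Lp ℂ 2 (volume : Measure E3) →ₗ[ℂ] Lp ℂ 2 (volume : Measure E2) :=
    { toFun := fun h => (hM h).toLp _
      map_add' := fun f g => by
        rw [← MemLp.toLp_add]
        refine MemLp.toLp_congr _ _ ?_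
        filter_upwards [ae_integrable_sliceX α ht (hL f), ae_integrable_sliceX α ht (hL g),
          ae_sliceX α (Lp.coeFn_add f g)] with x hf hg hfg
        rw [Pi.add_apply, ← mul_add]
        congr 1
        unfold sliceInt
        rw [← integral_add hf hg]
        refine integral_congr_ae ?_
        filter_upwards [hfg] with y hy
        rw [hy, Pi.add_apply, mul_add]
      map_smul' := fun c f => by
        rw [RingHom.id_apply, ← MemLp.toLp_const_smul]
        refine MemLp.toLp_congr _ _ ?_
        filter_upwards [ae_sliceX α (Lp.coeFn_smul c f)] with x hx
        simp only [Pi.smul_apply, smul_eq_mul]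
        rw [mul_left_comm]
        congr 1
        unfold sliceInt
        rw [← integral_const_mul]
        refine integral_congr_ae ?_
        filter_upwards [hx] with y hy
        rw [hy, Pi.smul_apply, smul_eq_mul]; ring }
  have hT : ∀ h : Lp ℂ 2 (volume : Measure E3), T₀ h =ᵐ[volume] _ := fun h => (hM h).coeFn_toLp
  have hbd : ∀ f, ‖T₀ f‖ ≤ √C.toReal * ‖f‖ := by
    intro f
    have h1 := hb _ (hL f)
    have h0 : ∀ ξ, ((jap t ξ : ℝ) : ℂ) * (((jap (-t) ξ : ℝ) : ℂ) * f ξ) = f ξ :=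
      congrFun (hcancel f)
    simp only [h0] at h1
    have h2 : ∫⁻ x, ‖T₀ f x‖ₑ ^ 2 = ∫⁻ η, ‖((jap (t - 1 / 2) η : ℝ) : ℂ) *
        sliceInt α (fun ξ => ((jap (-t) ξ : ℝ) : ℂ) * f ξ) η‖ₑ ^ 2 := by
      refine lintegral_congr_ae ?_
      filter_upwards [hT f] with x hx; rw [hx]
    rw [← h2, Lp.lintegral_sq, Lp.lintegral_sq] at h1
    have h3 := ENNReal.toReal_mono (ENNReal.mul_ne_top hC (by simp)) h1
    simp only [ENNReal.toReal_mul, ENNReal.toReal_pow, toReal_enorm] at h3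
    rw [← Real.sqrt_sq (norm_nonneg f), ← Real.sqrt_mul ENNReal.toReal_nonneg]
    exact Real.le_sqrt_of_sq_le h3
  exact ⟨T₀.mkContinuous _ hbd, hT⟩

end Slice

/-! ### The boundary operator as slice integration. -/

section Restriction

open scoped ENNReal

theorem exists_sliceX_bound (α : ℝ) (Ψ : 𝓢(E3, ℂ)) : ∃ C : ℝ, 0 ≤ C ∧ ∀ η t,
    ‖Ψ (sliceX α (η, t))‖ ≤ C * (jap (-4) η * jap (-2) t) := by
  obtain ⟨C, hC, h⟩ := schwartz_decay Ψ 6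
  refine ⟨C, hC, fun η t => (h _).trans ?_⟩
  have := jap_sliceX_le α (a := 4) (b := 2) (by norm_num) (by norm_num) η t
  norm_num at this
  gcongr

theorem integrable_jap_two_real : Integrable (fun t : ℝ => jap (-2) t) :=
  integrable_jap volume (by norm_num)

theorem integrable_schwartz_sliceX (α : ℝ) (Ψ : 𝓢(E3, ℂ)) (η : E2) :
    Integrable fun t : ℝ => Ψ (sliceX α (η, t)) := by
  obtain ⟨C, hC, h⟩ := exists_sliceX_bound α Ψ
  refine ((integrable_jap_two_real.const_mul (jap (-4) η)).const_mul C).mono'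
    (Continuous.aestronglyMeasurable ?_) (Filter.Eventually.of_forall fun t => h η t)
  exact Ψ.continuous.comp (by fun_prop)

theorem continuous_sliceInt_schwartz (α : ℝ) (Ψ : 𝓢(E3, ℂ)) : Continuous (sliceInt α Ψ) := by
  obtain ⟨C, hC, h⟩ := exists_sliceX_bound α Ψ
  refine continuous_of_dominated (bound := fun t => C * (1 * jap (-2) t)) (fun η => ?_)
    (fun η => Filter.Eventually.of_forall fun t => (h η t).trans ?_)
    ((integrable_jap_two_real.const_mul 1).const_mul C)
    (Filter.Eventually.of_forall fun t => Ψ.continuous.comp (by fun_prop))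
  · exact (integrable_schwartz_sliceX α Ψ η).1
  · have h1 : jap (-4) η ≤ 1 := by simpa using jap_mono (by norm_num : (-4 : ℝ) ≤ 0) η
    have := jap_nonneg (-2) t
    gcongr

theorem integrable_sliceInt {α : ℝ} {G : E3 → ℂ} (hG : Integrable G) :
    Integrable (sliceInt α G) :=
  ((integrable_sliceX_iff α).mpr hG).integral_prod_left

/-- The Fourier transform of the restriction to `X`. -/
theorem fourier_restrictX (α : ℝ) (ψ : 𝓢(E3, ℂ)) (η : E2) :
    (𝓕 (restrictX α ψ) : 𝓢(E2, ℂ)) η = sliceInt α (𝓕 ψ : 𝓢(E3, ℂ)) η := by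
  have h1 : 𝓕⁻ (sliceInt α (𝓕 ψ : 𝓢(E3, ℂ))) = (restrictX α ψ : E2 → ℂ) := by
    funext x
    -- Fourier inversion on ℝ³ at a point of X: the phase does not depend on the normal frequency,
    -- so the normal integral falls on 𝓕 ψ alone.
    have e1 : restrictX α ψ x = (𝓕⁻ (𝓕 ψ : 𝓢(E3, ℂ)) : 𝓢(E3, ℂ)) (embX α x) := by
      rw [fourierInv_fourier_eq]; rfl
    rw [e1, SchwartzMap.fourierInv_coe, Real.fourierInv_eq, Real.fourierInv_eq,
      integral_sliceX α]
    · refine integral_congr_ae (Filter.Eventually.of_forall fun η => ?_)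
      simp only [inner_sliceX_embX]
      unfold sliceInt
      simp only [Circle.smul_def]
      rw [integral_smul]
    · simp only [Circle.smul_def, smul_eq_mul]
      refine (SchwartzMap.integrable (𝓕 ψ : 𝓢(E3, ℂ))).bdd_mul (c := 1) ?_
        (Filter.Eventually.of_forall fun ξ => (Circle.norm_coe _).le)
      exact Continuous.aestronglyMeasurable (by fun_prop)
  have h2 : 𝓕 (𝓕⁻ (sliceInt α (𝓕 ψ : 𝓢(E3, ℂ)))) = sliceInt α (𝓕 ψ : 𝓢(E3, ℂ)) := by
    refine Continuous.fourier_fourierInv_eq (continuous_sliceInt_schwartz α _)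
      (integrable_sliceInt (SchwartzMap.integrable _)) ?_
    -- Inverting back requires an integrable transform; it is the reflection of the Schwartz
    -- function ψ ∘ i.
    have h3 : (fun η => 𝓕⁻ (sliceInt α (𝓕 ψ : 𝓢(E3, ℂ))) (-η)) =
        𝓕 (sliceInt α (𝓕 ψ : 𝓢(E3, ℂ))) := by
      funext η; rw [Real.fourierInv_eq_fourier_neg, neg_neg]
    rw [← h3, h1]
    exact (restrictX α ψ).integrable.comp_neg
  rw [SchwartzMap.fourier_coe, ← h1, h2]

theorem fourierInv_schwartz_eq_neg {E : Type*} [NormedAddCommGroup E] [InnerProductSpace ℝ E]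
    [FiniteDimensional ℝ E] [MeasurableSpace E] [BorelSpace E] (ψ : 𝓢(E, ℂ)) (ξ : E) :
    (𝓕⁻ ψ : 𝓢(E, ℂ)) ξ = (𝓕 ψ : 𝓢(E, ℂ)) (-ξ) := by
  rw [SchwartzMap.fourierInv_coe, SchwartzMap.fourier_coe, Real.fourierInv_eq_fourier_neg]

theorem fourierInv_restrictX (α : ℝ) (ψ : 𝓢(E3, ℂ)) (η : E2) :
    (𝓕⁻ (restrictX α ψ) : 𝓢(E2, ℂ)) η = sliceInt α (𝓕⁻ ψ : 𝓢(E3, ℂ)) η := by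
  rw [fourierInv_schwartz_eq_neg, fourier_restrictX]
  unfold sliceInt
  rw [← integral_neg_eq_self]
  refine integral_congr_ae (Filter.Eventually.of_forall fun t => ?_)
  simp only
  rw [fourierInv_schwartz_eq_neg, ← sliceX_neg]
  rfl

theorem hat_ofSchwartz {E : Type*} [NormedAddCommGroup E] [InnerProductSpace ℝ E]
    [FiniteDimensional ℝ E] [MeasurableSpace E] [BorelSpace E] (s : ℝ) (ψ : 𝓢(E, ℂ)) :
    SobolevSpace.hat s (SobolevSpace.ofSchwartz s ψ) =ᵐ[volume]
      fun ξ => ((jap s ξ : ℝ) : ℂ) * (𝓕 ψ : 𝓢(E, ℂ)) ξ :=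
  SobolevSpace.hat_ae_eq (isGivenBy_fourier_coe_schwartz ψ)

/-- Under `hatEquiv` this is the density of Schwartz functions in L², as multiplication by ⟨ξ⟩^{-s}
preserves them. -/
theorem denseRange_ofSchwartz {E : Type*} [NormedAddCommGroup E] [InnerProductSpace ℝ E]
    [FiniteDimensional ℝ E] [MeasurableSpace E] [BorelSpace E] (s : ℝ) :
    DenseRange (SobolevSpace.ofSchwartz s : 𝓢(E, ℂ) → SobolevSpace E s) := by
  have h1 : DenseRange (SchwartzMap.toLpCLM ℂ ℂ 2 (volume : Measure E)) :=
    SchwartzMap.denseRange_toLpCLM (by simp)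
  have h2 : DenseRange fun ψ : 𝓢(E, ℂ) =>
      (SobolevSpace.hatEquiv (E := E) s).symm (SchwartzMap.toLpCLM ℂ ℂ 2 (volume : Measure E) ψ) :=
    (SobolevSpace.hatEquiv (E := E) s).symm.surjective.denseRange.comp h1
      (SobolevSpace.hatEquiv (E := E) s).symm.continuous
  refine h2.mono ?_
  rintro _ ⟨φ, rfl⟩
  refine ⟨𝓕⁻ (SchwartzMap.smulLeftCLM ℂ (fun x : E => ((jap (-s) x : ℝ) : ℂ)) φ), ?_⟩
  apply (SobolevSpace.hatEquiv (E := E) s).injective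
  simp only
  rw [LinearIsometryEquiv.apply_symm_apply]
  refine Lp.ext ((hat_ofSchwartz s _).trans ?_)
  filter_upwards [SchwartzMap.coeFn_toLp φ 2 (volume : Measure E)] with x hx
  rw [SchwartzMap.toLpCLM_apply, hx, fourier_fourierInv_eq,
    SchwartzMap.smulLeftCLM_apply_apply (hasTemperateGrowth_jap _), smul_eq_mul, ← mul_assoc,
    ← Complex.ofReal_mul, jap_mul_neg]
  simp

/-- The graph of the boundary operator on the Fourier side. -/
theorem exists_boundaryCLM (α : ℝ) {t r : ℝ} (ht : 1 / 2 < t) (hr : r = t - 1 / 2) :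
    ∃ B : SobolevSpace E3 t →L[ℂ] SobolevSpace E2 r,
      (∀ P, P ∈ boundaryGraph α t r ↔ P.2 = B P.1) ∧
      ∀ u, SobolevSpace.hat r (B u) =ᵐ[volume] fun η => ((jap r η : ℝ) : ℂ) *
        sliceInt α (fun ξ => ((jap (-t) ξ : ℝ) : ℂ) * SobolevSpace.hat t u ξ) η := by
  subst hr
  obtain ⟨T, hT⟩ := exists_traceCLM α ht
  set r := t - 1 / 2
  let B : SobolevSpace E3 t →L[ℂ] SobolevSpace E2 r :=
    ((SobolevSpace.hatEquiv (E := E2) r).symm.toContinuousLinearEquiv : _ →L[ℂ] _) ∘L T ∘L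
      ((SobolevSpace.hatEquiv (E := E3) t).toContinuousLinearEquiv : _ →L[ℂ] _)
  have hB : ∀ u, SobolevSpace.hat r (B u) = T (SobolevSpace.hat t u) := fun u =>
    (SobolevSpace.hatEquiv (E := E2) r).apply_symm_apply _
  have hBψ : ∀ ψ : 𝓢(E3, ℂ), SobolevSpace.ofSchwartz r (restrictX α ψ) =
      B (SobolevSpace.ofSchwartz t ψ) := by
    intro ψ
    apply (SobolevSpace.hatEquiv (E := E2) r).injective
    rw [SobolevSpace.hatEquiv_apply, SobolevSpace.hatEquiv_apply, hB]
    refine Lp.ext ?_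
    filter_upwards [hT (SobolevSpace.hat t (SobolevSpace.ofSchwartz t ψ)),
      hat_ofSchwartz r (restrictX α ψ), ae_sliceX α (hat_ofSchwartz t ψ)] with η h1 h2 h3
    rw [h1, h2, fourier_restrictX]
    congr 1
    unfold sliceInt
    refine integral_congr_ae ?_
    filter_upwards [h3] with τ h4
    rw [h4, ← mul_assoc, ← Complex.ofReal_mul, jap_neg_mul]; simp
  -- The graph of B is closed and contains the generating pairs; conversely, density of Schwartz
  -- functions puts every point of the graph in their closure.
  refine ⟨B, fun P => ⟨fun hP => ?_, fun hP => ?_⟩, fun u => ?_⟩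
  · have hcl : IsClosed {P : SobolevSpace E3 t × SobolevSpace E2 r | P.2 = B P.1} :=
      isClosed_eq continuous_snd (B.continuous.comp continuous_fst)
    refine closure_minimal ?_ hcl hP
    rintro _ ⟨ψ, rfl⟩
    exact hBψ ψ
  · have hc : Continuous fun u : SobolevSpace E3 t => (u, B u) := by fun_prop
    have h1 := image_closure_subset_closure_image (s := Set.range (SobolevSpace.ofSchwartz
      (E := E3) t)) hc
    have h2 : P ∈ (fun u : SobolevSpace E3 t => (u, B u)) ''
        closure (Set.range (SobolevSpace.ofSchwartz (E := E3) t)) :=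
      ⟨P.1, denseRange_ofSchwartz t P.1, Prod.ext rfl hP.symm⟩
    refine closure_mono ?_ (h1 h2)
    rintro _ ⟨_, ⟨ψ, rfl⟩, rfl⟩
    exact ⟨ψ, Prod.ext rfl (hBψ ψ)⟩
  · rw [hB]; exact hT _

end Restriction

/-! ### Sobolev bounds for convolution with a Schwartz function. -/

section Convolution

open scoped ENNReal

variable {E : Type*} [NormedAddCommGroup E] [InnerProductSpace ℝ E] [FiniteDimensional ℝ E]
  [MeasurableSpace E] [BorelSpace E]

/-- The kernel of multiplication by a function with the Fourier transform `a` in `H^s`. -/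
def sobolevKernel (s : ℝ) (a : E → ℂ) (ξ ξ' : E) : ℂ :=
  ((jap s ξ * jap (-s) ξ' : ℝ) : ℂ) * a (ξ - ξ')

/-- By Peetre's inequality the weights cost only ⟨ξ - ξ'⟩^{|s|}, so the kernel is dominated by an
integrable convolution kernel. -/
theorem kerBound_sobolevKernel (s : ℝ) (a : 𝓢(E, ℂ)) :
    ∃ C : ℝ≥0∞, C ≠ ⊤ ∧ KerBound volume (sobolevKernel s a) C := by
  set d : ℝ := Module.finrank ℝ E + 1
  obtain ⟨D, hD, ha⟩ := schwartz_decay a (|s| + d)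
  set J := ∫⁻ ξ : E, ENNReal.ofReal (2 ^ (|s| / 2) * D * jap (-d) ξ)
  have hJ : J ≠ ⊤ :=
    ((integrable_jap volume (by simp [d])).const_mul (2 ^ (|s| / 2) * D)).lintegral_lt_top.ne
  have hm : Measurable (Function.uncurry (sobolevKernel s a)) := by
    have : Measurable (a : E → ℂ) := a.continuous.measurable
    unfold sobolevKernel Function.uncurry
    fun_prop
  have hb : ∀ ξ ξ', ‖sobolevKernel s a ξ ξ'‖ₑ ≤
      ENNReal.ofReal (2 ^ (|s| / 2) * D * jap (-d) (ξ - ξ')) := by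
    intro ξ ξ'
    have j1 := jap_nonneg s ξ
    have j2 := jap_nonneg (-s) ξ'
    rw [← ofReal_norm]
    refine ENNReal.ofReal_le_ofReal ?_
    unfold sobolevKernel
    rw [norm_mul, Complex.norm_real, Real.norm_of_nonneg (by positivity)]
    have e1 : jap |s| (ξ - ξ') * jap (-(|s| + d)) (ξ - ξ') = jap (-d) (ξ - ξ') := by
      rw [jap_mul]; ring_nf
    have e2 : jap s ξ' * jap (-s) ξ' = 1 := jap_mul_neg s ξ'
    have j3 := jap_nonneg s ξ'
    have j4 := jap_nonneg |s| (ξ - ξ')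
    calc jap s ξ * jap (-s) ξ' * ‖a (ξ - ξ')‖
        ≤ (2 ^ (|s| / 2) * (jap s ξ' * jap |s| (ξ - ξ'))) * jap (-s) ξ' *
          (D * jap (-(|s| + d)) (ξ - ξ')) := by
          have := jap_peetre s ξ ξ'
          have := ha (ξ - ξ')
          gcongr
      _ = 2 ^ (|s| / 2) * D * ((jap s ξ' * jap (-s) ξ') *
          (jap |s| (ξ - ξ') * jap (-(|s| + d)) (ξ - ξ'))) := by ring
      _ = _ := by rw [e1, e2, one_mul]
  refine ⟨J * J, ENNReal.mul_ne_top hJ hJ, KerBound.of_schur hm measurable_one measurable_one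
    (by simp) (by simp) (Filter.Eventually.of_forall fun ξ => ?_)
    (Filter.Eventually.of_forall fun ξ' => ?_)⟩
  · simp only [Pi.one_apply, mul_one]
    refine (lintegral_mono fun ξ' => hb ξ ξ').trans (le_of_eq ?_)
    exact lintegral_sub_left_eq_self
      (fun x => ENNReal.ofReal (2 ^ (|s| / 2) * D * jap (-d) x)) ξ
  · simp only [Pi.one_apply, mul_one]
    refine (lintegral_mono fun ξ => hb ξ ξ').trans (le_of_eq ?_)
    exact lintegral_sub_right_eq_self
      (fun x => ENNReal.ofReal (2 ^ (|s| / 2) * D * jap (-d) x)) ξ'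

theorem memLp_jap_convFun {s : ℝ} (a : 𝓢(E, ℂ)) {G : E → ℂ}
    (hG : MemLp (fun ξ => ((jap s ξ : ℝ) : ℂ) * G ξ) 2 volume) :
    MemLp (fun ξ => ((jap s ξ : ℝ) : ℂ) * convFun a G ξ) 2 volume := by
  obtain ⟨C, hC, h⟩ := kerBound_sobolevKernel s a
  refine (h.memLp hC hG).ae_eq (Filter.Eventually.of_forall fun ξ => ?_)
  simp only [convFun]
  rw [← integral_const_mul]
  refine integral_congr_ae (Filter.Eventually.of_forall fun ξ' => ?_)
  have e : ((jap (-s) ξ' : ℝ) : ℂ) * ((jap s ξ' : ℝ) : ℂ) = 1 := by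
    rw [← Complex.ofReal_mul, jap_neg_mul]; simp
  simp only [sobolevKernel]
  push_cast
  linear_combination (((jap s ξ : ℝ) : ℂ) * a (ξ - ξ') * G ξ') * e

theorem memLp_two_of_norm_le_jap {s : ℝ} (hs : (Module.finrank ℝ E : ℝ) < 2 * s) {C : ℝ} {f : E → ℂ}
    (hf : AEStronglyMeasurable f volume) (h : ∀ x, ‖f x‖ ≤ C * jap (-s) x) : MemLp f 2 volume := by
  have h1 : Integrable (fun x : E => C ^ 2 * jap (-(2 * s)) x) :=
    (integrable_jap volume (by linarith)).const_mul _
  refine (memLp_two_iff_lintegral hf).mpr (lt_of_le_of_lt (lintegral_mono fun x => ?_)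
    h1.lintegral_lt_top)
  rw [← ofReal_norm, ← ENNReal.ofReal_pow (norm_nonneg _)]
  refine ENNReal.ofReal_le_ofReal ((pow_le_pow_left₀ (norm_nonneg _) (h x) 2).trans (le_of_eq ?_))
  rw [mul_pow, jap_sq]; ring_nf

theorem convFun_decay (a : 𝓢(E, ℂ)) {G : E → ℂ}
    {N : ℝ} (hN : 0 ≤ N) (hG : Integrable (fun ξ => ((jap N ξ : ℝ) : ℂ) * G ξ)) :
    ∃ C : ℝ, ∀ ξ, ‖convFun a G ξ‖ ≤ C * jap (-N) ξ := by
  obtain ⟨D, hD, ha⟩ := schwartz_decay a N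
  refine ⟨2 ^ (N / 2) * D * ∫ ξ, ‖((jap N ξ : ℝ) : ℂ) * G ξ‖, fun ξ => ?_⟩
  rw [mul_right_comm, ← integral_const_mul]
  refine norm_integral_le_of_norm_le (hG.norm.const_mul _) (Filter.Eventually.of_forall fun ξ' => ?_)
  rw [norm_mul, norm_mul, Complex.norm_real, Real.norm_of_nonneg (jap_nonneg _ _)]
  have h1 := jap_peetre (-N) (ξ - ξ') ξ
  have e : jap |(-N)| (ξ - ξ' - ξ) = jap N ξ' := by
    rw [abs_neg, abs_of_nonneg hN]; unfold jap; congr 3; simp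
  rw [e, abs_neg, abs_of_nonneg hN] at h1
  calc ‖a (ξ - ξ')‖ * ‖G ξ'‖ ≤ (D * (2 ^ (N / 2) * (jap (-N) ξ * jap N ξ'))) * ‖G ξ'‖ := by
        gcongr
        exact (ha _).trans (by gcongr)
    _ = _ := by ring

/-- Meant for the low frequencies, where 1/|ξ|² leaves only integrability and no L² bound;
convolution with a turns integrability against all powers of the bracket into pointwise decay of
every order. -/
theorem memLp_jap_convFun_of_decay {s : ℝ} (a : 𝓢(E, ℂ)) {G : E → ℂ}
    (hG : ∀ N : ℝ, 0 ≤ N → Integrable (fun ξ => ((jap N ξ : ℝ) : ℂ) * G ξ)) :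
    MemLp (fun ξ => ((jap s ξ : ℝ) : ℂ) * convFun a G ξ) 2 volume := by
  set N : ℝ := max 0 (s + (Module.finrank ℝ E + 1))
  obtain ⟨C, hC⟩ := convFun_decay a (le_max_left _ _) (hG N (le_max_left _ _))
  have hGi : Integrable G := by simpa using hG 0 le_rfl
  have hm : AEStronglyMeasurable (convFun a G) volume := by
    obtain ⟨K, hK⟩ := (Integrable.polyInt hGi).convFun a
    have h1 : AEStronglyMeasurable (fun x : E => ((jap K x : ℝ) : ℂ) *
      (((jap (-K) x : ℝ) : ℂ) * convFun a G x)) volume :=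
      AEStronglyMeasurable.mul (by fun_prop) hK.1
    refine h1.congr (Filter.Eventually.of_forall fun x => ?_)
    simp only
    rw [← mul_assoc, ← Complex.ofReal_mul, jap_mul_neg]; simp
  refine memLp_two_of_norm_le_jap (s := Module.finrank ℝ E + 1) (C := C) (by
    have : (0 : ℝ) ≤ Module.finrank ℝ E := by positivity
    linarith) (AEStronglyMeasurable.mul (by fun_prop) hm) fun ξ => ?_
  rw [norm_mul, Complex.norm_real, Real.norm_of_nonneg (jap_nonneg _ _)]
  have hC0 : 0 ≤ C := by
    have h1 := (norm_nonneg _).trans (hC ξ)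
    exact nonneg_of_mul_nonneg_left h1 (jap_pos _ _)
  calc jap s ξ * ‖convFun a G ξ‖ ≤ jap s ξ * (C * jap (-N) ξ) := by
        gcongr
        · exact jap_nonneg _ _
        · exact hC ξ
    _ = C * jap (s - N) ξ := by rw [sub_eq_add_neg, ← jap_mul]; ring
    _ ≤ _ := by
        gcongr
        refine jap_mono ?_ ξ
        have : s + (Module.finrank ℝ E + 1) ≤ N := le_max_right _ _
        linarith

theorem convFun_add {a : 𝓢(E, ℂ)} {G G' : E → ℂ} (hG : PolyInt G) (hG' : PolyInt G') (ξ : E) :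
    convFun a (fun x => G x + G' x) ξ = convFun a G ξ + convFun a G' ξ := by
  have hd : ∀ N : ℝ, ∃ C : ℝ, ∀ y, ‖a (ξ - y)‖ ≤ C * jap (-N) y := by
    intro N
    obtain ⟨D, hD, ha⟩ := schwartz_decay a |N|
    refine ⟨D * (2 ^ (|N| / 2) * jap |N| ξ), fun y => (ha _).trans ?_⟩
    have h1 := jap_peetre (-|N|) (ξ - y) (-y)
    have e : jap |(-|N|)| (ξ - y - -y) = jap |N| ξ := by
      rw [abs_neg, abs_abs]; congr 1; abel
    have e' : jap (-|N|) (-y) = jap (-|N|) y := by unfold jap; rw [norm_neg]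
    rw [e, e', abs_neg, abs_abs] at h1
    have h2 : jap (-|N|) y ≤ jap (-N) y := jap_mono (by linarith [le_abs_self N]) y
    have := jap_nonneg |N| ξ
    calc D * jap (-|N|) (ξ - y) ≤ D * (2 ^ (|N| / 2) * (jap (-|N|) y * jap |N| ξ)) := by gcongr
      _ ≤ D * (2 ^ (|N| / 2) * (jap (-N) y * jap |N| ξ)) := by gcongr
      _ = _ := by ring
  have hm : AEStronglyMeasurable (fun y => a (ξ - y)) volume :=
    (a.continuous.comp (by fun_prop)).aestronglyMeasurable
  unfold convFun
  rw [← integral_add (hG.integrable_mul_of_decay hm hd) (hG'.integrable_mul_of_decay hm hd)]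
  simp only [mul_add]

end Convolution

/-! ### Slice integration commutes with multiplication by cut-offs. -/

section SliceConvolution

/-- Functions which are integrable over `ℝ³` with a polynomial weight in the tangential
coordinates. -/
def SlicePolyInt (α : ℝ) (G : E3 → ℂ) : Prop :=
  ∃ N : ℝ, 0 ≤ N ∧ Integrable (fun ξ => ((jap (-N) (projX α ξ) : ℝ) : ℂ) * G ξ)

theorem sliceX_projX (α : ℝ) (ξ : E3) :
    sliceX α (projX α ξ, ξ 2 * Real.cos α - ξ 0 * Real.sin α) = ξ := by
  have h := Real.sin_sq_add_cos_sq α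
  rw [sliceX_apply]
  unfold projX
  ext j; fin_cases j
  · simp; linear_combination ξ 0 * h
  · simp
  · simp; linear_combination ξ 2 * h

theorem norm_projX_le (α : ℝ) (ξ : E3) : ‖projX α ξ‖ ≤ ‖ξ‖ := by
  have h := norm_sq_sliceX α (projX α ξ, ξ 2 * Real.cos α - ξ 0 * Real.sin α)
  rw [sliceX_projX] at h
  simp only at h
  refine abs_le_of_sq_le_sq' ?_ (norm_nonneg _) |>.2
  nlinarith [sq_nonneg (ξ 2 * Real.cos α - ξ 0 * Real.sin α)]

theorem SlicePolyInt.aestronglyMeasurable {α : ℝ} {G : E3 → ℂ} (h : SlicePolyInt α G) :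
    AEStronglyMeasurable G volume := by
  obtain ⟨N, -, hN⟩ := h
  have h1 : AEStronglyMeasurable (fun ξ : E3 => ((jap N (projX α ξ) : ℝ) : ℂ) *
      (((jap (-N) (projX α ξ) : ℝ) : ℂ) * G ξ)) volume :=
    AEStronglyMeasurable.mul (by fun_prop) hN.1
  refine h1.congr (Filter.Eventually.of_forall fun x => ?_)
  simp only
  rw [← mul_assoc, ← Complex.ofReal_mul, jap_mul_neg]; simp

theorem SlicePolyInt.polyInt {α : ℝ} {G : E3 → ℂ} (h : SlicePolyInt α G) : PolyInt G := by
  have hm := h.aestronglyMeasurable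
  obtain ⟨N, hN0, hN⟩ := h
  refine ⟨N, hN.mono (AEStronglyMeasurable.mul (by fun_prop) hm)
    (Filter.Eventually.of_forall fun ξ => ?_)⟩
  rw [norm_mul, norm_mul, Complex.norm_real, Complex.norm_real,
    Real.norm_of_nonneg (jap_nonneg _ _), Real.norm_of_nonneg (jap_nonneg _ _)]
  gcongr
  unfold jap
  refine Real.rpow_le_rpow_of_nonpos (by positivity) ?_ (by linarith)
  have := norm_projX_le α ξ
  gcongr

theorem SlicePolyInt.polyInt_sliceInt {α : ℝ} {G : E3 → ℂ} (h : SlicePolyInt α G) :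
    PolyInt (sliceInt α G) := by
  obtain ⟨N, hN0, hN⟩ := h
  refine ⟨N, (integrable_sliceInt (α := α) hN).congr (Filter.Eventually.of_forall fun η => ?_)⟩
  unfold sliceInt
  simp only [projX_sliceX]
  rw [integral_const_mul]

/-- Subtracting ξ shifts the tangential coordinate by `projX α ξ` and the normal one by a constant,
which the integral over t absorbs. -/
theorem integral_sub_sliceX (α : ℝ) (K : 𝓢(E3, ℂ)) (η : E2) (ξ : E3) :
    ∫ t : ℝ, (𝓕 K : 𝓢(E3, ℂ)) (sliceX α (η, t) - ξ) =
      (𝓕 (restrictX α K) : 𝓢(E2, ℂ)) (η - projX α ξ) := by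
  rw [fourier_restrictX]
  unfold sliceInt
  set τ := ξ 2 * Real.cos α - ξ 0 * Real.sin α with hτ
  rw [← integral_sub_right_eq_self (fun t : ℝ =>
    (𝓕 K : 𝓢(E3, ℂ)) (sliceX α (η - projX α ξ, t))) τ]
  refine integral_congr_ae (Filter.Eventually.of_forall fun t => ?_)
  have e : ((η - projX α ξ, t - τ) : E2 × ℝ) = (η, t) - (projX α ξ, τ) := rfl
  simp only
  rw [e, sliceX_sub, hτ, sliceX_projX]

/-- Of the N + 2 powers of decay of a, N pay for the tangential weight of G and 2 make the normal
variable integrable. This justifies Fubini in `sliceInt_convFun`. -/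
theorem integrable_slice_prod {α : ℝ} (a : 𝓢(E3, ℂ)) {G : E3 → ℂ} (hG : SlicePolyInt α G)
    (η : E2) : Integrable (fun p : ℝ × E3 => a (sliceX α (η, p.1) - p.2) * G p.2)
      (volume.prod volume) := by
  have hm := hG.aestronglyMeasurable
  obtain ⟨N, hN0, hN⟩ := hG
  obtain ⟨D, hD, ha⟩ := schwartz_decay a (N + 2)
  have hmp : AEStronglyMeasurable (fun p : ℝ × E3 => a (sliceX α (η, p.1) - p.2) * G p.2)
      (volume.prod volume) := by
    refine AEStronglyMeasurable.mul ?_ hm.comp_snd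
    exact (a.continuous.comp (by fun_prop)).aestronglyMeasurable
  have hb : ∀ t ξ, ‖a (sliceX α (η, t) - ξ) * G ξ‖ ≤ D * (jap (-N) (η - projX α ξ) *
      jap (-2) (t - (ξ 2 * Real.cos α - ξ 0 * Real.sin α))) * ‖G ξ‖ := by
    intro t ξ
    rw [norm_mul]
    gcongr
    refine (ha _).trans ?_
    gcongr
    have e : sliceX α (η, t) - ξ = sliceX α (η - projX α ξ,
        t - (ξ 2 * Real.cos α - ξ 0 * Real.sin α)) := by
      conv_lhs => rw [← sliceX_projX α ξ]
      rw [← sliceX_sub]; rfl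
    rw [e]
    exact jap_sliceX_le α hN0 (by norm_num) _ _
  have hmaj : Integrable (fun p : ℝ × E3 => D * (jap (-N) (η - projX α p.2) *
      jap (-2) (p.1 - (p.2 2 * Real.cos α - p.2 0 * Real.sin α))) * ‖G p.2‖)
      (volume.prod volume) := by
    have hmm : AEStronglyMeasurable (fun p : ℝ × E3 => D * (jap (-N) (η - projX α p.2) *
      jap (-2) (p.1 - (p.2 2 * Real.cos α - p.2 0 * Real.sin α))) * ‖G p.2‖)
      (volume.prod volume) :=
      AEStronglyMeasurable.mul (by fun_prop) hm.norm.comp_snd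
    refine (integrable_prod_iff' hmm).mpr ⟨Filter.Eventually.of_forall fun ξ => ?_, ?_⟩
    · have h := (((integrable_jap_two_real.comp_sub_right
        (ξ 2 * Real.cos α - ξ 0 * Real.sin α)).const_mul
        (jap (-N) (η - projX α ξ))).const_mul D).mul_const ‖G ξ‖
      exact h
    · have e : ∀ ξ : E3, ∫ t : ℝ, ‖D * (jap (-N) (η - projX α ξ) *
          jap (-2) (t - (ξ 2 * Real.cos α - ξ 0 * Real.sin α))) * ‖G ξ‖‖ =
          D * (∫ t : ℝ, jap (-2) t) * jap (-N) (η - projX α ξ) * ‖G ξ‖ := by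
        intro ξ
        have e1 : ∀ t : ℝ, ‖D * (jap (-N) (η - projX α ξ) *
          jap (-2) (t - (ξ 2 * Real.cos α - ξ 0 * Real.sin α))) * ‖G ξ‖‖ =
          (D * jap (-N) (η - projX α ξ) * ‖G ξ‖) *
            jap (-2) (t - (ξ 2 * Real.cos α - ξ 0 * Real.sin α)) := by
          intro t
          have j1 := jap_nonneg (-N) (η - projX α ξ)
          have j2 := jap_nonneg (-2) (t - (ξ 2 * Real.cos α - ξ 0 * Real.sin α))
          rw [Real.norm_of_nonneg (by positivity)]; ring
        simp only [e1]
        rw [integral_const_mul, integral_sub_right_eq_self (fun t : ℝ => jap (-2) t)]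
        ring
      simp only [e]
      refine (hN.norm.const_mul (D * (∫ t : ℝ, jap (-2) t) * (2 ^ (N / 2) * jap N η))).mono'
        (AEStronglyMeasurable.mul (by fun_prop) hm.norm) (Filter.Eventually.of_forall fun ξ => ?_)
      have hI : 0 ≤ ∫ t : ℝ, jap (-2) t := integral_nonneg fun t => jap_nonneg _ _
      have j1 := jap_nonneg (-N) (η - projX α ξ)
      have h1 := jap_peetre (-N) (η - projX α ξ) (-projX α ξ)
      have e2 : jap |(-N)| (η - projX α ξ - -projX α ξ) = jap N η := by
        rw [abs_neg, abs_of_nonneg hN0]; congr 1; abel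
      have e3 : jap (-N) (-projX α ξ) = jap (-N) (projX α ξ) := by unfold jap; rw [norm_neg]
      rw [e2, e3, abs_neg, abs_of_nonneg hN0] at h1
      rw [Real.norm_of_nonneg (by positivity), norm_mul, Complex.norm_real,
        Real.norm_of_nonneg (jap_nonneg _ _)]
      calc _ ≤ D * (∫ t : ℝ, jap (-2) t) * (2 ^ (N / 2) * (jap (-N) (projX α ξ) * jap N η)) *
            ‖G ξ‖ := by gcongr
        _ = _ := by ring
  exact hmaj.mono' hmp (Filter.Eventually.of_forall fun p => hb p.1 p.2)

/-- The slices of a product with `K` are the convolutions of the slices. -/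
theorem sliceInt_convFun {α : ℝ} (K : 𝓢(E3, ℂ)) {G : E3 → ℂ} (hG : SlicePolyInt α G) (η : E2) :
    sliceInt α (convFun (𝓕 K : 𝓢(E3, ℂ)) G) η =
      convFun (𝓕 (restrictX α K) : 𝓢(E2, ℂ)) (sliceInt α G) η := by
  have hI := integrable_slice_prod (𝓕 K : 𝓢(E3, ℂ)) hG η
  have e1 : ∀ ξ, ∫ t : ℝ, (𝓕 K : 𝓢(E3, ℂ)) (sliceX α (η, t) - ξ) * G ξ =
      (𝓕 (restrictX α K) : 𝓢(E2, ℂ)) (η - projX α ξ) * G ξ := fun ξ => by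
    rw [integral_mul_const, integral_sub_sliceX]
  have hI2 := hI.integral_prod_right
  simp only [e1] at hI2
  unfold sliceInt convFun
  rw [integral_integral_swap hI]
  simp only [e1]
  rw [integral_sliceX α hI2]
  refine integral_congr_ae (Filter.Eventually.of_forall fun η' => ?_)
  simp only [projX_sliceX]
  rw [integral_const_mul]

end SliceConvolution

/-! ### The averaged coboundary of a distribution on the Fourier side -/

theorem PolyInt.comp_projX {F : E2 → ℂ} (hF : PolyInt F) (α : ℝ) :
    PolyInt fun ξ => F (projX α ξ) := by
  obtain ⟨N₀, hN₀⟩ := hF.mono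
  set N := max N₀ 0
  have h1 := hN₀ N (le_max_left _ _)
  -- The function is constant in the normal direction; two further powers of the bracket make that
  -- direction integrable.
  refine ⟨N + 2, (integrable_sliceX_iff α).mp ?_⟩
  have hmaj := (h1.mul_prod (integrable_jap_two_real.ofReal (𝕜 := ℂ)))
  refine hmaj.mono ?_ (Filter.Eventually.of_forall fun p => ?_)
  · have hm : AEStronglyMeasurable F volume := by
      have h2 : AEStronglyMeasurable (fun x : E2 => ((jap N x : ℝ) : ℂ) *
          (((jap (-N) x : ℝ) : ℂ) * F x)) volume :=
        AEStronglyMeasurable.mul (by fun_prop) h1.1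
      refine h2.congr (Filter.Eventually.of_forall fun x => ?_)
      simp only
      rw [← mul_assoc, ← Complex.ofReal_mul, jap_mul_neg]; simp
    simp only [projX_sliceX]
    exact AEStronglyMeasurable.mul (by fun_prop) hm.comp_fst
  · have h2 := jap_sliceX_le α (le_max_right N₀ 0) (zero_le_two (α := ℝ)) p.1 p.2
    simp only [norm_mul, projX_sliceX, Complex.norm_real, Real.norm_of_nonneg (jap_nonneg _ _),
      RCLike.ofReal_eq_complex_ofReal]
    calc _ ≤ (jap (-N) p.1 * jap (-2) p.2) * ‖F p.1‖ := by gcongr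
      _ = _ := by ring

/-- Dual to `fourier_restrictX`: since restriction integrates Fourier transforms along normal lines,
i_* extends them as constants along these lines. -/
theorem coboundary_apply_eq (α : ℝ) {f : 𝓢'(E2, ℂ)} {F : E2 → ℂ} (hf : IsGivenBy (𝓕 f) F)
    (hF : PolyInt F) (ψ : 𝓢(E3, ℂ)) :
    coboundary α f ψ = ∫ ξ, (𝓕⁻ ψ : 𝓢(E3, ℂ)) ξ * F (projX α ξ) := by
  have h1 : coboundary α f ψ = f (restrictX α ψ) := rfl
  rw [h1, hf.apply_eq, integral_sliceX α ((hF.comp_projX α).integrable_schwartz_mul _)]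
  refine integral_congr_ae (Filter.Eventually.of_forall fun η => ?_)
  simp only [projX_sliceX]
  rw [integral_mul_const, fourierInv_restrictX]; rfl

theorem fourierInv_comp_rotZ (θ : ℝ) (ψ : 𝓢(E3, ℂ)) (ξ : E3) :
    (𝓕⁻ (SchwartzMap.compCLMOfContinuousLinearEquiv ℂ (rotZ θ) ψ) : 𝓢(E3, ℂ)) ξ =
      (𝓕⁻ ψ : 𝓢(E3, ℂ)) (rotZ θ ξ) := by
  rw [SchwartzMap.fourierInv_coe, SchwartzMap.fourierInv_coe, ← rotZIso_apply,
    ← Real.fourierInv_comp_linearIsometry]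
  rfl

theorem shiftOp_apply_eq {U : 𝓢'(E3, ℂ)} {Φ : E3 → ℂ}
    (hU : ∀ ψ : 𝓢(E3, ℂ), U ψ = ∫ ξ, (𝓕⁻ ψ : 𝓢(E3, ℂ)) ξ * Φ ξ) (θ : ℝ) (ψ : 𝓢(E3, ℂ)) :
    shiftOp θ U ψ = ∫ ξ, (𝓕⁻ ψ : 𝓢(E3, ℂ)) ξ * Φ (rotZ θ ξ) := by
  have h1 : shiftOp θ U ψ =
      U (SchwartzMap.compCLMOfContinuousLinearEquiv ℂ (rotZ (-θ)) ψ) := rfl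
  rw [h1, hU, ← (measurePreserving_rotZ θ).integral_comp
    (rotZ θ).toHomeomorph.measurableEmbedding]
  simp only [fourierInv_comp_rotZ, rotZ_neg_apply]

/-- The average of `F ∘ projX` over the rotations. -/
def rotInt (α : ℝ) (F : E2 → ℂ) (ξ : E3) : ℂ :=
  ∫ θ in Set.Ioo 0 (2 * Real.pi), F (projX α (rotZ θ ξ))

theorem measurable_projX_rotZ (α : ℝ) :
    Measurable fun p : ℝ × E3 => projX α (rotZ p.1 p.2) :=
  ((continuous_projX α).comp continuous_rotZ_uncurry).measurable

theorem jap_rotZ (s θ : ℝ) (ξ : E3) : jap s (rotZ θ ξ) = jap s ξ := by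
  unfold jap; rw [norm_rotZ]

/-- The weight is radial and rotations preserve volume, so the inner integral does not depend on θ.
-/
theorem PolyInt.integrable_rot {F : E2 → ℂ} (hF : PolyInt F) (hFm : Measurable F) (α : ℝ) :
    ∃ N₀ : ℝ, ∀ N, N₀ ≤ N → Integrable
      (fun p : ℝ × E3 => ((jap (-N) p.2 : ℝ) : ℂ) * F (projX α (rotZ p.1 p.2)))
      ((volume.restrict (Set.Ioo 0 (2 * Real.pi))).prod volume) := by
  obtain ⟨N₀, h⟩ := (hF.comp_projX α).mono
  refine ⟨N₀, fun N hN => ?_⟩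
  have h1 := h N hN
  have e : ∀ θ : ℝ, (fun ξ : E3 => ((jap (-N) ξ : ℝ) : ℂ) * F (projX α (rotZ θ ξ))) =
      (fun ξ => ((jap (-N) ξ : ℝ) : ℂ) * F (projX α ξ)) ∘ rotZ θ := by
    intro θ; ext ξ; simp only [Function.comp, jap_rotZ]
  refine (integrable_prod_iff ?_).mpr ⟨Filter.Eventually.of_forall fun θ => ?_, ?_⟩
  · refine Measurable.aestronglyMeasurable ?_
    exact (by fun_prop : Measurable fun p : ℝ × E3 => ((jap (-N) p.2 : ℝ) : ℂ)).mul
      (hFm.comp (measurable_projX_rotZ α))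
  · simp only
    rw [e]
    exact ((measurePreserving_rotZ θ).integrable_comp_emb
      (rotZ θ).toHomeomorph.measurableEmbedding).mpr h1
  · have e2 : ∀ θ : ℝ, ∫ ξ : E3, ‖((jap (-N) ξ : ℝ) : ℂ) * F (projX α (rotZ θ ξ))‖ =
        ∫ ξ : E3, ‖((jap (-N) ξ : ℝ) : ℂ) * F (projX α ξ)‖ := by
      intro θ
      have h3 := (measurePreserving_rotZ θ).integral_comp
        (rotZ θ).toHomeomorph.measurableEmbedding
        (fun ξ => ‖((jap (-N) ξ : ℝ) : ℂ) * F (projX α ξ)‖)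
      rw [← h3]
      simp only [jap_rotZ]
    simp only [e2]
    exact integrable_const _

theorem measurable_rotInt {F : E2 → ℂ} (hFm : Measurable F) (α : ℝ) : Measurable (rotInt α F) := by
  have h : StronglyMeasurable fun p : E3 × ℝ => F (projX α (rotZ p.2 p.1)) :=
    (hFm.comp ((measurable_projX_rotZ α).comp measurable_swap)).stronglyMeasurable
  exact (h.integral_prod_right (ν := volume.restrict (Set.Ioo 0 (2 * Real.pi)))).measurable

theorem PolyInt.rotInt {F : E2 → ℂ} (hF : PolyInt F) (hFm : Measurable F) (α : ℝ) :
    PolyInt (rotInt α F) := by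
  obtain ⟨N, h⟩ := hF.integrable_rot hFm α
  refine ⟨N, (h N le_rfl).integral_prod_right.congr (Filter.Eventually.of_forall fun ξ => ?_)⟩
  simp only
  rw [integral_const_mul]; rfl

theorem PolyInt.integrable_schwartz_rot {F : E2 → ℂ} (hF : PolyInt F) (hFm : Measurable F) (α : ℝ)
    (Ψ : 𝓢(E3, ℂ)) : Integrable (fun p : ℝ × E3 => Ψ p.2 * F (projX α (rotZ p.1 p.2)))
      ((volume.restrict (Set.Ioo 0 (2 * Real.pi))).prod volume) := by
  obtain ⟨N, h⟩ := hF.integrable_rot hFm α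
  obtain ⟨D, hD, hΨ⟩ := schwartz_decay Ψ N
  refine ((h N le_rfl).norm.const_mul D).mono' ?_ (Filter.Eventually.of_forall fun p => ?_)
  · exact ((Ψ.continuous.measurable.comp measurable_snd).mul
      (hFm.comp (measurable_projX_rotZ α))).aestronglyMeasurable
  · rw [norm_mul, norm_mul, Complex.norm_real, Real.norm_of_nonneg (jap_nonneg _ _), ← mul_assoc]
    gcongr
    exact hΨ _

theorem isRotationIntegral_of_isGivenBy {α : ℝ} {f : 𝓢'(E2, ℂ)} {F : E2 → ℂ}
    (hf : IsGivenBy (𝓕 f) F) (hF : PolyInt F) (hFm : Measurable F) {W : 𝓢'(E3, ℂ)}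
    (hW : IsGivenBy (𝓕 W) (rotInt α F)) : IsRotationIntegral (coboundary α f) W := by
  intro ψ
  have h1 := hF.integrable_schwartz_rot hFm α (𝓕⁻ ψ)
  have h2 : ∀ θ, shiftOp θ (coboundary α f) ψ =
      ∫ ξ, (𝓕⁻ ψ : 𝓢(E3, ℂ)) ξ * F (projX α (rotZ θ ξ)) :=
    fun θ => shiftOp_apply_eq (coboundary_apply_eq α hf hF) θ ψ
  have hpi : (0 : ℝ) ≤ 2 * Real.pi := by positivity
  simp only [h2]
  refine ⟨(intervalIntegrable_iff_integrableOn_Ioo_of_le hpi).mpr h1.integral_prod_left, ?_⟩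
  rw [intervalIntegral.integral_of_le hpi, integral_Ioc_eq_integral_Ioo, hW.apply_eq,
    integral_integral_swap h1]
  refine integral_congr_ae (Filter.Eventually.of_forall fun ξ => ?_)
  simp only
  rw [integral_const_mul]; rfl

theorem IsRotationIntegral.unique {U W W' : 𝓢'(E3, ℂ)} (h : IsRotationIntegral U W)
    (h' : IsRotationIntegral U W') : W = W' := by
  ext ψ
  rw [(h ψ).2, (h' ψ).2]

/-- The function representing the Fourier transform of W is unique almost everywhere, hence so is
its product with the symbol. -/
theorem IsInverseLaplacian.unique {W V V' : 𝓢'(E3, ℂ)} (h : IsInverseLaplacian W V)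
    (h' : IsInverseLaplacian W V') : V = V' := by
  obtain ⟨g, hg, hV⟩ := h
  obtain ⟨g', hg', hV'⟩ := h'
  refine fourier_distr_injective (hV.ext (hV'.congr ?_))
  filter_upwards [hg'.ae_eq hg] with ξ hξ
  rw [hξ]

theorem IsOperatorD.unique {U V V' : 𝓢'(E3, ℂ)} (h : IsOperatorD U V) (h' : IsOperatorD U V') :
    V = V' := by
  obtain ⟨W, hW, hV⟩ := h
  obtain ⟨W', hW', hV'⟩ := h'
  rw [hW'.unique hW] at hV'
  exact hV.unique hV'
open scoped ENNReal

/-- The Fourier transform of `D i_* f`, when `F` is the Fourier transform of `f`. -/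
def invLapRot (α : ℝ) (F : E2 → ℂ) (ξ : E3) : ℂ :=
  ((-(4 * Real.pi ^ 2 * ‖ξ‖ ^ 2)⁻¹ : ℝ) : ℂ) * rotInt α F ξ

theorem kerBound_traceKernel {α : ℝ} (hsin : Real.sin α ≠ 0) (hcos : Real.cos α ≠ 0) {a : ℝ}
    (ha0 : 0 < a) (ha1 : a < 1) :
    ∃ C : ℝ≥0∞, C ≠ ⊤ ∧ KerBound volume (weightedKernel a (traceKernel α)) C := by
  obtain ⟨C, hC, h⟩ := kerBound_weightedKernel hsin hcos ha0 ha1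
  refine ⟨_, ENNReal.mul_ne_top ENNReal.ofReal_ne_top hC, h (2 / |Real.sin α|) (traceKernel α)
    (by positivity) (measurable_traceKernel α) fun η ζ => ?_⟩
  rw [abs_of_nonneg (traceKernel_nonneg _ _ _)]
  exact traceKernel_le hsin η ζ

theorem lintegral_jap_mul_norm_rpow_lt_top {r : ℝ} (hr0 : 0 ≤ r) (hr : r < 1) :
    ∫⁻ η : E2, ENNReal.ofReal (jap (-2) η * ‖η‖ ^ (-r)) ^ 2 < ⊤ := by
  have h1 := setLIntegral_ball_norm_rpow_lt_top (E := E2) (p := -(2 * r)) (by simp; linarith)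
  have h2 := lintegral_jap_lt_top (s := -4) (by norm_num) 1
  rw [← lintegral_indicator Metric.isOpen_ball.measurableSet] at h1
  refine lt_of_le_of_lt (lintegral_mono fun η => ?_) ((lintegral_add_right _
    (by refine Measurable.indicator (by fun_prop) Metric.isOpen_ball.measurableSet)).le.trans_lt
      (ENNReal.add_lt_top.mpr ⟨h2, h1⟩))
  have e : (jap (-2) η * ‖η‖ ^ (-r)) ^ 2 = jap (-4) η * ‖η‖ ^ (-(2 * r)) := by
    rw [mul_pow, jap_sq, ← Real.rpow_natCast, ← Real.rpow_mul (norm_nonneg _)]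
    norm_num; left; ring_nf
  have hle : jap (-4) η ≤ 1 := by
    have := jap_mono (show (-4 : ℝ) ≤ 0 by norm_num) η
    simpa using this
  rw [← ENNReal.ofReal_pow (mul_nonneg (jap_nonneg _ _) (by positivity)), e, one_mul]
  by_cases hη : η ∈ Metric.ball (0 : E2) 1
  · rw [Set.indicator_of_mem hη]
    refine le_trans (ENNReal.ofReal_le_ofReal ?_) le_add_self
    exact mul_le_of_le_one_left (by positivity) hle
  · rw [Set.indicator_of_notMem hη, add_zero]
    refine ENNReal.ofReal_le_ofReal (mul_le_of_le_one_right (jap_nonneg _ _) ?_)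
    exact Real.rpow_le_one_of_one_le_of_nonpos (by simpa using hη) (by linarith)

/-! ### Slices of the Fourier transform of D i_* f. -/

section

variable {α s : ℝ} {F : E2 → ℂ}

theorem ofReal_traceKernel_mul_eq (η : E2) (hη : η ≠ 0) {ζ : E2} (hζ : ζ ≠ 0) :
    ENNReal.ofReal (traceKernel α η ζ) * ‖F ζ‖ₑ = ENNReal.ofReal (‖η‖ ^ (-(s + 1))) *
      (‖weightedKernel (s + 1) (traceKernel α) η ζ‖ₑ * ‖((‖ζ‖ ^ s : ℝ) : ℂ) * F ζ‖ₑ) := by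
  have h1 : ‖η‖ ^ (-(s + 1)) * ‖η‖ ^ (s + 1) = 1 := by
    rw [← Real.rpow_add (norm_pos_iff.mpr hη)]; simp
  have h2 : ‖ζ‖ ^ (1 - (s + 1)) * ‖ζ‖ ^ s = 1 := by
    rw [← Real.rpow_add (norm_pos_iff.mpr hζ)]; simp
  have hk := traceKernel_nonneg α η ζ
  unfold weightedKernel
  rw [enorm_mul, ← ofReal_norm (((‖η‖ ^ (s + 1) * traceKernel α η ζ * ‖ζ‖ ^ (1 - (s + 1)) : ℝ) : ℂ)),
    ← ofReal_norm (((‖ζ‖ ^ s : ℝ) : ℂ)), Complex.norm_real, Complex.norm_real, Real.norm_of_nonneg (by positivity), Real.norm_of_nonneg (by positivity),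
    ← mul_assoc, ← mul_assoc, ← ENNReal.ofReal_mul (by positivity),
    ← ENNReal.ofReal_mul (by positivity)]
  congr 2
  linear_combination (-(‖ζ‖ ^ (1 - (s + 1)) * ‖ζ‖ ^ s) * traceKernel α η ζ) * h1 -
    traceKernel α η ζ * h2

theorem lintegral_traceKernel_eq {η : E2} (hη : η ≠ 0) :
    ∫⁻ ζ, ENNReal.ofReal (traceKernel α η ζ) * ‖F ζ‖ₑ = ENNReal.ofReal (‖η‖ ^ (-(s + 1))) *
      ∫⁻ ζ, ‖weightedKernel (s + 1) (traceKernel α) η ζ‖ₑ * ‖((‖ζ‖ ^ s : ℝ) : ℂ) * F ζ‖ₑ := by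
  rw [← lintegral_const_mul' _ _ ENNReal.ofReal_ne_top]
  refine lintegral_congr_ae ?_
  filter_upwards [show ∀ᵐ ζ : E2, ζ ≠ 0 by simp [ae_iff]] with ζ hζ
  exact ofReal_traceKernel_mul_eq η hη hζ

/-- The kernel bound puts |η|^{s+1} times the inner integral in L², and ⟨η⟩^{-2}|η|^{-(s+1)} is
square integrable on the plane because s + 1 < 1; conclude by Cauchy–Schwarz. -/
theorem lintegral_jap_traceKernel_lt_top (hsin : Real.sin α ≠ 0) (hcos : Real.cos α ≠ 0)
    (hs : -1 < s) (hs0 : s < 0)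
    (hF : MemLp (fun ζ => ((‖ζ‖ ^ s : ℝ) : ℂ) * F ζ) 2 volume) :
    ∫⁻ η : E2, ENNReal.ofReal (jap (-2) η) *
      ∫⁻ ζ, ENNReal.ofReal (traceKernel α η ζ) * ‖F ζ‖ₑ < ⊤ := by
  obtain ⟨C, hC, h⟩ := kerBound_traceKernel hsin hcos (a := s + 1) (by linarith) (by linarith)
  set q : E2 → ℝ≥0∞ := fun η =>
    ∫⁻ ζ, ‖weightedKernel (s + 1) (traceKernel α) η ζ‖ₑ * ‖((‖ζ‖ ^ s : ℝ) : ℂ) * F ζ‖ₑ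
  have hqm : AEMeasurable q volume := by
    have h0 := (AEStronglyMeasurable.kernel_mul (μ := volume) (measurable_weightedKernel (s + 1)
      (measurable_traceKernel α)) hF.1).enorm.lintegral_prod_right'
    refine h0.congr (Filter.Eventually.of_forall fun η => ?_)
    simp only [q, enorm_mul]
  have e : ∫⁻ η : E2, ENNReal.ofReal (jap (-2) η) *
      ∫⁻ ζ, ENNReal.ofReal (traceKernel α η ζ) * ‖F ζ‖ₑ =
      ∫⁻ η : E2, ENNReal.ofReal (jap (-2) η * ‖η‖ ^ (-(s + 1))) * q η := by
    refine lintegral_congr_ae ?_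
    filter_upwards [show ∀ᵐ η : E2, η ≠ 0 by simp [ae_iff]] with η hη
    rw [lintegral_traceKernel_eq (s := s) hη, ← mul_assoc, ← ENNReal.ofReal_mul (jap_nonneg _ _)]
  rw [e]
  have h1 := sq_lintegral_mul_le (μ := volume)
    (f := fun η : E2 => ENNReal.ofReal (jap (-2) η * ‖η‖ ^ (-(s + 1)))) (by fun_prop) hqm
  have h2 : ∫⁻ η, q η ^ 2 < ⊤ := by
    refine lt_of_le_of_lt (h.aemeasurable_le hF.1.enorm) ?_
    exact ENNReal.mul_lt_top hC.lt_top ((memLp_two_iff_lintegral hF.1).mp hF)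
  have h3 := lt_of_le_of_lt h1 (ENNReal.mul_lt_top
    (lintegral_jap_mul_norm_rpow_lt_top (r := s + 1) (by linarith) (by linarith)) h2)
  exact lt_top_iff_ne_top.mpr fun h4 => by rw [h4] at h3; simp at h3

theorem measurable_invLapRot (hFm : Measurable F) : Measurable (invLapRot α F) := by
  unfold invLapRot
  exact (by fun_prop : Measurable fun ξ : E3 => ((-(4 * Real.pi ^ 2 * ‖ξ‖ ^ 2)⁻¹ : ℝ) : ℂ)).mul
    (measurable_rotInt hFm α)

theorem enorm_invLapRot_le (ξ : E3) : ‖invLapRot α F ξ‖ₑ ≤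
    ENNReal.ofReal (‖ξ‖ ^ 2)⁻¹ *
      ∫⁻ θ in Set.Ioo 0 (2 * Real.pi), ‖F (projX α (rotZ θ ξ))‖ₑ := by
  unfold invLapRot rotInt
  rw [enorm_mul]
  gcongr
  · rw [← ofReal_norm, Complex.norm_real, norm_neg, Real.norm_of_nonneg (by positivity), mul_inv]
    refine ENNReal.ofReal_le_ofReal (mul_le_of_le_one_left (by positivity) ?_)
    refine inv_le_one_of_one_le₀ ?_
    nlinarith [Real.pi_gt_three]
  · exact enorm_integral_le_lintegral_enorm _

/-- Integrating over normal lines and changing variables turns this integrability on ℝ³ into that of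
the trace kernel applied to |F|. In particular 1/|ξ|² at the origin causes no divergence, and D i_*
f is a well-defined tempered distribution. -/
theorem slicePolyInt_invLapRot (hsin : Real.sin α ≠ 0) (hcos : Real.cos α ≠ 0)
    (hs : -1 < s) (hs0 : s < 0) (hFm : Measurable F)
    (hF : MemLp (fun ζ => ((‖ζ‖ ^ s : ℝ) : ℂ) * F ζ) 2 volume) :
    SlicePolyInt α (invLapRot α F) := by
  refine ⟨2, zero_le_two, Measurable.aestronglyMeasurable ?_, ?_⟩
  · exact (by fun_prop : Measurable fun ξ : E3 => ((jap (-2) (projX α ξ) : ℝ) : ℂ)).mul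
      (measurable_invLapRot hFm)
  · refine lt_of_le_of_lt ?_ (lintegral_jap_traceKernel_lt_top hsin hcos hs hs0 hF)
    have hm : Measurable fun ξ : E3 => ‖((jap (-2) (projX α ξ) : ℝ) : ℂ) * invLapRot α F ξ‖ₑ :=
      ((by fun_prop : Measurable fun ξ : E3 => ((jap (-2) (projX α ξ) : ℝ) : ℂ)).mul
        (measurable_invLapRot hFm)).enorm
    rw [lintegral_sliceX α hm]
    refine lintegral_mono fun η => ?_
    have hΦ : Measurable fun ζ => ‖F ζ‖ₑ := hFm.enorm
    rw [← lintegral_rotation_eq hsin hcos η hΦ, ← lintegral_const_mul' _ _ ENNReal.ofReal_ne_top]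
    refine lintegral_mono fun t => ?_
    rw [lintegral_const_mul' _ _ ENNReal.ofReal_ne_top, enorm_mul, projX_sliceX,
      ← norm_sq_sliceX α (η, t)]
    gcongr
    · rw [← ofReal_norm, Complex.norm_real, Real.norm_of_nonneg (jap_nonneg _ _)]
    · exact enorm_invLapRot_le _

theorem integrable_rotation (hsin : Real.sin α ≠ 0) (hcos : Real.cos α ≠ 0) (hFm : Measurable F)
    {η : E2} (h : ∫⁻ ζ, ENNReal.ofReal (traceKernel α η ζ) * ‖F ζ‖ₑ < ⊤) :
    Integrable (fun p : ℝ × ℝ => (((‖η‖ ^ 2 + p.1 ^ 2)⁻¹ : ℝ) : ℂ) *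
      F (projX α (rotZ p.2 (sliceX α (η, p.1)))))
      (volume.prod (volume.restrict (Set.Ioo 0 (2 * Real.pi)))) := by
  have hm : Measurable fun p : ℝ × ℝ => (((‖η‖ ^ 2 + p.1 ^ 2)⁻¹ : ℝ) : ℂ) *
      F (projX α (rotZ p.2 (sliceX α (η, p.1)))) :=
    (by fun_prop : Measurable fun p : ℝ × ℝ => (((‖η‖ ^ 2 + p.1 ^ 2)⁻¹ : ℝ) : ℂ)).mul
      (hFm.comp (measurable_rotZ_sliceX α η))
  refine ⟨hm.aestronglyMeasurable, ?_⟩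
  unfold HasFiniteIntegral
  rw [lintegral_prod _ hm.enorm.aemeasurable]
  rw [← lintegral_rotation_eq hsin hcos η hFm.enorm] at h
  refine lt_of_le_of_lt (le_of_eq ?_) h
  refine lintegral_congr fun t => lintegral_congr fun θ => ?_
  rw [enorm_mul, ← ofReal_norm, Complex.norm_real, Real.norm_of_nonneg (by positivity)]

/-- On the normal line over η one has |ξ|² = |η|² + t², so the slice is the integral of F against
the measure whose image is computed in `map_rotation_measure`; absolute convergence permits the
iterated integration. -/
theorem sliceInt_invLapRot_eq (hsin : Real.sin α ≠ 0) (hcos : Real.cos α ≠ 0)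
    (hFm : Measurable F)
    {η : E2} (h : ∫⁻ ζ, ENNReal.ofReal (traceKernel α η ζ) * ‖F ζ‖ₑ < ⊤) :
    sliceInt α (invLapRot α F) η =
      ((-(4 * Real.pi ^ 2)⁻¹ : ℝ) : ℂ) * ∫ ζ, ((traceKernel α η ζ : ℝ) : ℂ) * F ζ := by
  have hi := integrable_rotation hsin hcos hFm h
  have h1 : ∫ ζ, ((traceKernel α η ζ : ℝ) : ℂ) * F ζ =
      ∫ ζ, F ζ ∂(volume.withDensity fun ζ => ENNReal.ofReal (traceKernel α η ζ)) := by
    have hm : Measurable fun ζ => ENNReal.ofReal (traceKernel α η ζ) :=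
      ((measurable_traceKernel α).comp (measurable_const.prodMk measurable_id)).ennreal_ofReal
    rw [integral_withDensity_eq_integral_toReal_smul hm
      (Filter.Eventually.of_forall fun _ => ENNReal.ofReal_lt_top)]
    refine integral_congr_ae (Filter.Eventually.of_forall fun ζ => ?_)
    simp only
    rw [ENNReal.toReal_ofReal (traceKernel_nonneg _ _ _), Complex.real_smul]
  have h2 : ∫ ζ, F ζ ∂(volume.withDensity fun ζ => ENNReal.ofReal (traceKernel α η ζ)) =
      ∫ p : ℝ × ℝ, (((‖η‖ ^ 2 + p.1 ^ 2)⁻¹ : ℝ) : ℂ) *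
        F (projX α (rotZ p.2 (sliceX α (η, p.1))))
      ∂(volume.prod (volume.restrict (Set.Ioo 0 (2 * Real.pi)))) := by
    rw [← map_rotation_measure hsin hcos η, integral_map (measurable_rotZ_sliceX α η).aemeasurable
      hFm.aestronglyMeasurable, integral_withDensity_eq_integral_toReal_smul (by fun_prop)
      (Filter.Eventually.of_forall fun _ => ENNReal.ofReal_lt_top)]
    refine integral_congr_ae (Filter.Eventually.of_forall fun p => ?_)
    simp only
    rw [ENNReal.toReal_ofReal (by positivity), Complex.real_smul]
  rw [h1, h2, integral_prod _ hi, ← integral_const_mul]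
  refine integral_congr_ae (Filter.Eventually.of_forall fun t => ?_)
  simp only
  rw [integral_const_mul, invLapRot, norm_sq_sliceX, ← mul_assoc, ← Complex.ofReal_mul]
  congr 2
  rw [mul_inv]; simp

theorem ae_sliceInt_invLapRot (hsin : Real.sin α ≠ 0) (hcos : Real.cos α ≠ 0)
    (hs : -1 < s) (hs0 : s < 0) (hFm : Measurable F)
    (hF : MemLp (fun ζ => ((‖ζ‖ ^ s : ℝ) : ℂ) * F ζ) 2 volume) :
    ∀ᵐ η, sliceInt α (invLapRot α F) η =
      ((-(4 * Real.pi ^ 2)⁻¹ : ℝ) : ℂ) * ∫ ζ, ((traceKernel α η ζ : ℝ) : ℂ) * F ζ := by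
  obtain ⟨C, hC, h⟩ := kerBound_traceKernel hsin hcos (a := s + 1) (by linarith) (by linarith)
  filter_upwards [h.ae_lintegral_lt_top hC hF, show ∀ᵐ η : E2, η ≠ 0 by simp [ae_iff]] with η h1 hη
  refine sliceInt_invLapRot_eq hsin hcos hFm ?_
  rw [lintegral_traceKernel_eq (s := s) hη]
  exact ENNReal.mul_lt_top ENNReal.ofReal_lt_top h1

end

/-! ### Local Sobolev regularity of D i_* f. -/

section

variable {α s : ℝ} {F : E2 → ℂ}

theorem jap_le_norm_rpow {E : Type*} [NormedAddCommGroup E] {s : ℝ} (hs : s ≤ 0) {x : E}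
    (hx : x ≠ 0) : jap s x ≤ ‖x‖ ^ s := by
  have h : ‖x‖ ^ s = (‖x‖ ^ 2) ^ (s / 2) := by
    rw [← Real.rpow_natCast, ← Real.rpow_mul (norm_nonneg _)]
    congr 1; push_cast; ring
  rw [h]
  have hx' := norm_pos_iff.mpr hx
  exact Real.rpow_le_rpow_of_nonpos (by positivity) (by linarith) (by linarith)

theorem memLp_jap_mul_of_norm_rpow (hs0 : s ≤ 0) (hFm : AEStronglyMeasurable F volume)
    (hF : MemLp (fun ζ => ((‖ζ‖ ^ s : ℝ) : ℂ) * F ζ) 2 volume) :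
    MemLp (fun ζ => ((jap s ζ : ℝ) : ℂ) * F ζ) 2 volume := by
  refine hF.mono (AEStronglyMeasurable.mul (by fun_prop) hFm) ?_
  filter_upwards [show ∀ᵐ ζ : E2, ζ ≠ 0 by simp [ae_iff]] with ζ hζ
  rw [norm_mul, norm_mul, Complex.norm_real, Complex.norm_real,
    Real.norm_of_nonneg (jap_nonneg _ _), Real.norm_of_nonneg (by positivity)]
  gcongr
  exact jap_le_norm_rpow hs0 hζ

/-- The square of the average is at most the average of the square. -/
theorem enorm_rotInt_sq_le (hFm : Measurable F) (ξ : E3) : ‖rotInt α F ξ‖ₑ ^ 2 ≤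
    ENNReal.ofReal (2 * Real.pi) *
      ∫⁻ θ in Set.Ioo 0 (2 * Real.pi), ‖F (projX α (rotZ θ ξ))‖ₑ ^ 2 := by
  have hm : Measurable fun θ : ℝ => ‖F (projX α (rotZ θ ξ))‖ₑ :=
    (hFm.comp ((measurable_projX_rotZ α).comp (measurable_id.prodMk measurable_const))).enorm
  have h := sq_lintegral_mul_le (μ := volume.restrict (Set.Ioo 0 (2 * Real.pi)))
    (f := fun _ : ℝ => 1) aemeasurable_const hm.aemeasurable
  simp only [one_mul, one_pow, lintegral_const, MeasurableSet.univ, Measure.restrict_apply,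
    Set.univ_inter, Real.volume_Ioo, sub_zero] at h
  refine le_trans ?_ h
  gcongr
  exact enorm_integral_le_lintegral_enorm _

/-- The exponent is 2(s + 3/2) - 4: the squared weight of H^{s+3/2} together with the decay |ξ|^{-4}
of the squared symbol. Integrated along normal lines it leaves ⟨η⟩^{2s}, the squared weight of H^s.
-/
theorem lintegral_jap_projX_sq_lt_top (hs0 : s < 0) (hFm : Measurable F)
    (hF : MemLp (fun ζ => ((jap s ζ : ℝ) : ℂ) * F ζ) 2 volume) :
    ∫⁻ ξ : E3, ENNReal.ofReal (jap (-(1 - 2 * s)) ξ) * ‖F (projX α ξ)‖ₑ ^ 2 < ⊤ := by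
  have hFe : Measurable fun ζ => ‖F ζ‖ₑ ^ 2 := hFm.enorm.pow_const 2
  have hw : Measurable fun ξ : E3 => ENNReal.ofReal (jap (-(1 - 2 * s)) ξ) := by fun_prop
  have hwF : Measurable fun ξ : E3 =>
      ENNReal.ofReal (jap (-(1 - 2 * s)) ξ) * ‖F (projX α ξ)‖ₑ ^ 2 :=
    hw.mul (hFe.comp (continuous_projX α).measurable)
  rw [lintegral_sliceX α hwF]
  simp only [projX_sliceX]
  have e : ∀ η : E2, ∫⁻ t : ℝ, ENNReal.ofReal (jap (-(1 - 2 * s)) (sliceX α (η, t))) *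
      ‖F η‖ₑ ^ 2 = (∫⁻ t : ℝ, ENNReal.ofReal (jap (-(1 - 2 * s)) t)) *
        ‖((jap s η : ℝ) : ℂ) * F η‖ₑ ^ 2 := by
    intro η
    rw [lintegral_mul_const' _ _ (by finiteness), lintegral_jap_sliceX, enorm_mul, mul_pow,
      ← mul_assoc]
    congr 2
    rw [← ofReal_norm, Complex.norm_real, Real.norm_of_nonneg (jap_nonneg _ _),
      ← ENNReal.ofReal_pow (jap_nonneg _ _), jap_sq]
    congr 2; ring
  simp only [e]
  have hlt := lintegral_jap_real_lt_top (p := 1 - 2 * s) (by linarith)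
  rw [lintegral_const_mul' _ _ hlt.ne]
  exact ENNReal.mul_lt_top hlt ((memLp_two_iff_lintegral hF.1).mp hF)

theorem lintegral_radial_rotZ (w : ℝ → ℝ≥0∞) (hw : Measurable w) {Φ : E3 → ℝ≥0∞}
    (hΦ : Measurable Φ) (θ : ℝ) :
    ∫⁻ ξ : E3, w ‖ξ‖ * Φ (rotZ θ ξ) = ∫⁻ ξ : E3, w ‖ξ‖ * Φ ξ := by
  have hm : Measurable fun ξ : E3 => w ‖ξ‖ * Φ ξ := (hw.comp measurable_norm).mul hΦ
  rw [← (measurePreserving_rotZ θ).lintegral_comp hm]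
  simp only [norm_rotZ]

/-- By Cauchy–Schwarz in θ and the invariance of radial weights, averaging over rotations costs only
a constant. -/
theorem lintegral_radial_rotInt_sq_le (w : ℝ → ℝ≥0∞) (hw : Measurable w) (hFm : Measurable F) :
    ∫⁻ ξ : E3, w ‖ξ‖ * ‖rotInt α F ξ‖ₑ ^ 2 ≤ ENNReal.ofReal (2 * Real.pi) *
      ((∫⁻ ξ : E3, w ‖ξ‖ * ‖F (projX α ξ)‖ₑ ^ 2) *
        volume.restrict (Set.Ioo 0 (2 * Real.pi)) Set.univ) := by
  have hFe : Measurable fun ξ : E3 => ‖F (projX α ξ)‖ₑ ^ 2 :=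
    (hFm.comp (continuous_projX α).measurable).enorm.pow_const 2
  have hm2 : Measurable fun p : E3 × ℝ => w ‖p.1‖ * ‖F (projX α (rotZ p.2 p.1))‖ₑ ^ 2 :=
    (hw.comp (measurable_norm.comp measurable_fst)).mul
      ((hFm.comp ((measurable_projX_rotZ α).comp measurable_swap)).enorm.pow_const 2)
  have h1 : ∀ ξ : E3, w ‖ξ‖ * ‖rotInt α F ξ‖ₑ ^ 2 ≤ ENNReal.ofReal (2 * Real.pi) *
      ∫⁻ θ in Set.Ioo 0 (2 * Real.pi), w ‖ξ‖ * ‖F (projX α (rotZ θ ξ))‖ₑ ^ 2 := by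
    intro ξ
    have hm : Measurable fun θ : ℝ => ‖F (projX α (rotZ θ ξ))‖ₑ ^ 2 :=
      (hFm.comp ((measurable_projX_rotZ α).comp
        (measurable_id.prodMk measurable_const))).enorm.pow_const 2
    rw [lintegral_const_mul _ hm, mul_left_comm]
    gcongr
    exact enorm_rotInt_sq_le hFm ξ
  refine (lintegral_mono h1).trans ?_
  rw [lintegral_const_mul' _ _ ENNReal.ofReal_ne_top,
    lintegral_lintegral_swap (f := fun (ξ : E3) (θ : ℝ) =>
      w ‖ξ‖ * ‖F (projX α (rotZ θ ξ))‖ₑ ^ 2) hm2.aemeasurable]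
  refine le_of_eq ?_
  rw [← lintegral_const]
  congr 1
  refine lintegral_congr fun θ => ?_
  exact lintegral_radial_rotZ w hw hFe θ

theorem lintegral_jap_rotInt_sq_lt_top (hs0 : s < 0) (hFm : Measurable F)
    (hF : MemLp (fun ζ => ((jap s ζ : ℝ) : ℂ) * F ζ) 2 volume) :
    ∫⁻ ξ : E3, ENNReal.ofReal (jap (-(1 - 2 * s)) ξ) * ‖rotInt α F ξ‖ₑ ^ 2 < ⊤ := by
  have h := lintegral_radial_rotInt_sq_le (α := α)
    (fun x : ℝ => ENNReal.ofReal ((1 + x ^ 2) ^ (-(1 - 2 * s) / 2))) (by fun_prop) hFm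
  refine lt_of_le_of_lt h (ENNReal.mul_lt_top ENNReal.ofReal_lt_top
    (ENNReal.mul_lt_top ?_ (measure_lt_top _ _)))
  exact lintegral_jap_projX_sq_lt_top hs0 hFm hF

theorem integrable_jap_indicator_ball {G : E3 → ℂ} (hG : PolyInt G) (N : ℝ) (hN : 0 ≤ N) :
    Integrable fun ξ => ((jap N ξ : ℝ) : ℂ) *
      (Metric.ball (0 : E3) 1).indicator G ξ := by
  obtain ⟨M₀, hM⟩ := hG.mono
  set M := max M₀ 0
  have h := ((hM M (le_max_left _ _)).indicator (s := Metric.ball (0 : E3) 1)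
    Metric.isOpen_ball.measurableSet)
  have h2 : Integrable fun ξ => ((jap (N + M) ξ : ℝ) : ℂ) * (Metric.ball (0 : E3) 1).indicator
      (fun ξ => ((jap (-M) ξ : ℝ) : ℂ) * G ξ) ξ := by
    refine (h.norm.const_mul (2 ^ ((N + M) / 2))).mono'
      (AEStronglyMeasurable.mul (by fun_prop) h.1) (Filter.Eventually.of_forall fun ξ => ?_)
    by_cases hξ : ξ ∈ Metric.ball (0 : E3) 1
    · rw [norm_mul, Complex.norm_real, Real.norm_of_nonneg (jap_nonneg _ _)]
      gcongr
      unfold jap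
      have h1 : ‖ξ‖ < 1 := by simpa using hξ
      have hM0 : 0 ≤ M := le_max_right _ _
      refine Real.rpow_le_rpow (by positivity) ?_ (by positivity)
      nlinarith [norm_nonneg ξ]
    · simp [Set.indicator_of_notMem hξ]
  refine h2.congr (Filter.Eventually.of_forall fun ξ => ?_)
  by_cases hξ : ξ ∈ Metric.ball (0 : E3) 1
  · simp only [Set.indicator_of_mem hξ]
    rw [← mul_assoc, ← Complex.ofReal_mul, jap_mul]
    congr 3; ring
  · simp [Set.indicator_of_notMem hξ]

theorem memLp_jap_indicator_compl_ball (hs0 : s < 0) (hFm : Measurable F)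
    (hF : MemLp (fun ζ => ((jap s ζ : ℝ) : ℂ) * F ζ) 2 volume) :
    MemLp (fun ξ => ((jap (s + 3 / 2) ξ : ℝ) : ℂ) *
      (Metric.ball (0 : E3) 1)ᶜ.indicator (invLapRot α F) ξ) 2 volume := by
  have hms : MeasurableSet (Metric.ball (0 : E3) 1)ᶜ := Metric.isOpen_ball.measurableSet.compl
  have hm : Measurable (fun ξ => ((jap (s + 3 / 2) ξ : ℝ) : ℂ) *
      (Metric.ball (0 : E3) 1)ᶜ.indicator (invLapRot α F) ξ) :=
    (by fun_prop : Measurable fun ξ : E3 => ((jap (s + 3 / 2) ξ : ℝ) : ℂ)).mul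
      ((measurable_invLapRot hFm).indicator hms)
  refine (memLp_two_iff_lintegral hm.aestronglyMeasurable).mpr
    (lt_of_le_of_lt (lintegral_mono (g := fun ξ => ENNReal.ofReal 4 *
      (ENNReal.ofReal (jap (-(1 - 2 * s)) ξ) * ‖rotInt α F ξ‖ₑ ^ 2)) fun ξ => ?_) ?_)
  · by_cases hξ : ξ ∈ (Metric.ball (0 : E3) 1)ᶜ
    · simp only [Set.indicator_of_mem hξ]
      have h1 : 1 ≤ ‖ξ‖ := by simpa using hξ
      unfold invLapRot
      rw [← mul_assoc, enorm_mul, mul_pow, ← mul_assoc]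
      gcongr
      rw [← Complex.ofReal_mul, ← ofReal_norm, Complex.norm_real, ← ENNReal.ofReal_pow
        (norm_nonneg _), ← ENNReal.ofReal_mul (by norm_num)]
      refine ENNReal.ofReal_le_ofReal ?_
      -- For |ξ| ≥ 1 the symbol is at most 2/(1 + |ξ|²); squaring the 2 yields the constant 4.
      have h2 : ‖jap (s + 3 / 2) ξ * -(4 * Real.pi ^ 2 * ‖ξ‖ ^ 2)⁻¹‖ ≤
          jap (s + 3 / 2) ξ * (2 * jap (-2) ξ) := by
        rw [norm_mul, norm_neg, Real.norm_of_nonneg (jap_nonneg _ _),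
          Real.norm_of_nonneg (by positivity)]
        refine mul_le_mul_of_nonneg_left ?_ (jap_nonneg _ _)
        have h3 : jap (-2) ξ = (1 + ‖ξ‖ ^ 2)⁻¹ := by
          unfold jap; norm_num; rw [Real.rpow_neg_one]
        rw [h3, ← div_eq_mul_inv, inv_eq_one_div, div_le_div_iff₀ (by positivity) (by positivity)]
        have hp : 1 ≤ Real.pi ^ 2 := one_le_pow₀ (by linarith [Real.pi_gt_three])
        have hn : 1 ≤ ‖ξ‖ ^ 2 := one_le_pow₀ h1
        nlinarith [mul_le_mul_of_nonneg_right hp (sq_nonneg ‖ξ‖)]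
      calc _ ≤ (jap (s + 3 / 2) ξ * (2 * jap (-2) ξ)) ^ 2 :=
            pow_le_pow_left₀ (norm_nonneg _) h2 2
        _ = 4 * jap (-(1 - 2 * s)) ξ := by
            rw [mul_left_comm, jap_mul, mul_pow, jap_sq]
            norm_num; congr 1; ring
    · simp [Set.indicator_of_notMem hξ]
  · rw [lintegral_const_mul' _ _ ENNReal.ofReal_ne_top]
    exact ENNReal.mul_lt_top ENNReal.ofReal_lt_top (lintegral_jap_rotInt_sq_lt_top hs0 hFm hF)

/-- Split at |ξ| = 1. The high frequencies lie in the weighted L² space, which convolution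
preserves; the low ones are integrable with bounded support, so their convolution with a decays
rapidly. -/
theorem memLp_jap_convFun_invLapRot (hs0 : s < 0) (hFm : Measurable F)
    (hF : MemLp (fun ζ => ((jap s ζ : ℝ) : ℂ) * F ζ) 2 volume) (hG : PolyInt (invLapRot α F))
    (a : 𝓢(E3, ℂ)) :
    MemLp (fun ξ => ((jap (s + 3 / 2) ξ : ℝ) : ℂ) * convFun a (invLapRot α F) ξ) 2 volume := by
  have h1 := memLp_jap_convFun_of_decay (s := s + 3 / 2) a
    (fun N hN => integrable_jap_indicator_ball hG N hN)
  have hhigh := memLp_jap_indicator_compl_ball (α := α) hs0 hFm hF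
  have h2 := memLp_jap_convFun a hhigh
  have hlow : PolyInt ((Metric.ball (0 : E3) 1).indicator (invLapRot α F)) := by
    refine Integrable.polyInt ?_
    simpa using integrable_jap_indicator_ball hG 0 le_rfl
  refine (h1.add h2).ae_eq (Filter.Eventually.of_forall fun ξ => ?_)
  have h3 := convFun_add (a := a) hlow (polyInt_of_memLp hhigh) ξ
  have e : (fun x => (Metric.ball (0 : E3) 1).indicator (invLapRot α F) x +
      (Metric.ball (0 : E3) 1)ᶜ.indicator (invLapRot α F) x) = invLapRot α F :=
    Set.indicator_self_add_compl _ _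
  rw [e] at h3
  simp only [Pi.add_apply]
  rw [h3]; ring

end

/-! ### Uniqueness of the boundary value -/

section CutoffConvergence

variable {E : Type*} [NormedAddCommGroup E] [InnerProductSpace ℝ E] [FiniteDimensional ℝ E]
  [MeasurableSpace E] [BorelSpace E]

theorem IsCutoff.comp_smul {χ : E → ℂ} (hχ : IsCutoff χ) {a : ℝ} (ha : a ≠ 0) :
    IsCutoff fun x => χ (a • x) :=
  ⟨hχ.1.comp (contDiff_const_smul a), hχ.2.comp_homeomorph (Homeomorph.smulOfNeZero a ha)⟩

theorem IsCutoff.norm_iteratedFDeriv_comp_smul_le {χ : E → ℂ} (hχ : IsCutoff χ) {a : ℝ}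
    (ha0 : 0 ≤ a) (ha : a ≤ 1) (i : ℕ) (x : E) :
    ‖iteratedFDeriv ℝ i (fun x => χ (a • x)) x‖ ≤ SchwartzMap.seminorm ℝ 0 i hχ.toSchwartz := by
  have h := congrFun (iteratedFDeriv_comp_const_smul (𝕜 := ℝ) (i := i) a
    (hχ.1.of_le (by exact_mod_cast le_top))) x
  rw [h, norm_smul, Real.norm_of_nonneg (by positivity)]
  have h2 := SchwartzMap.le_seminorm ℝ 0 i hχ.toSchwartz (a • x)
  rw [pow_zero, one_mul] at h2
  refine (mul_le_of_le_one_left (norm_nonneg _) (pow_le_one₀ ha0 ha)).trans h2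

/-- The difference vanishes where a‖x‖ < 1; elsewhere the factor a‖x‖ ≥ 1 can be inserted for free,
trading one power of decay of ψ for one factor a. -/
theorem exists_seminorm_cutoff_sub_le {χ : E → ℂ} (hχ : IsCutoff χ)
    (h1 : ∀ x, ‖x‖ < 1 → χ x = 1) (ψ : 𝓢(E, ℂ)) (k l : ℕ) : ∃ C : ℝ, ∀ a : ℝ, 0 < a → a ≤ 1 →
      SchwartzMap.seminorm ℂ k l (SchwartzMap.smulLeftCLM ℂ (fun x => χ (a • x)) ψ - ψ) ≤
        C * a := by
  set C : ℝ := ∑ i ∈ Finset.range (l + 1), (l.choose i : ℝ) *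
    SchwartzMap.seminorm ℝ 0 i hχ.toSchwartz * SchwartzMap.seminorm ℝ (k + 1) (l - i) ψ +
    SchwartzMap.seminorm ℝ (k + 1) l ψ with hC
  have hC0 : 0 ≤ C := by positivity
  refine ⟨C, fun a ha0 ha => SchwartzMap.seminorm_le_bound ℂ k l _ (by positivity) fun x => ?_⟩
  have hcut := hχ.comp_smul ha0.ne'
  have e : ⇑(SchwartzMap.smulLeftCLM ℂ (fun x => χ (a • x)) ψ - ψ) =
      (fun x => χ (a • x) * ψ x) - ⇑ψ := by
    ext y
    simp [SchwartzMap.smulLeftCLM_apply_apply hcut.hasTemperateGrowth]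
  rw [e]
  by_cases hx : a * ‖x‖ < 1
  · have h2 : (fun x => χ (a • x) * ψ x) - ⇑ψ =ᶠ[𝓝 x] fun _ => 0 := by
      have h3 : ∀ᶠ y in 𝓝 x, a * ‖y‖ < 1 :=
        (continuous_const.mul continuous_norm).continuousAt.eventually_lt_const hx
      filter_upwards [h3] with y hy
      simp only [Pi.sub_apply]
      rw [h1 _ (by rw [norm_smul, Real.norm_of_nonneg ha0.le]; exact hy)]
      ring
    rw [(Filter.EventuallyEq.iteratedFDeriv ℝ h2 l).eq_of_nhds, iteratedFDeriv_fun_zero]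
    simp only [Pi.zero_apply, norm_zero, mul_zero]
    positivity
  · push Not at hx
    have hd : ContDiff ℝ ∞ fun x => χ (a • x) := hcut.1
    have hψ : ContDiff ℝ ∞ ψ := ψ.smooth'
    have hl : ((l : ℕ∞) : WithTop ℕ∞) ≤ (∞ : WithTop ℕ∞) := by exact_mod_cast le_top
    rw [iteratedFDeriv_sub_apply ((hd.mul hψ).of_le hl).contDiffAt (hψ.of_le hl).contDiffAt]
    have hmul := norm_iteratedFDeriv_mul_le hd hψ x (n := l) hl
    have hb : ‖iteratedFDeriv ℝ l (fun x => χ (a • x) * ψ x) x - iteratedFDeriv ℝ l ψ x‖ ≤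
        ∑ i ∈ Finset.range (l + 1), (l.choose i : ℝ) *
          SchwartzMap.seminorm ℝ 0 i hχ.toSchwartz * ‖iteratedFDeriv ℝ (l - i) ψ x‖ +
          ‖iteratedFDeriv ℝ l ψ x‖ := by
      refine (norm_sub_le _ _).trans (add_le_add_left (hmul.trans ?_) _)
      gcongr with i _
      exact hχ.norm_iteratedFDeriv_comp_smul_le ha0.le ha i x
    calc _ ≤ (a * ‖x‖) * (‖x‖ ^ k * ‖_‖) := le_mul_of_one_le_left (by positivity) hx
      _ ≤ (a * ‖x‖) * (‖x‖ ^ k * (∑ i ∈ Finset.range (l + 1), (l.choose i : ℝ) *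
          SchwartzMap.seminorm ℝ 0 i hχ.toSchwartz * ‖iteratedFDeriv ℝ (l - i) ψ x‖ +
          ‖iteratedFDeriv ℝ l ψ x‖)) := by gcongr
      _ = a * (∑ i ∈ Finset.range (l + 1), (l.choose i : ℝ) *
          SchwartzMap.seminorm ℝ 0 i hχ.toSchwartz *
            (‖x‖ ^ (k + 1) * ‖iteratedFDeriv ℝ (l - i) ψ x‖) +
          ‖x‖ ^ (k + 1) * ‖iteratedFDeriv ℝ l ψ x‖) := by
        rw [mul_add, mul_add, mul_add, Finset.mul_sum, Finset.mul_sum, Finset.mul_sum]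
        congr 1
        · refine Finset.sum_congr rfl fun i _ => ?_
          ring
        · ring
      _ ≤ a * C := by
        rw [hC]
        gcongr with i _
        · exact SchwartzMap.le_seminorm ℝ (k + 1) (l - i) ψ x
        · exact SchwartzMap.le_seminorm ℝ (k + 1) l ψ x
      _ = C * a := mul_comm _ _

theorem tendsto_smulLeft_cutoff {χ : E → ℂ} (hχ : IsCutoff χ)
    (h1 : ∀ x, ‖x‖ < 1 → χ x = 1) (ψ : 𝓢(E, ℂ)) :
    Filter.Tendsto (fun a : ℝ => SchwartzMap.smulLeftCLM ℂ (fun x => χ (a • x)) ψ)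
      (𝓝[>] 0) (𝓝 ψ) := by
  refine ((schwartz_withSeminorms ℂ E ℂ).tendsto_nhds _ _).mpr fun ⟨k, l⟩ ε hε => ?_
  obtain ⟨C, hC⟩ := exists_seminorm_cutoff_sub_le hχ h1 ψ k l
  have h2 : ∀ᶠ a : ℝ in 𝓝[>] 0, C * a < ε := by
    refine nhdsWithin_le_nhds ?_
    have : Filter.Tendsto (fun a : ℝ => C * a) (𝓝 0) (𝓝 0) := by
      simpa using (continuous_const_mul C).tendsto 0
    exact this.eventually_lt_const hε
  filter_upwards [h2, self_mem_nhdsWithin, nhdsWithin_le_nhds (Iic_mem_nhds one_pos)] with a h3 h4 h5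
  exact (hC a h4 h5).trans_lt h3

theorem eq_of_cutoffMul_eq {χ : E → ℂ} (hχ : IsCutoff χ) (h1 : ∀ x, ‖x‖ < 1 → χ x = 1)
    {v v' : 𝓢'(E, ℂ)}
    (h : ∀ a : ℝ, 0 < a → cutoffMul (fun x => χ (a • x)) v = cutoffMul (fun x => χ (a • x)) v') :
    v = v' := by
  ext ψ
  have hψ := tendsto_smulLeft_cutoff hχ h1 ψ
  have h2 := (v.continuous.tendsto ψ).comp hψ
  have h3 := (v'.continuous.tendsto ψ).comp hψ
  refine tendsto_nhds_unique (h2.congr' ?_) h3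
  filter_upwards [self_mem_nhdsWithin] with a ha
  exact congrArg (fun w : 𝓢'(E, ℂ) => w ψ) (h a ha)

theorem exists_isCutoff_eq_one : ∃ χ : E → ℂ, IsCutoff χ ∧ ∀ x, ‖x‖ < 1 → χ x = 1 := by
  let b : ContDiffBump (0 : E) := ⟨1, 2, one_pos, one_lt_two⟩
  refine ⟨fun x => ((b x : ℝ) : ℂ), ⟨Complex.ofRealCLM.contDiff.comp b.contDiff,
    b.hasCompactSupport.comp_left (g := fun x : ℝ => (x : ℂ)) (by simp)⟩, fun x hx => ?_⟩
  have : b x = 1 := b.one_of_mem_closedBall (by simpa [b] using hx.le)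
  simp [this]

end CutoffConvergence

/-! ### Boundary values and the trace in terms of Fourier transforms. -/

theorem IsCutoff.comp_embX {κ : E3 → ℂ} (hκ : IsCutoff κ) (α : ℝ) :
    IsCutoff fun q => κ (embX α q) :=
  ⟨hκ.1.comp (embX α).contDiff, hκ.2.comp_isClosedEmbedding (embX α).isometry.isClosedEmbedding⟩

theorem IsCutoff.toSchwartz_comp_embX {κ : E3 → ℂ} (hκ : IsCutoff κ) (α : ℝ) :
    (hκ.comp_embX α).toSchwartz = restrictX α hκ.toSchwartz := by
  ext q; rfl

theorem sliceInt_congr_ae (α : ℝ) {G G' : E3 → ℂ} (h : G =ᵐ[volume] G') :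
    sliceInt α G =ᵐ[volume] sliceInt α G' := by
  filter_upwards [ae_sliceX α h] with η hη
  exact integral_congr_ae hη

/-- A cut-off acts on both sides by convolution, and `sliceInt_convFun` says that the slices of the
convolution on ℝ³ are the convolution on X with the restricted cut-off. -/
theorem isBoundaryValue_of_isGivenBy {α t r : ℝ} (ht : 1 / 2 < t) (hr : r = t - 1 / 2)
    {V : 𝓢'(E3, ℂ)} {v : 𝓢'(E2, ℂ)} {G : E3 → ℂ} (hV : IsGivenBy (𝓕 V) G)
    (hG : SlicePolyInt α G) (hv : IsGivenBy (𝓕 v) (sliceInt α G))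
    (hmem : ∀ a : 𝓢(E3, ℂ), MemLp (fun ξ => ((jap t ξ : ℝ) : ℂ) * convFun a G ξ) 2 volume) :
    IsBoundaryValue α t r V v := by
  intro κ hκ
  obtain ⟨B, hB, hBhat⟩ := exists_boundaryCLM α ht hr
  have h1 := hV.fourier_cutoffMul hκ hG.polyInt
  obtain ⟨u, hu⟩ := exists_sobolev_of_isGivenBy h1 (hmem _)
  refine ⟨(u, B u), (hB _).mpr rfl, hu, fourier_distr_injective ?_⟩
  have h2 := hv.fourier_cutoffMul (hκ.comp_embX α) hG.polyInt_sliceInt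
  rw [hκ.toSchwartz_comp_embX α] at h2
  refine (SobolevSpace.isGivenBy_fourier r (B u)).ext (h2.congr ?_)
  have h3 := SobolevSpace.hat_ae_eq (hu.symm ▸ h1)
  have h4 : (fun ξ => ((jap (-t) ξ : ℝ) : ℂ) * SobolevSpace.hat t u ξ) =ᵐ[volume]
      convFun (𝓕 hκ.toSchwartz : 𝓢(E3, ℂ)) G := by
    filter_upwards [h3] with ξ hξ
    rw [hξ, ← mul_assoc, ← Complex.ofReal_mul, jap_neg_mul]; simp
  filter_upwards [hBhat u, sliceInt_congr_ae α h4] with η h5 h6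
  rw [h5, h6, sliceInt_convFun _ hG, ← mul_assoc, ← Complex.ofReal_mul, jap_neg_mul]; simp

/-- As i is linear, the dilated cut-offs χ(a·) restrict to dilated cut-offs on X, and these exhaust
X as a → 0. For each of them the boundary operator is single-valued. -/
theorem IsBoundaryValue.unique {α t r : ℝ} (ht : 1 / 2 < t) (hr : r = t - 1 / 2)
    {V : 𝓢'(E3, ℂ)} {v v' : 𝓢'(E2, ℂ)} (h : IsBoundaryValue α t r V v)
    (h' : IsBoundaryValue α t r V v') : v = v' := by
  obtain ⟨B, hB, -⟩ := exists_boundaryCLM α ht hr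
  obtain ⟨χ, hχ, h1⟩ := exists_isCutoff_eq_one (E := E3)
  refine eq_of_cutoffMul_eq (hχ.comp_embX α) (fun x hx => h1 _ (by simpa using hx)) fun a ha => ?_
  obtain ⟨P, hP, hP1, hP2⟩ := h _ (hχ.comp_smul ha.ne')
  obtain ⟨P', hP', hP1', hP2'⟩ := h' _ (hχ.comp_smul ha.ne')
  have e1 : P.1 = P'.1 := SobolevSpace.toDistr_injective t (hP1.trans hP1'.symm)
  have e2 : P.2 = P'.2 := by rw [(hB P).mp hP, (hB P').mp hP', e1]
  simp only [map_smul]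
  rw [← hP2, ← hP2', e2]

theorem IsTraceOfD.unique {α s : ℝ} (hs : -1 < s) {f v v' : 𝓢'(E2, ℂ)} (h : IsTraceOfD α s f v)
    (h' : IsTraceOfD α s f v') : v = v' := by
  obtain ⟨V, hV, hv⟩ := h
  obtain ⟨V', hV', hv'⟩ := h'
  rw [hV'.unique hV] at hv'
  exact hv.unique (by linarith) (by ring) hv'

/-- The trace in terms of Fourier transforms: if `F` is the Fourier transform of `f`, then
`w(η) = -(4π²)⁻¹ ∫ k(η, ζ) F(ζ) dζ` is the Fourier transform of `i^!(D) f`. -/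
theorem exists_isTraceOfD {α s : ℝ} (hsin : Real.sin α ≠ 0) (hcos : Real.cos α ≠ 0)
    (hs : -1 < s) (hs0 : s < 0) {f : 𝓢'(E2, ℂ)} {F : E2 → ℂ} (hf : IsGivenBy (𝓕 f) F)
    (hFm : Measurable F) (hF : MemLp (fun ζ => ((‖ζ‖ ^ s : ℝ) : ℂ) * F ζ) 2 volume) :
    ∃ v w, IsTraceOfD α s f v ∧ IsGivenBy (𝓕 v) w ∧ PolyInt w ∧
      ∀ᵐ η, w η =
        ((-(4 * Real.pi ^ 2)⁻¹ : ℝ) : ℂ) * ∫ ζ, ((traceKernel α η ζ : ℝ) : ℂ) * F ζ := by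
  -- For s ≤ 0 the homogeneous weight dominates the bracket, so f also lies in H^s.
  have hF' := memLp_jap_mul_of_norm_rpow hs0.le hFm.aestronglyMeasurable hF
  have hFp := polyInt_of_memLp hF'
  have hG := slicePolyInt_invLapRot hsin hcos hs hs0 hFm hF
  obtain ⟨W, hW⟩ := (hFp.rotInt hFm α).exists_fourier
  obtain ⟨V, hV⟩ := hG.polyInt.exists_fourier
  obtain ⟨v, hv⟩ := hG.polyInt_sliceInt.exists_fourier
  refine ⟨v, _, ⟨V, ⟨W, isRotationIntegral_of_isGivenBy hf hFp hFm hW, _, hW, hV⟩,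
    isBoundaryValue_of_isGivenBy (by linarith) (by ring) hV hG hv fun a =>
      memLp_jap_convFun_invLapRot hs0 hFm hF' hG.polyInt a⟩, hv, hG.polyInt_sliceInt,
    ae_sliceInt_invLapRot hsin hcos hs hs0 hFm hF⟩

/-! ### Cut-off functions on the Fourier side -/

theorem measurable_convFun {a : 𝓢(E2, ℂ)} {g : E2 → ℂ} (hg : Measurable g) :
    Measurable (convFun a g) := by
  have h : StronglyMeasurable fun p : E2 × E2 => a (p.1 - p.2) * g p.2 :=
    ((a.continuous.measurable.comp (measurable_fst.sub measurable_snd)).mul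
      (hg.comp measurable_snd)).stronglyMeasurable
  exact (h.integral_prod_right (ν := volume)).measurable

theorem measurable_jap_mul_lp (s : ℝ) (h : Lp ℂ 2 (volume : Measure E2)) :
    Measurable fun ζ => ((jap s ζ : ℝ) : ℂ) * h ζ :=
  (by fun_prop : Measurable fun ζ : E2 => ((jap s ζ : ℝ) : ℂ)).mul
    (Lp.stronglyMeasurable h).measurable

theorem norm_rpow_mul_convFun_eq (s : ℝ) (a : E2 → ℂ) (h : E2 → ℂ) (ζ : E2) :
    ((‖ζ‖ ^ s : ℝ) : ℂ) * convFun a (fun ζ => ((jap (-s) ζ : ℝ) : ℂ) * h ζ) ζ =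
      ∫ ζ', multKernel s a ζ ζ' * h ζ' := by
  unfold convFun
  rw [← integral_const_mul]
  refine integral_congr_ae (Filter.Eventually.of_forall fun ζ' => ?_)
  simp only [multKernel]
  push_cast
  ring

theorem jap_mul_convFun_eq (r : ℝ) (b : E2 → ℂ) {w h : E2 → ℂ}
    (hw : ∀ᵐ η, ((‖η‖ ^ r : ℝ) : ℂ) * w η = h η) (η : E2) :
    ((jap r η : ℝ) : ℂ) * convFun b w η = ∫ η', multKernelOut r b η η' * h η' := by
  unfold convFun
  rw [← integral_const_mul]
  refine integral_congr_ae ?_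
  filter_upwards [hw, show ∀ᵐ η : E2, η ≠ 0 by simp [ae_iff]] with η' h1 h2
  have e : ((‖η'‖ ^ (-r) : ℝ) : ℂ) * ((‖η'‖ ^ r : ℝ) : ℂ) = 1 := by
    rw [← Complex.ofReal_mul, ← Real.rpow_add (norm_pos_iff.mpr h2)]; simp
  rw [← h1]
  simp only [multKernelOut]
  push_cast
  linear_combination (-((jap r η : ℝ) : ℂ) * b (η - η') * w η') * e

/-- Inversion at the origin. This is how the vanishing of φ at the fixed point becomes the
cancellation condition ∫ a = 0. -/
theorem integral_fourier_schwartz {E : Type*} [NormedAddCommGroup E] [InnerProductSpace ℝ E]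
    [FiniteDimensional ℝ E] [MeasurableSpace E] [BorelSpace E] (ψ : 𝓢(E, ℂ)) :
    ∫ ξ, (𝓕 ψ : 𝓢(E, ℂ)) ξ = ψ 0 := by
  have h : (𝓕⁻ (𝓕 ψ : 𝓢(E, ℂ)) : 𝓢(E, ℂ)) 0 = ψ 0 := by
    rw [FourierTransform.fourierInv_fourier_eq]
  rw [← h, SchwartzMap.fourierInv_coe, Real.fourierInv_eq']
  simp

/-- `χ i^!(D) φ` is a bounded operator, which is compact if `φ` vanishes at the origin. -/
theorem exists_cutoff_trace_clm {α s : ℝ} (hsin : Real.sin α ≠ 0) (hcos : Real.cos α ≠ 0)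
    (hs : -1 < s) (hs0 : s < 0) {φ χ : E2 → ℂ} (hφ : IsCutoff φ) (hχ : IsCutoff χ) :
    ∃ K : SobolevSpace E2 s →L[ℂ] SobolevSpace E2 (s + 1),
      (∀ u : SobolevSpace E2 s, ∃ v,
        IsTraceOfD α s (cutoffMul φ (SobolevSpace.toDistr s u)) v ∧
          SobolevSpace.toDistr (s + 1) (K u) = cutoffMul χ v) ∧
      (φ 0 = 0 → IsCompactOperator K) := by
  set a : 𝓢(E2, ℂ) := 𝓕 hφ.toSchwartz
  set b : 𝓢(E2, ℂ) := 𝓕 hχ.toSchwartz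
  -- Of the twelve powers, nine pay for `regKernel_sub_le` and three keep the integral over the
  -- plane convergent.
  obtain ⟨Da, hDa, ha⟩ := schwartz_decay a 12
  obtain ⟨Db, hDb, hb⟩ := schwartz_decay b 12
  have ham : Measurable a := a.continuous.measurable
  obtain ⟨CM, hCM, hM⟩ := kerBound_multKernel hs hs0 ham hDa ha
  obtain ⟨CK, hCK, hK⟩ := kerBound_traceKernel hsin hcos (a := s + 1) (by linarith) (by linarith)
  obtain ⟨CO, hCO, hO⟩ := kerBound_multKernelOut (r := s + 1) (by linarith) (by linarith)
    b.continuous.measurable hDb hb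
  obtain ⟨TM, -, hTM⟩ := hM.exists_clm hCM
  obtain ⟨TK, -, hTK⟩ := hK.exists_clm hCK
  obtain ⟨TO, -, hTO⟩ := hO.exists_clm hCO
  set c₀ : ℂ := ((-(4 * Real.pi ^ 2)⁻¹ : ℝ) : ℂ)
  -- Read from the right: the isometry of H^s onto L², multiplication by φ into the weight |ζ|^s,
  -- the trace kernel into the weight |η|^{s+1}, multiplication by χ back to the weight ⟨η⟩^{s+1},
  -- and the isometry back to H^{s+1}.
  refine ⟨((SobolevSpace.hatEquiv (E := E2) (s + 1)).symm.toContinuousLinearEquiv :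
      Lp ℂ 2 (volume : Measure E2) →L[ℂ] SobolevSpace E2 (s + 1)) ∘L TO ∘L (c₀ • (TK ∘L TM)) ∘L
      ((SobolevSpace.hatEquiv (E := E2) s).toContinuousLinearEquiv :
        SobolevSpace E2 s →L[ℂ] Lp ℂ 2 (volume : Measure E2)), fun u => ?_, fun h0 => ?_⟩
  · set h := SobolevSpace.hat s u
    set F : E2 → ℂ := convFun a (fun ζ => ((jap (-s) ζ : ℝ) : ℂ) * h ζ)
    have hFm : Measurable F := measurable_convFun (measurable_jap_mul_lp _ _)
    have hf : IsGivenBy (𝓕 (cutoffMul φ (SobolevSpace.toDistr s u))) F :=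
      (SobolevSpace.isGivenBy_fourier s u).fourier_cutoffMul hφ (Lp.polyInt_jap_mul s h)
    have hTMF : TM h =ᵐ[volume] fun ζ => ((‖ζ‖ ^ s : ℝ) : ℂ) * F ζ := by
      filter_upwards [hTM h] with ζ hζ
      rw [hζ, norm_rpow_mul_convFun_eq]
    have hF : MemLp (fun ζ => ((‖ζ‖ ^ s : ℝ) : ℂ) * F ζ) 2 volume :=
      (Lp.memLp (TM h)).ae_eq hTMF
    obtain ⟨v, w, hv, hvw, hwp, hw⟩ := exists_isTraceOfD hsin hcos hs hs0 hf hFm hF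
    refine ⟨v, hv, fourier_distr_injective ?_⟩
    have hwK : ∀ᵐ η, ((‖η‖ ^ (s + 1) : ℝ) : ℂ) * w η = (c₀ • TK (TM h)) η := by
      filter_upwards [hw, Lp.coeFn_smul c₀ (TK (TM h)), hTK (TM h)] with η h1 h2 h3
      rw [h1, h2, Pi.smul_apply, h3, smul_eq_mul, mul_left_comm, ← integral_const_mul]
      congr 1
      refine integral_congr_ae ?_
      filter_upwards [hTMF, show ∀ᵐ ζ : E2, ζ ≠ 0 by simp [ae_iff]] with ζ h4 h5
      have e : ((‖ζ‖ ^ (1 - (s + 1)) : ℝ) : ℂ) * ((‖ζ‖ ^ s : ℝ) : ℂ) = 1 := by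
        rw [← Complex.ofReal_mul, ← Real.rpow_add (norm_pos_iff.mpr h5)]; simp
      rw [h4]
      simp only [weightedKernel]
      push_cast
      linear_combination (-((‖η‖ ^ (s + 1) : ℝ) : ℂ) * ((traceKernel α η ζ : ℝ) : ℂ) * F ζ) * e
    refine (SobolevSpace.isGivenBy_fourier (s + 1) _).ext
      ((hvw.fourier_cutoffMul hχ hwp).congr ?_)
    have e1 : SobolevSpace.hat (s + 1) ((((SobolevSpace.hatEquiv (E := E2) (s + 1)).symm.toContinuousLinearEquiv :
        Lp ℂ 2 (volume : Measure E2) →L[ℂ] SobolevSpace E2 (s + 1)) ∘L TO ∘L (c₀ • (TK ∘L TM)) ∘L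
      ((SobolevSpace.hatEquiv (E := E2) s).toContinuousLinearEquiv :
        SobolevSpace E2 s →L[ℂ] Lp ℂ 2 (volume : Measure E2))) u) = TO (c₀ • TK (TM h)) := by
      rw [← SobolevSpace.hatEquiv_apply]
      exact (SobolevSpace.hatEquiv (s + 1)).apply_symm_apply _
    rw [e1]
    filter_upwards [hTO (c₀ • TK (TM h))] with η hη
    rw [hη, ← jap_mul_convFun_eq (s + 1) b hwK, ← mul_assoc, ← Complex.ofReal_mul, jap_neg_mul]
    simp [b]
  · have hint : ∫ ξ, a ξ = 0 := by
      rw [integral_fourier_schwartz, hφ.toSchwartz_apply, h0]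
    have hc := isCompactOperator_comp hsin hcos hs hs0 ham hDa ha hint TK TM hTK hTM
    have h1 : IsCompactOperator (c₀ • (TK ∘L TM)) := hc.smul c₀
    have h2 := h1.comp_clm ((SobolevSpace.hatEquiv (E := E2) s).toContinuousLinearEquiv :
      SobolevSpace E2 s →L[ℂ] Lp ℂ 2 (volume : Measure E2))
    have h3 := h2.clm_comp TO
    exact h3.clm_comp ((SobolevSpace.hatEquiv (E := E2) (s + 1)).symm.toContinuousLinearEquiv :
      Lp ℂ 2 (volume : Measure E2) →L[ℂ] SobolevSpace E2 (s + 1))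

theorem embX_preimage_zero (α : ℝ) : embX α ⁻¹' {0} = {0} := by
  ext q
  exact map_eq_zero_iff (embX α) (embX α).injective

/-! ### The geometry of the tilted plane -/

theorem mem_planeX {α : ℝ} {p : E3} :
    p ∈ planeX α ↔ -(p 0) * Real.sin α + p 2 * Real.cos α = 0 := Iff.rfl

theorem E3.eq_zero_iff {p : E3} : p = 0 ↔ p 0 = 0 ∧ p 1 = 0 ∧ p 2 = 0 := by
  constructor
  · rintro rfl; simp
  · rintro ⟨h0, h1, h2⟩
    ext j; fin_cases j <;> simp [h0, h1, h2]

theorem planeX_inter_axisOZ {α : ℝ} (hcos : Real.cos α ≠ 0) :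
    (planeX α : Set E3) ∩ axisOZ = {0} := by
  ext p
  simp only [Set.mem_inter_iff, SetLike.mem_coe, mem_planeX, axisOZ, Set.mem_ofPred_eq,
    Set.mem_singleton_iff, E3.eq_zero_iff]
  constructor
  · rintro ⟨h, h0, h1⟩
    refine ⟨h0, h1, ?_⟩
    simpa [h0, hcos] using h
  · rintro ⟨h0, h1, h2⟩
    simp [h0, h1, h2]

theorem hasDerivAt_rotZ (p : E3) :
    HasDerivAt (fun θ => rotZ θ p) (!₂[-(p 1), p 0, 0] : E3) 0 := by
  have e : (fun θ => rotZ θ p) = fun θ => Real.cos θ • (!₂[p 0, p 1, 0] : E3) +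
      Real.sin θ • (!₂[-(p 1), p 0, 0] : E3) + !₂[0, 0, p 2] := by
    ext θ j
    rw [rotZ_apply]
    fin_cases j <;> simp <;> ring
  rw [e]
  have h := (((Real.hasDerivAt_cos 0).smul_const (!₂[p 0, p 1, 0] : E3)).add
    ((Real.hasDerivAt_sin 0).smul_const (!₂[-(p 1), p 0, 0] : E3))).add_const (!₂[0, 0, p 2] : E3)
  simpa using h

theorem orbitTangentSet_eq {α : ℝ} (hsin : Real.sin α ≠ 0) : orbitTangentSet α =
    {p : E3 | p 1 = 0 ∧ -(p 0) * Real.sin α + p 2 * Real.cos α = 0} := by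
  ext p
  simp only [orbitTangentSet, Set.mem_ofPred_eq, (hasDerivAt_rotZ p).deriv,
    Submodule.span_singleton_le_iff_mem, mem_planeX]
  simp [hsin, and_comm]

theorem orbitInSet_eq {α : ℝ} (hsin : Real.sin α ≠ 0) (hcos : Real.cos α ≠ 0) :
    orbitInSet α = {0} := by
  ext p
  simp only [orbitInSet, Set.mem_ofPred_eq, Set.mem_singleton_iff, Set.range_subset_iff,
    SetLike.mem_coe, mem_planeX, rotZ_apply]
  constructor
  · rintro ⟨h, hθ⟩
    -- Besides p itself, the quarter turn and the half turn already force p = 0.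
    have h1 := hθ (Real.pi / 2)
    have h2 := hθ Real.pi
    simp at h1 h2
    have h3 : p 0 * Real.sin α = 0 := by linarith
    have h0 : p 0 = 0 := (mul_eq_zero.mp h3).resolve_right hsin
    have h4 : p 2 * Real.cos α = 0 := by rw [h0] at h; linarith
    have h5 : p 2 = 0 := (mul_eq_zero.mp h4).resolve_right hcos
    have h6 : p 1 * Real.sin α = 0 := by rw [h5] at h1; linarith
    exact E3.eq_zero_iff.mpr ⟨h0, (mul_eq_zero.mp h6).resolve_right hsin, h5⟩
  · rintro rfl
    simp

theorem mainTheorem4 (α : ℝ) (hsin : Real.sin α ≠ 0) (hcos : Real.cos α ≠ 0) :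
    (planeX α : Set E3) ∩ axisOZ = {0} ∧
    orbitTangentSet α = {p : E3 | p 1 = 0 ∧ -(p 0) * Real.sin α + p 2 * Real.cos α = 0} ∧
    orbitInSet α = {0} ∧
    ∀ s : ℝ, s ∈ Set.Ioo (-1 : ℝ) 0 →
      IsLocalOperator (IsTraceOfD α s) s (s + 1) ∧
      IsLocalizedOn (IsTraceOfD α s) s (s + 1) (embX α ⁻¹' {0}) := by
  refine ⟨planeX_inter_axisOZ hcos, orbitTangentSet_eq hsin, orbitInSet_eq hsin hcos,
    fun s hs => ⟨⟨fun f v v' h h' => h.unique hs.1 h', fun φ χ hφ hχ => ?_⟩,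
      fun φ χ hφ hχ h0 => ?_⟩⟩
  · obtain ⟨K, hK, -⟩ := exists_cutoff_trace_clm hsin hcos hs.1 hs.2 hφ hχ
    exact ⟨K, hK⟩
  · obtain ⟨K, hK, hc⟩ := exists_cutoff_trace_clm hsin hcos hs.1 hs.2 hφ hχ
    rw [embX_preimage_zero, nhdsSet_singleton] at h0
    exact ⟨K, hc h0.self_of_nhds, hK⟩
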